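/- **Setting.** Let $Y=\bigsqcup_{j=1}^J Y_j$, with $Y_j\subset\mathbb R^d$ bounded, open and contractible, and let $\mathcal U\Subset T^*Y\subset\bigsqcup_{j=1}^J T^*\mathbb R^d$ be open. ($A\Subset B$ means that $\overline A$ is a compact subset of the interior of $B$.) Let $F\subset\mathcal U\times\mathcal U$ be an open canonical transformation: the restriction to a compact set $\widetilde D\subset\mathcal U$ of a smooth symplectomorphism between open sets, with $F(\widetilde D)\subset\mathcal U$. Let $\mathcal T_\pm=\{\rho\in\mathcal U: F^{\mp n}(\rho)\text{ is defined in }\mathcal U\text{ for all }n\ge 0\}$ be the outgoing and incoming tails and $\mathcal T=\mathcal T_+\cap\mathcal T_-$ the trapped set. Assume that $\mathcal T$ is nonempty, contained in the interior of $\widetilde D$, and hyperbolic: for $\rho\in\mathcal T$ there is a splitting $\mathbb R^{2d}=E^+_\rho\oplus E^-_\rho$, continuous in $\rho$, with $\dim E^\pm_\rho=d$, $dF_\rho(E^\pm_\rho)=E^\pm_{F(\rho)}$, and constants $C$ and $0<\theta<1$ such that $\|dF^{\pm n}_\rho v\|\le C\theta^n\|v\|$ for all $\rho\in\mathcal T$,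 $n\ge0$, $v\in E^\mp_\rho$. Let $d(\cdot,\cdot)$ be the distance on $\bigsqcup_j T^*\mathbb R^d$ which is Euclidean inside each copy of $T^*\mathbb R^d$ and equals $1$ plus the Euclidean distance of the coordinates for points in different copies, and let $\langle t\rangle=(1+t^2)^{1/2}$. Constants are independent of $\epsilon$, and $a\sim b$ means $b/C\le a\le Cb$ for such a constant $C\ge1$. **Regularized distances.** Let $\mathcal V\Subset\widetilde D$ be an open neighbourhood of $\mathcal T$, let $\mathcal V'=\mathcal V\cup F(\mathcal V)$, and let $0<\epsilon_0<1$. A *regularized pair* on $\mathcal V$ is a family of functions $\widehat\varphi_\pm=\widehat\varphi_{\pm,\epsilon}\in C^\infty(\mathcal V';[\epsilon,\infty))$, $0<\epsilon<\epsilon_0$, such that, uniformly in $\epsilon$, on $\mathcal V'$ $$\widehat\varphi_\pm\sim d(\cdot,\mathcal T_\pm)^2+\epsilon,\qquad \widehat\varphi_++\widehat\varphi_-\sim d(\cdot,\mathcal T)^2+\epsilon,\qquad \partial^\alpha\widehat\varphi_\pm=O(\widehat\varphi_\pm^{\,1-|\alpha|/2}),$$ and on $\mathcal V$, for some $C_0>0$,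 $\ \pm(\widehat\varphi_\pm-\widehat\varphi_\pm\circ F)+C_0\epsilon\sim\widehat\varphi_\pm$. **Proposition.** (a) Every neighbourhood of $\mathcal T$ compactly contains a neighbourhood $\mathcal V$ that carries a regularized pair. (b) Let $\widehat\varphi_\pm$ be any regularized pair on $\mathcal V$. There is $M_0>0$ such that for every $M\ge M_0$ there is $C_1>0$ with the following properties. Put $$\widehat G=\log(M\epsilon+\widehat\varphi_-)-\log(M\epsilon+\widehat\varphi_+)\quad\text{on }\mathcal V',$$ and let $\mathcal W_2,\mathcal W_3$ be neighbourhoods of $\mathcal T$ with $\mathcal W_2\Subset\mathcal V\Subset\mathcal W_3\Subset\widetilde D$. There exists $g_0\in C_c^\infty(T^*Y;\mathbb R)$ that vanishes on some neighbourhood $\mathcal W_1\Subset\mathcal W_2$ of $\mathcal T$ and satisfies $$g_0\circ F-g_0\ge0\ \text{ on }\mathcal W_3,\qquad g_0\circ F-g_0\ge1\ \text{ on }\mathcal W_3\setminus\mathcal W_2 .$$ Moreover, for every such $g_0$ and every real-valued $\chi\in C_c^\infty(\mathcal V')$ equal to $1$ on $\mathcal W_2\cup F(\mathcal W_2)$,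 if $C_5$ is large enough (independently of $\epsilon$), there are constants $C_6,C_7,C_8,C_9>0$ and $N_1$ such that for all $0<\epsilon<\epsilon_0$ the function $$G=\chi\widehat G+C_5\log(1/\epsilon)\,g_0$$ belongs to $C_c^\infty(T^*Y)$ and satisfies $$|G(\rho)|\le C_6\log(1/\epsilon),\qquad \partial^\alpha G=O(\epsilon^{-|\alpha|/2})\quad(|\alpha|\ge1),$$ $$\rho\in\mathcal W_2\ \Longrightarrow\ G(F(\rho))-G(\rho)\ge -C_7,$$ $$\rho\in\mathcal W_2,\ d(\rho,\mathcal T)^2\ge C_1\epsilon\ \Longrightarrow\ G(F(\rho))-G(\rho)\ge 1/C_1,$$ $$\rho\in\mathcal W_3\setminus\mathcal W_2\ \Longrightarrow\ G(F(\rho))-G(\rho)\ge C_8\log(1/\epsilon),$$ and, for all $\rho,\mu\in\bigsqcup_j T^*\mathbb R^d$, $$\frac{e^{G(\rho)}}{e^{G(\mu)}}\le C_9\Big\langle\frac{d(\rho,\mu)}{\sqrt\epsilon}\Big\rangle^{N_1}.$$ -/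

import Mathlib

open Set
open scoped ContDiff

noncomputable section

/-- The cotangent space `T*ℝ^d = ℝ^{2d}` with its Euclidean norm: the coordinates `Sum.inl i` are the
positions `x_i`, the coordinates `Sum.inr i` are the momenta `ξ_i`. -/
abbrev CotSpace (d : ℕ) : Type := EuclideanSpace ℝ (Fin d ⊕ Fin d)

/-- The position `x` of `(x, ξ)`. -/
def position {d : ℕ} (v : CotSpace d) : EuclideanSpace ℝ (Fin d) :=
  WithLp.toLp 2 (fun i => v (Sum.inl i))

/-- The standard symplectic form `σ = ∑ dξ_i ∧ dx_i`. -/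
def symplForm {d : ℕ} (u v : CotSpace d) : ℝ :=
  ∑ i : Fin d, (u (Sum.inr i) * v (Sum.inl i) - u (Sum.inl i) * v (Sum.inr i))

/-- The disjoint union of `J` copies of `T*ℝ^d` (the topology on `Fin J` is discrete). -/
abbrev PhaseSpace (d J : ℕ) : Type := Fin J × CotSpace d

section Phase

variable {d J : ℕ}

/-- The distance on the disjoint union: the Euclidean distance inside each copy; points in
different copies are at distance at least one. -/
def phaseDist (ρ μ : PhaseSpace d J) : ℝ :=
  (if ρ.1 = μ.1 then 0 else 1) + dist ρ.2 μ.2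

/-- The distance of a point to a (nonempty) set. -/
def distTo (ρ : PhaseSpace d J) (A : Set (PhaseSpace d J)) : ℝ :=
  sInf ((fun μ => phaseDist ρ μ) '' A)

/-- `A ⋐ B`: the closure of `A` is a compact subset of the interior of `B`. -/
def CompactlyIn (A B : Set (PhaseSpace d J)) : Prop :=
  IsCompact (closure A) ∧ closure A ⊆ interior B

/-- A real function is `C^∞` on an open subset of the disjoint union. -/
def SmoothOn (φ : PhaseSpace d J → ℝ) (V : Set (PhaseSpace d J)) : Prop :=
  ∀ j : Fin J, ContDiffOn ℝ ∞ (fun x : CotSpace d => φ (j, x)) {x | (j, x) ∈ V}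

/-- The size of the derivatives of order `n` at `ρ`. -/
def derivNorm (n : ℕ) (φ : PhaseSpace d J → ℝ) (ρ : PhaseSpace d J) : ℝ :=
  ‖iteratedFDeriv ℝ n (fun x : CotSpace d => φ (ρ.1, x)) ρ.2‖

/-- The tangent map at `ρ` of a map between open subsets of the disjoint union. -/
def derivMap (Φ : PhaseSpace d J → PhaseSpace d J) (ρ : PhaseSpace d J) :
    CotSpace d →L[ℝ] CotSpace d :=
  fderiv ℝ (fun x : CotSpace d => (Φ (ρ.1, x)).2) ρ.2

/-- The tangent map of the `n`-th iterate, along the orbit of `ρ`. -/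
def derivMapIter (Φ : PhaseSpace d J → PhaseSpace d J) :
    ℕ → PhaseSpace d J → (CotSpace d →L[ℝ] CotSpace d)
  | 0, _ => ContinuousLinearMap.id ℝ (CotSpace d)
  | n + 1, ρ => (derivMapIter Φ n (Φ ρ)).comp (derivMap Φ ρ)

end Phase

/-- An open canonical transformation `F ⊆ U × U`: the restriction to a compact set `D` (the
departure set, `π_R(F)`) of a smooth symplectomorphism `Φ` between open sets. `U` is the local phase
space, relatively compact in `T*Y`, where `Y` is a disjoint union of bounded contractible open
subsets of `ℝ^d`. -/
structure OpenMap (d J : ℕ) where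
  Y : Fin J → Set (EuclideanSpace ℝ (Fin d))
  isOpen_Y : ∀ j, IsOpen (Y j)
  bounded_Y : ∀ j, Bornology.IsBounded (Y j)
  contractible_Y : ∀ j, ContractibleSpace (Y j)
  U : Set (PhaseSpace d J)
  isOpen_U : IsOpen U
  U_compactlyIn : CompactlyIn U {ρ | position ρ.2 ∈ Y ρ.1}
  Φ : OpenPartialHomeomorph (PhaseSpace d J) (PhaseSpace d J)
  smooth : ∀ ρ ∈ Φ.source, ContDiffAt ℝ ∞ (fun x : CotSpace d => (Φ (ρ.1, x)).2) ρ.2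
  symplectic : ∀ ρ ∈ Φ.source, ∀ u v : CotSpace d,
    symplForm (derivMap Φ ρ u) (derivMap Φ ρ v) = symplForm u v
  D : Set (PhaseSpace d J)
  isCompact_D : IsCompact D
  D_subset_source : D ⊆ Φ.source
  D_subset_U : D ⊆ U
  image_subset_U : Φ '' D ⊆ U

namespace OpenMap

variable {d J : ℕ}

/-- The phase space `T*Y` over the configuration space `Y`. -/
def cotY (F : OpenMap d J) : Set (PhaseSpace d J) := {ρ | position ρ.2 ∈ F.Y ρ.1}

/-- `(ρ', ρ) ∈ F`, that is, `F(ρ)` is defined and equal to `ρ'`. -/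
def Rel (F : OpenMap d J) (ρ' ρ : PhaseSpace d J) : Prop := ρ ∈ F.D ∧ ρ' = F.Φ ρ

/-- `(ρ', ρ) ∈ F^n`, with the usual composition of relations. -/
def RelIter (F : OpenMap d J) : ℕ → PhaseSpace d J → PhaseSpace d J → Prop
  | 0, ρ', ρ => ρ' = ρ
  | n + 1, ρ', ρ => ∃ σ, F.RelIter n ρ' σ ∧ F.Rel σ ρ

/-- The incoming tail `𝒯₋`: all the forward iterates are defined. -/
def tailMinus (F : OpenMap d J) : Set (PhaseSpace d J) :=
  {ρ | ∀ n : ℕ, ∃ ρ' ∈ F.U, ρ ∈ F.U ∧ F.RelIter n ρ' ρ}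

/-- The outgoing tail `𝒯₊`: all the backward iterates are defined. -/
def tailPlus (F : OpenMap d J) : Set (PhaseSpace d J) :=
  {ρ | ∀ n : ℕ, ∃ ρ' ∈ F.U, ρ ∈ F.U ∧ F.RelIter n ρ ρ'}

/-- The trapped set `𝒯`. -/
def trapped (F : OpenMap d J) : Set (PhaseSpace d J) := F.tailPlus ∩ F.tailMinus

/-- The trapped set is a hyperbolic set for `F`. Continuity of a family of subspaces is
continuity of the orthogonal projections onto them. -/
def IsHyperbolic (F : OpenMap d J) : Prop :=
  ∃ Eplus Eminus : PhaseSpace d J → Submodule ℝ (CotSpace d),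
    ContinuousOn (fun ρ => (Eplus ρ).starProjection) F.trapped ∧
    ContinuousOn (fun ρ => (Eminus ρ).starProjection) F.trapped ∧
    (∀ ρ ∈ F.trapped, IsCompl (Eplus ρ) (Eminus ρ) ∧
      Module.finrank ℝ (Eplus ρ) = d ∧ Module.finrank ℝ (Eminus ρ) = d ∧
      (Eplus ρ).map (derivMap F.Φ ρ : CotSpace d →ₗ[ℝ] CotSpace d) = Eplus (F.Φ ρ) ∧
      (Eminus ρ).map (derivMap F.Φ ρ : CotSpace d →ₗ[ℝ] CotSpace d) = Eminus (F.Φ ρ)) ∧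
    ∃ C θ : ℝ, 0 < θ ∧ θ < 1 ∧ ∀ ρ ∈ F.trapped, ∀ n : ℕ,
      (∀ v ∈ Eminus ρ, ‖derivMapIter F.Φ n ρ v‖ ≤ C * θ ^ n * ‖v‖) ∧
      (∀ v ∈ Eplus ρ, ‖derivMapIter F.Φ.symm n ρ v‖ ≤ C * θ ^ n * ‖v‖)

/-- `g ∈ C^∞_c(T*Y; ℝ)`. -/
def IsTest (F : OpenMap d J) (g : PhaseSpace d J → ℝ) : Prop :=
  SmoothOn g univ ∧ HasCompactSupport g ∧ tsupport g ⊆ F.cotY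

/-- `V' = V ∪ F(V)`. -/
def enlarge (F : OpenMap d J) (V : Set (PhaseSpace d J)) : Set (PhaseSpace d J) := V ∪ F.Φ '' V

/-- `φ₊ ε`, `φ₋ ε`, for `0 < ε < ε₀`, are regularizations, at scale `√ε` and near the trapped set,
of the squared distances to the outgoing tail `𝒯₊` and to the incoming tail `𝒯₋`: smooth
functions `V ∪ F(V) → [ε, ∞)` with, uniformly in `ε`,
`φ± ∼ d(·, 𝒯±)² + ε`, `±(φ± - φ± ∘ F) + C₀ ε ∼ φ±` on `V`, `∂^α φ± = O(φ±^{1 - |α|/2})` and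
`φ₊ + φ₋ ∼ d(·, 𝒯)² + ε`. -/
def IsRegularizedPair (F : OpenMap d J) (V : Set (PhaseSpace d J)) (ε₀ : ℝ)
    (φp φm : ℝ → PhaseSpace d J → ℝ) : Prop :=
  IsOpen V ∧ F.trapped ⊆ V ∧ CompactlyIn V F.D ∧ 0 < ε₀ ∧ ε₀ < 1 ∧
  ∃ C₀ C : ℝ, ∃ K : ℕ → ℝ, 0 < C₀ ∧ 1 ≤ C ∧ ∀ ε : ℝ, 0 < ε → ε < ε₀ →
    SmoothOn (φp ε) (F.enlarge V) ∧ SmoothOn (φm ε) (F.enlarge V) ∧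
    (∀ ρ ∈ F.enlarge V,
      ε ≤ φp ε ρ ∧ ε ≤ φm ε ρ ∧
      (distTo ρ F.tailPlus ^ 2 + ε) / C ≤ φp ε ρ ∧
      φp ε ρ ≤ C * (distTo ρ F.tailPlus ^ 2 + ε) ∧
      (distTo ρ F.tailMinus ^ 2 + ε) / C ≤ φm ε ρ ∧
      φm ε ρ ≤ C * (distTo ρ F.tailMinus ^ 2 + ε) ∧
      (distTo ρ F.trapped ^ 2 + ε) / C ≤ φp ε ρ + φm ε ρ ∧
      φp ε ρ + φm ε ρ ≤ C * (distTo ρ F.trapped ^ 2 + ε) ∧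
      ∀ n : ℕ, derivNorm n (φp ε) ρ ≤ K n * φp ε ρ ^ (1 - (n : ℝ) / 2) ∧
        derivNorm n (φm ε) ρ ≤ K n * φm ε ρ ^ (1 - (n : ℝ) / 2)) ∧
    (∀ ρ ∈ V,
      φp ε ρ / C ≤ (φp ε ρ - φp ε (F.Φ ρ)) + C₀ * ε ∧
      (φp ε ρ - φp ε (F.Φ ρ)) + C₀ * ε ≤ C * φp ε ρ ∧
      φm ε ρ / C ≤ -(φm ε ρ - φm ε (F.Φ ρ)) + C₀ * ε ∧
      -(φm ε ρ - φm ε (F.Φ ρ)) + C₀ * ε ≤ C * φm ε ρ)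

/-- An escape function `g` away from the trapped set: it vanishes near the trapped set, does not
decrease along `F` on `W₃`, and increases at least by one on `W₃ ∖ W₂`. -/
def IsOuterEscape (F : OpenMap d J) (W₂ W₃ : Set (PhaseSpace d J))
    (g : PhaseSpace d J → ℝ) : Prop :=
  F.IsTest g ∧
  (∃ W₁, F.trapped ⊆ interior W₁ ∧ CompactlyIn W₁ W₂ ∧ ∀ ρ ∈ W₁, g ρ = 0) ∧
  (∀ ρ ∈ W₃, 0 ≤ g (F.Φ ρ) - g ρ) ∧
  (∀ ρ ∈ W₃ \ W₂, 1 ≤ g (F.Φ ρ) - g ρ)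

end OpenMap

/-- `Ĝ = log (M ε + φ₋) - log (M ε + φ₊)`. -/
def innerEscape {d J : ℕ} (φp φm : ℝ → PhaseSpace d J → ℝ) (M ε : ℝ) (ρ : PhaseSpace d J) : ℝ :=
  Real.log (M * ε + φm ε ρ) - Real.log (M * ε + φp ε ρ)

/-- `G = χ Ĝ + C₅ log(1/ε) g₀`. -/
def escapeFunction {d J : ℕ} (φp φm : ℝ → PhaseSpace d J → ℝ) (χ g₀ : PhaseSpace d J → ℝ)
    (M C₅ ε : ℝ) (ρ : PhaseSpace d J) : ℝ :=
  χ ρ * innerEscape φp φm M ε ρ + C₅ * Real.log (1 / ε) * g₀ ρ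

end

open Set
open scoped ContDiff

noncomputable section

/-! ### The phase space as a proper metric space -/

section PhaseMetric

variable {d J : ℕ}

/-! Everything rests on two facts near the trapped set `𝒯`. Expansion: some power of `F` at least
doubles the distance to `𝒯₋`, and by time reversal some power of the inverse does so for `𝒯₊`
(`exists_expansion`). Transversality: the distance to `𝒯` is bounded by a constant times the sum of
the distances to the two tails (`exists_transversality`). Both are proved by shadowing, without
invariant manifolds. A pseudo-orbit near `𝒯` with a single jump can be corrected to a true orbit,
and the correction is bounded by a multiple of the jump (`exists_orbit_near_zero`). If the jump goes
from `F^m(ρ)` to its nearest point of `𝒯₋`, the corrected starting point lies in `𝒯₋` and is at most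
half a jump away from `ρ`. If the jump goes from the backward orbit of a point of `𝒯₊` to the
forward orbit of a point of `𝒯₋`, the corrected point is in `𝒯`.

For (a), summing the distance to `𝒯₋` along `m` iterates gives a Lipschitz function `D`, comparable
to that distance, which one step of `F` multiplies by at least `1 + c` (`exists_adapted_distance`).
The function `√(D² + ε)` has the Lipschitz constant of `D`, whatever `ε` is, and averaging at a
scale proportional to its own value smooths its square, with all the symbol estimates and with a
relative error at most `c` (`exists_regularization`). Squaring makes the dynamical gain `(1 + c)²`,
which beats this error; what remains is `O(ε)`.

For (b), adding `Mε` inside the logarithms turns the error `C₀ε` into a relative error of size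
`C₀/M`. Away from `𝒯` at scale `√ε` one of `φ₊`, `φ₋` exceeds `Mε` and its logarithm gains a fixed
amount, while the other loses at most half as much (`exists_gain`). A point of the departure set
outside `𝒯` leaves it in the future or in the past, so near such a point the equation `g ∘ F - g =
ψ` is solved by a finite sum along the orbit. Finitely many solutions add up to `g₀`
(`exists_isOuterEscape`). The cut-off inner function is `O(log(1/ε))`, so a large multiple of
`log(1/ε) g₀` dominates it outside `W₂` (`escapeFunction_estimates`). The final ratio bound holds
because `φ±` are comparable to squared distances plus `ε`, and because `log(1/ε) δ ≤ log(1 + δ²/ε) +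
2` for `0 ≤ δ ≤ 1`. -/

lemma isOpen_phase_iff (s : Set (PhaseSpace d J)) :
    IsOpen s ↔ ∀ x ∈ s, ∃ ε > 0, ∀ y, phaseDist x y < ε → y ∈ s := by
  constructor
  · rintro hs ⟨j, x⟩ hx
    have h1 : IsOpen {y : CotSpace d | (j, y) ∈ s} := hs.preimage (by fun_prop)
    obtain ⟨ε, hε, hb⟩ := Metric.isOpen_iff.1 h1 x hx
    refine ⟨min ε 1, by positivity, ?_⟩
    rintro ⟨k, y⟩ hy
    have hjk : j = k := by
      by_contra h
      have h2 : phaseDist (j, x) (k, y) = 1 + dist x y := by simp [phaseDist, h]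
      have := lt_of_lt_of_le hy (min_le_right _ _)
      have h3 : 0 ≤ dist x y := dist_nonneg
      linarith
    subst hjk
    have h2 : phaseDist (j, x) (j, y) = dist x y := by simp [phaseDist]
    apply hb
    rw [Metric.mem_ball, dist_comm, ← h2]
    exact lt_of_lt_of_le hy (min_le_left _ _)
  · intro h
    rw [isOpen_iff_mem_nhds]
    rintro ⟨j, x⟩ hx
    obtain ⟨ε, hε, hb⟩ := h _ hx
    rw [nhds_prod_eq, nhds_discrete]
    refine Filter.mem_prod_iff.2 ⟨{j}, by simp, Metric.ball x ε, Metric.ball_mem_nhds _ hε, ?_⟩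
    rintro ⟨k, y⟩ ⟨hk, hy⟩
    obtain rfl : k = j := hk
    apply hb
    rw [Metric.mem_ball, dist_comm] at hy
    simpa [phaseDist] using hy

lemma phaseDist_self (x : PhaseSpace d J) : phaseDist x x = 0 := by simp [phaseDist]

lemma phaseDist_comm (x y : PhaseSpace d J) : phaseDist x y = phaseDist y x := by
  simp [phaseDist, dist_comm, eq_comm]

lemma phaseDist_triangle (x y z : PhaseSpace d J) :
    phaseDist x z ≤ phaseDist x y + phaseDist y z := by
  have h := dist_triangle x.2 y.2 z.2
  unfold phaseDist
  by_cases h1 : x.1 = y.1 <;> by_cases h2 : y.1 = z.1 <;> by_cases h3 : x.1 = z.1 <;>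
    simp only [h1, h2, h3, if_true, if_false] <;>
    first
    | linarith
    | exact absurd (h1.trans h2) h3
    | exact absurd (h3.symm.trans h1).symm h2
    | exact absurd (h3.trans h2.symm) h1
    | (split_ifs <;> linarith)

lemma eq_of_phaseDist_eq_zero (x y : PhaseSpace d J) (h : phaseDist x y = 0) : x = y := by
  unfold phaseDist at h
  have h0 : 0 ≤ dist x.2 y.2 := dist_nonneg
  by_cases h1 : x.1 = y.1
  · simp only [h1, if_true, zero_add] at h
    exact Prod.ext h1 (dist_eq_zero.1 h)
  · simp only [h1, if_false] at h
    linarith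

/-- The phase space as a metric space, with its distance `phaseDist`. -/
instance phaseMetricSpace : MetricSpace (PhaseSpace d J) :=
  -- The metric is put on the existing product topology, so openness, continuity and compactness
  -- keep their meaning; this is what `isOpen_phase_iff` is needed for.
  MetricSpace.ofDistTopology phaseDist phaseDist_self phaseDist_comm phaseDist_triangle
    isOpen_phase_iff eq_of_phaseDist_eq_zero

lemma phase_dist_def (ρ μ : PhaseSpace d J) : dist ρ μ = phaseDist ρ μ := rfl

@[simp] lemma phase_dist_mk (j : Fin J) (x y : CotSpace d) :
    dist ((j, x) : PhaseSpace d J) (j, y) = dist x y := by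
  simp [phase_dist_def, phaseDist]

lemma dist_snd_le (ρ μ : PhaseSpace d J) : dist ρ.2 μ.2 ≤ dist ρ μ := by
  rw [phase_dist_def]; unfold phaseDist; split_ifs <;> linarith

lemma fst_eq_of_dist_lt_one {ρ μ : PhaseSpace d J} (h : dist ρ μ < 1) : ρ.1 = μ.1 := by
  by_contra h1
  rw [phase_dist_def] at h
  simp only [phaseDist, h1, if_false] at h
  have h0 : 0 ≤ dist ρ.2 μ.2 := dist_nonneg
  linarith

lemma dist_of_fst_eq {ρ μ : PhaseSpace d J} (h : ρ.1 = μ.1) : dist ρ μ = dist ρ.2 μ.2 := by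
  simp [phase_dist_def, phaseDist, h]

lemma distTo_eq_infDist (ρ : PhaseSpace d J) (A : Set (PhaseSpace d J)) :
    distTo ρ A = Metric.infDist ρ A := by
  rw [Metric.infDist_eq_iInf, distTo, iInf, Set.image_eq_range]
  rfl

lemma isometry_mk (j : Fin J) : Isometry (fun x : CotSpace d => ((j, x) : PhaseSpace d J)) :=
  Isometry.of_dist_eq fun x y => phase_dist_mk j x y

lemma isCompact_closedBall_phase (x : PhaseSpace d J) (r : ℝ) :
    IsCompact (Metric.closedBall x r) := by
  have h : IsCompact ((Set.univ : Set (Fin J)) ×ˢ Metric.closedBall x.2 r) :=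
    isCompact_univ.prod (isCompact_closedBall x.2 r)
  have h2 : IsClosed (Metric.closedBall x r) := Metric.isClosed_closedBall
  exact h.of_isClosed_subset h2 fun y hy => ⟨Set.mem_univ _, (dist_snd_le _ _).trans hy⟩

/-- Closed bounded sets of the phase space are compact. -/
instance properSpace_phase : ProperSpace (PhaseSpace d J) := ⟨isCompact_closedBall_phase⟩

end PhaseMetric

set_option linter.unusedSectionVars false

/-! ### Smoothing a Lipschitz function at its own scale -/

section Regularization

open MeasureTheory

variable {E : Type} [NormedAddCommGroup E] [InnerProductSpace ℝ E] [FiniteDimensional ℝ E]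
  [MeasurableSpace E] [BorelSpace E]

/-- The average of `h ^ a` against the kernel `η`, at the variable scale `δ h`. -/
def scaleAverage {F : Type} [NormedAddCommGroup F] [NormedSpace ℝ F] (μ : Measure E) (δ : ℝ)
    (h : E → ℝ) (a : ℤ) (η : E → F) (x : E) : F :=
  ∫ y, (h y ^ a) • η ((δ * h y)⁻¹ • (x - y)) ∂μ

/-- `h` is positive and varies slowly at the scale `δ h`. -/
structure SlowlyVarying (δ τ : ℝ) (h : E → ℝ) : Prop where
  continuous : Continuous h
  pos : ∀ y, 0 < h y
  slow : ∀ x y, δ * |h x - h y| ≤ τ * ‖x - y‖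

variable {δ : ℝ} {h : E → ℝ}

lemma zpow_le_of_comparable {s t q : ℝ} (hs : 0 < s) (ht : 0 < t) (h1 : s ≤ q * t)
    (h2 : t ≤ q * s) (a : ℤ) : s ^ a ≤ q ^ a.natAbs * t ^ a := by
  obtain ⟨n, rfl | rfl⟩ := a.eq_nat_or_neg
  · simp only [zpow_natCast, Int.natAbs_natCast, ← mul_pow]
    gcongr
  · simp only [zpow_neg, zpow_natCast, Int.natAbs_neg, Int.natAbs_natCast]
    rw [← div_eq_mul_inv, inv_eq_one_div, div_le_div_iff₀ (by positivity) (by positivity), one_mul,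
      ← mul_pow]
    gcongr

/-- On the support of the kernel based at `y` one has `|h x - h y| ≤ τ h y`. The ratio `(1 + τ)/(1 -
τ)` tends to `1` with `τ`, which is what makes a sharp regularization possible; it equals `2` at `τ
= 1/3`. -/
lemma SlowlyVarying.comparable {τ : ℝ} (H : SlowlyVarying δ τ h) (hδ : 0 < δ) (hτ : 0 ≤ τ)
    (hτ1 : τ < 1) {x y : E}
    (hxy : ‖x - y‖ ≤ δ * h y) : h y ≤ (1 + τ) / (1 - τ) * h x ∧ h x ≤ (1 + τ) / (1 - τ) * h y := by
  have h1 := H.slow x y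
  have h2 : δ * |h x - h y| ≤ δ * (τ * h y) := by
    nlinarith [mul_le_mul_of_nonneg_left hxy hτ]
  have h3 := le_of_mul_le_mul_left h2 hδ
  rw [abs_le] at h3
  have hy := H.pos y
  have hx := H.pos x
  have h5 : 0 < 1 - τ := by linarith
  rw [div_mul_eq_mul_div, div_mul_eq_mul_div, le_div_iff₀ h5, le_div_iff₀ h5]
  constructor
  · nlinarith
  · nlinarith [mul_nonneg hτ hx.le, mul_nonneg hτ hy.le]

lemma SlowlyVarying.comparable_half (H : SlowlyVarying δ (1 / 3) h) (hδ : 0 < δ) {x y : E}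
    (hxy : ‖x - y‖ ≤ δ * h y) : h y ≤ 2 * h x ∧ h x ≤ 2 * h y := by
  have := H.comparable hδ (by norm_num) (by norm_num) hxy
  norm_num at this
  exact this

lemma norm_le_of_kernel_ne_zero {F : Type} [NormedAddCommGroup F] [NormedSpace ℝ F] {η : E → F}
    (hη : ∀ z, 1 < ‖z‖ → η z = 0) {s : ℝ} (hs : 0 < s) {x y : E}
    (h : η (s⁻¹ • (x - y)) ≠ 0) : ‖x - y‖ ≤ s := by
  by_contra h1
  push Not at h1
  apply h (hη _ _)
  rw [norm_smul, norm_inv, Real.norm_of_nonneg hs.le, ← div_eq_inv_mul]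
  rwa [one_lt_div hs]

lemma exists_norm_bound {F : Type} [NormedAddCommGroup F] {η : E → F} (hc : Continuous η)
    (hη : ∀ z, 1 < ‖z‖ → η z = 0) : ∃ C : ℝ, 0 ≤ C ∧ ∀ z, ‖η z‖ ≤ C := by
  have h1 : HasCompactSupport η := by
    refine HasCompactSupport.intro (isCompact_closedBall (0 : E) 1) fun x hx => hη x ?_
    simpa using hx
  obtain ⟨C, hC⟩ := h1.exists_bound_of_continuous hc
  exact ⟨C, (norm_nonneg _).trans (hC 0), hC⟩

lemma continuous_kernel {F : Type} [NormedAddCommGroup F] [NormedSpace ℝ F] {η : E → F}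
    (hc : Continuous η) (hδ : 0 < δ) (hh : Continuous h) (hpos : ∀ y, 0 < h y) (a : ℤ) (x : E) :
    Continuous fun y => (h y ^ a) • η ((δ * h y)⁻¹ • (x - y)) := by
  have h1 : Continuous fun y => h y ^ a := hh.zpow₀ a fun y => Or.inl (hpos y).ne'
  have h2 : Continuous fun y => (δ * h y)⁻¹ :=
    (continuous_const.mul hh).inv₀ fun y => (mul_pos hδ (hpos y)).ne'
  exact h1.smul (hc.comp (h2.smul (continuous_const.sub continuous_id)))

/-- The integrand lives in the ball of radius `2δ h(x)`, where `h` is comparable to `h(x)`; the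
volume of that ball contributes the power `Module.finrank ℝ E`. The constant is chosen before `h`,
which later gives uniformity in `ε`. -/
lemma norm_scaleAverage_le {F : Type} [NormedAddCommGroup F] [NormedSpace ℝ F] (μ : Measure E)
    [μ.IsAddHaarMeasure] {η : E → F} (hc : Continuous η) (hη : ∀ z, 1 < ‖z‖ → η z = 0)
    (hδ : 0 < δ) (a : ℤ) :
    ∃ K : ℝ, ∀ h : E → ℝ, SlowlyVarying δ (1 / 3) h → ∀ x,
      ‖scaleAverage μ δ h a η x‖ ≤ K * h x ^ (a + Module.finrank ℝ E) := by
  obtain ⟨C, hC0, hC⟩ := exists_norm_bound hc hη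
  set m := Module.finrank ℝ E
  refine ⟨2 ^ a.natAbs * C * ((2 * δ) ^ m * μ.real (Metric.ball 0 1)), fun h H x => ?_⟩
  have hx := H.pos x
  have hsub : ∀ y, y ∉ Metric.closedBall x (2 * δ * h x) →
      (h y ^ a) • η ((δ * h y)⁻¹ • (x - y)) = 0 := by
    intro y hy
    by_contra hne
    have h1 : η ((δ * h y)⁻¹ • (x - y)) ≠ 0 := fun h0 => hne (by rw [h0, smul_zero])
    have h2 := norm_le_of_kernel_ne_zero hη (mul_pos hδ (H.pos y)) h1
    have h3 := (H.comparable_half hδ h2).1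
    apply hy
    rw [Metric.mem_closedBall, dist_eq_norm, norm_sub_rev]
    nlinarith
  rw [scaleAverage, ← setIntegral_eq_integral_of_forall_compl_eq_zero hsub]
  have hb : ∀ y ∈ Metric.closedBall x (2 * δ * h x),
      ‖(h y ^ a) • η ((δ * h y)⁻¹ • (x - y))‖ ≤ 2 ^ a.natAbs * h x ^ a * C := by
    intro y _
    by_cases h0 : η ((δ * h y)⁻¹ • (x - y)) = 0
    · rw [h0, smul_zero, norm_zero]; positivity
    · have h2 := norm_le_of_kernel_ne_zero hη (mul_pos hδ (H.pos y)) h0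
      have h3 := H.comparable_half hδ h2
      have h4 := zpow_le_of_comparable (H.pos y) hx h3.1 h3.2 a
      rw [norm_smul, Real.norm_of_nonneg (zpow_pos (H.pos y) a).le]
      exact mul_le_mul h4 (hC _) (norm_nonneg _) (by positivity)
  refine (norm_setIntegral_le_of_norm_le_const (measure_closedBall_lt_top) hb).trans ?_
  have hv : μ.real (Metric.closedBall x (2 * δ * h x)) =
      (2 * δ * h x) ^ m * μ.real (Metric.ball 0 1) := by
    rw [Measure.real, Measure.addHaar_closedBall _ _ (by positivity), ENNReal.toReal_mul,
      ENNReal.toReal_ofReal (by positivity)]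
    rfl
  rw [hv, zpow_add₀ hx.ne', zpow_natCast, mul_pow _ (h x)]
  apply le_of_eq
  ring

/-- The scale is read at the integration variable and not at `x`, so `h` is never differentiated.
The derivative falls on the kernel alone and brings out `(δ h(y))⁻¹`: the result is again a scale
average, with exponent `a - 1`. The class is closed under differentiation, and a merely continuous
`h` produces smooth functions. -/
lemma hasFDerivAt_scaleAverage {F : Type} [NormedAddCommGroup F] [NormedSpace ℝ F]
    (μ : Measure E) [μ.IsAddHaarMeasure] {η : E → F} (hs : ContDiff ℝ ∞ η)
    (hη : ∀ z, 1 < ‖z‖ → η z = 0) (hδ : 0 < δ) (H : SlowlyVarying δ (1 / 3) h) (a : ℤ) (x : E) :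
    HasFDerivAt (scaleAverage μ δ h a η)
      (scaleAverage μ δ h (a - 1) (fun z => δ⁻¹ • fderiv ℝ η z) x) x := by
  have hc' : Continuous fun z => δ⁻¹ • fderiv ℝ η z :=
    show Continuous (δ⁻¹ • fderiv ℝ η) from (hs.continuous_fderiv (by simp)).const_smul δ⁻¹
  have hη' : ∀ z, 1 < ‖z‖ → δ⁻¹ • fderiv ℝ η z = 0 := by
    intro z hz
    have h1 : η =ᶠ[nhds z] fun _ => 0 := by
      filter_upwards [(isOpen_lt continuous_const continuous_norm).mem_nhds hz] with w hw
      exact hη w hw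
    rw [h1.fderiv_eq]; simp
  obtain ⟨C, hC0, hC⟩ := exists_norm_bound hc' hη'
  -- Dominated convergence needs one compact set that contains the supports for all `z` in the unit
  -- ball around `x`.
  set R : ℝ := 1 + 2 * δ * (h x + δ⁻¹)
  have hcont : ContinuousOn (fun y => h y ^ (a - 1)) (Metric.closedBall x R) :=
    (H.continuous.zpow₀ _ fun y => Or.inl (H.pos y).ne').continuousOn
  obtain ⟨B, hB⟩ := (isCompact_closedBall x R).exists_bound_of_continuousOn hcont
  have hloc : ∀ z ∈ Metric.ball x 1, ∀ y, δ⁻¹ • fderiv ℝ η ((δ * h y)⁻¹ • (z - y)) ≠ 0 →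
      y ∈ Metric.closedBall x R := by
    intro z hz y h1
    have h2 := norm_le_of_kernel_ne_zero hη' (mul_pos hδ (H.pos y)) h1
    have h3 := (H.comparable_half hδ h2).1
    rw [Metric.mem_ball, dist_eq_norm] at hz
    have h5 := H.slow z x
    have h6 : δ * |h z - h x| ≤ 1 := by linarith
    have h7 : δ * h z ≤ δ * h x + 1 := by nlinarith [le_abs_self (h z - h x)]
    rw [Metric.mem_closedBall, dist_eq_norm]
    have h8 : ‖y - x‖ ≤ ‖z - y‖ + ‖z - x‖ := by
      rw [← norm_neg (z - y)]
      refine le_trans (le_of_eq ?_) (norm_add_le _ _)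
      congr 1; abel
    have h9 : δ * δ⁻¹ = 1 := mul_inv_cancel₀ hδ.ne'
    simp only [R]
    nlinarith
  refine hasFDerivAt_integral_of_dominated_of_fderiv_le (μ := μ) (s := Metric.ball x 1)
    (F := fun x y => (h y ^ a) • η ((δ * h y)⁻¹ • (x - y)))
    (F' := fun x y => (h y ^ (a - 1)) • (δ⁻¹ • fderiv ℝ η ((δ * h y)⁻¹ • (x - y))))
    (bound := (Metric.closedBall x R).indicator fun _ => B * C)
    (Metric.ball_mem_nhds _ one_pos) ?_ ?_ ?_ ?_ ?_ ?_
  · exact Filter.Eventually.of_forall fun z =>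
      (continuous_kernel hs.continuous hδ H.continuous H.pos a z).aestronglyMeasurable
  · refine (continuous_kernel hs.continuous hδ H.continuous H.pos a x).integrable_of_hasCompactSupport
      ?_
    refine HasCompactSupport.intro (isCompact_closedBall x (2 * δ * h x)) fun y hy => ?_
    by_contra hne
    have h1 : η ((δ * h y)⁻¹ • (x - y)) ≠ 0 := fun h0 => hne (by rw [h0, smul_zero])
    have h2 := norm_le_of_kernel_ne_zero hη (mul_pos hδ (H.pos y)) h1
    have h3 := (H.comparable_half hδ h2).1
    apply hy
    rw [Metric.mem_closedBall, dist_eq_norm, norm_sub_rev]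
    nlinarith
  · exact (continuous_kernel hc' hδ H.continuous H.pos (a - 1) x).aestronglyMeasurable
  · refine Filter.Eventually.of_forall fun y z hz => ?_
    by_cases h0 : δ⁻¹ • fderiv ℝ η ((δ * h y)⁻¹ • (z - y)) = 0
    · rw [h0, smul_zero, norm_zero]
      apply indicator_nonneg
      intro w hw
      exact mul_nonneg ((norm_nonneg _).trans (hB w hw)) hC0
    · have hy := hloc z hz y h0
      rw [indicator_of_mem hy, norm_smul]
      exact mul_le_mul (hB y hy) (hC _) (norm_nonneg _) ((norm_nonneg _).trans (hB y hy))
  · rw [integrable_indicator_iff measurableSet_closedBall]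
    exact integrableOn_const (measure_closedBall_lt_top).ne
  · refine Filter.Eventually.of_forall fun y z _ => ?_
    have h1 : HasFDerivAt (fun z => (δ * h y)⁻¹ • (z - y))
        ((δ * h y)⁻¹ • ContinuousLinearMap.id ℝ E) z :=
      ((hasFDerivAt_id z).sub_const y).const_smul _
    have h2 : HasFDerivAt η (fderiv ℝ η ((δ * h y)⁻¹ • (z - y))) ((δ * h y)⁻¹ • (z - y)) :=
      ((hs.differentiable (by simp)) _).hasFDerivAt
    have h3 := (h2.comp z h1).const_smul (h y ^ a)
    refine h3.congr_fderiv ?_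
    ext v
    have hy := (H.pos y).ne'
    simp only [smul_apply, ContinuousLinearMap.comp_apply,
      ContinuousLinearMap.id_apply, map_smul, smul_smul]
    congr 1
    rw [zpow_sub_one₀ hy, mul_inv]
    ring

/-- The induction runs over all kernels with values in all normed spaces, because the kernel of the
derivative takes values in a space of linear maps. -/
lemma scaleAverage_regular (μ : Measure E) [μ.IsAddHaarMeasure] (hδ : 0 < δ) (n : ℕ) :
    ∀ {F : Type} [NormedAddCommGroup F] [NormedSpace ℝ F] (η : E → F), ContDiff ℝ ∞ η →
      (∀ z, 1 < ‖z‖ → η z = 0) → ∀ a : ℤ, ∃ K : ℝ, ∀ h : E → ℝ, SlowlyVarying δ (1 / 3) h →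
        ContDiff ℝ n (scaleAverage μ δ h a η) ∧ ∀ x,
          ‖iteratedFDeriv ℝ n (scaleAverage μ δ h a η) x‖ ≤
            K * h x ^ (a + Module.finrank ℝ E - n) := by
  induction n with
  | zero =>
    intro F _ _ η hs hη a
    obtain ⟨K, hK⟩ := norm_scaleAverage_le μ hs.continuous hη hδ a
    refine ⟨K, fun h H => ⟨?_, fun x => ?_⟩⟩
    · rw [Nat.cast_zero, contDiff_zero]
      exact continuous_iff_continuousAt.2 fun x =>
        (hasFDerivAt_scaleAverage μ hs hη hδ H a x).continuousAt
    · rw [norm_iteratedFDeriv_zero]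
      simpa using hK h H x
  | succ n ih =>
    intro F _ _ η hs hη a
    have hs' : ContDiff ℝ ∞ fun z => δ⁻¹ • fderiv ℝ η z :=
      show ContDiff ℝ ∞ (δ⁻¹ • fderiv ℝ η) from (hs.fderiv_right (m := ∞) (by simp)).const_smul δ⁻¹
    have hη' : ∀ z, 1 < ‖z‖ → δ⁻¹ • fderiv ℝ η z = 0 := by
      intro z hz
      have h1 : η =ᶠ[nhds z] fun _ => 0 := by
        filter_upwards [(isOpen_lt continuous_const continuous_norm).mem_nhds hz] with w hw
        exact hη w hw
      rw [h1.fderiv_eq]; simp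
    obtain ⟨K, hK⟩ := ih _ hs' hη' (a - 1)
    refine ⟨K, fun h H => ?_⟩
    have hd := hasFDerivAt_scaleAverage μ hs hη hδ H a
    have hf : fderiv ℝ (scaleAverage μ δ h a η) =
        scaleAverage μ δ h (a - 1) (fun z => δ⁻¹ • fderiv ℝ η z) :=
      funext fun x => (hd x).fderiv
    refine ⟨?_, fun x => ?_⟩
    · rw [Nat.cast_add, Nat.cast_one, contDiff_succ_iff_fderiv]
      refine ⟨fun x => (hd x).differentiableAt, by simp, ?_⟩
      rw [hf]; exact (hK h H).1
    · rw [← norm_iteratedFDeriv_fderiv, hf]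
      refine ((hK h H).2 x).trans (le_of_eq ?_)
      congr 2
      push_cast; ring

/-- A radial bump function, nonincreasing in the norm. -/
def radialBump (z : E) : ℝ := Real.smoothTransition (1 - ‖z‖ ^ 2)

lemma contDiff_radialBump : ContDiff ℝ ∞ (radialBump : E → ℝ) :=
  Real.smoothTransition.contDiff.comp (contDiff_const.sub (contDiff_norm_sq ℝ))

lemma radialBump_nonneg (z : E) : 0 ≤ radialBump z := Real.smoothTransition.nonneg _

lemma radialBump_eq_zero {z : E} (hz : 1 ≤ ‖z‖) : radialBump z = 0 :=
  Real.smoothTransition.zero_of_nonpos (by nlinarith)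

lemma radialBump_smul_le {s t : ℝ} (hs : 0 ≤ s) (hst : s ≤ t) (z : E) :
    radialBump (t • z) ≤ radialBump (s • z) := by
  apply Real.smoothTransition.monotone
  rw [norm_smul, norm_smul, Real.norm_of_nonneg hs, Real.norm_of_nonneg (hs.trans hst)]
  have : s * ‖z‖ ≤ t * ‖z‖ := by gcongr
  have h2 : 0 ≤ s * ‖z‖ := by positivity
  nlinarith

lemma hasCompactSupport_radialBump : HasCompactSupport (radialBump : E → ℝ) :=
  HasCompactSupport.intro (isCompact_closedBall (0 : E) 1) fun x hx =>
    radialBump_eq_zero (by simpa using (not_le.1 fun h => hx (by simpa using h)).le)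

lemma integral_radialBump_pos (μ : Measure E) [μ.IsAddHaarMeasure] :
    0 < ∫ z : E, radialBump z ∂μ := by
  refine contDiff_radialBump.continuous.integral_pos_of_hasCompactSupport_nonneg_nonzero
    hasCompactSupport_radialBump radialBump_nonneg (x := 0) ?_
  have : radialBump (0 : E) = 1 := Real.smoothTransition.one_of_one_le (by simp)
  rw [this]; exact one_ne_zero

lemma integral_radialBump_scaled (μ : Measure E) [μ.IsAddHaarMeasure] {s : ℝ} (hs : 0 < s)
    (x : E) : ∫ y, radialBump (s⁻¹ • (x - y)) ∂μ =
      s ^ Module.finrank ℝ E * ∫ z, radialBump z ∂μ := by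
  rw [integral_sub_left_eq_self (fun y => radialBump (s⁻¹ • y)) μ x,
    Measure.integral_comp_inv_smul, abs_of_pos (by positivity), smul_eq_mul]

/-- With the exponent `2 - m` the average would be exactly `δ^m (∫ bump) h²` for constant `h`. As
the bump is radially nonincreasing, a variable scale is sandwiched between the fixed scales `q⁻¹ δ
h(x)` and `q δ h(x)`. The loss `q^(2+2m)` is `q^(2+m)` from the weight, since `|2 - m| ≤ 2 + m`,
times `q^m` from the volume. -/
lemma scaleAverage_radialBump_bounds (μ : Measure E) [μ.IsAddHaarMeasure] {τ : ℝ} (hδ : 0 < δ)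
    (hτ : 0 ≤ τ) (hτ1 : τ < 1) (H : SlowlyVarying δ τ h) (x : E) :
    scaleAverage μ δ h (2 - Module.finrank ℝ E) radialBump x ≤
      ((1 + τ) / (1 - τ)) ^ (2 + 2 * Module.finrank ℝ E) *
        (δ ^ Module.finrank ℝ E * ∫ z : E, radialBump z ∂μ) * h x ^ 2 ∧
    (δ ^ Module.finrank ℝ E * ∫ z : E, radialBump z ∂μ) * h x ^ 2 ≤
      ((1 + τ) / (1 - τ)) ^ (2 + 2 * Module.finrank ℝ E) *
      scaleAverage μ δ h (2 - Module.finrank ℝ E) radialBump x := by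
  set m := Module.finrank ℝ E
  set q : ℝ := (1 + τ) / (1 - τ)
  set I := ∫ z : E, radialBump z ∂μ
  have hq1 : 1 ≤ q := by
    rw [one_le_div (by linarith)]; linarith
  have hq0 : 0 < q := by linarith
  have hx := H.pos x
  have hI : 0 < I := integral_radialBump_pos μ
  -- the weight on the support of the kernel
  have hw : ∀ y, h y ≤ q * h x → h x ≤ q * h y →
      h y ^ (2 - m : ℤ) ≤ q ^ (2 + m) * h x ^ (2 - m : ℤ) ∧
      h x ^ (2 - m : ℤ) ≤ q ^ (2 + m) * h y ^ (2 - m : ℤ) := by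
    intro y h1 h2
    have hy := H.pos y
    have hle : q ^ (2 - m : ℤ).natAbs ≤ q ^ (2 + m) :=
      pow_le_pow_right₀ hq1 (by omega)
    constructor
    · refine (zpow_le_of_comparable hy hx h1 h2 _).trans ?_
      gcongr
    · refine (zpow_le_of_comparable hx hy h2 h1 _).trans ?_
      gcongr
  have hzp : h x ^ (2 - m : ℤ) * h x ^ m = h x ^ 2 := by
    rw [← zpow_natCast (h x) m, ← zpow_add₀ hx.ne']
    simp only [sub_add_cancel]
    norm_cast
  have hbd : ∀ s : ℝ, 0 < s → Integrable (fun y => radialBump (s⁻¹ • (x - y))) μ := by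
    intro s hs
    refine Continuous.integrable_of_hasCompactSupport
      (contDiff_radialBump.continuous.comp (by fun_prop)) ?_
    refine HasCompactSupport.intro (isCompact_closedBall x s) fun y hy => ?_
    apply radialBump_eq_zero
    rw [Metric.mem_closedBall, dist_eq_norm, not_le, norm_sub_rev] at hy
    rw [norm_smul, norm_inv, Real.norm_of_nonneg hs.le, ← div_eq_inv_mul, one_le_div hs]
    exact hy.le
  have hzero : ∀ z : E, 1 < ‖z‖ → radialBump z = 0 := fun z hz => radialBump_eq_zero hz.le
  have hAint : Integrable (fun y => (h y ^ (2 - m : ℤ)) • radialBump ((δ * h y)⁻¹ • (x - y))) μ := by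
    refine (continuous_kernel contDiff_radialBump.continuous hδ H.continuous H.pos _
      x).integrable_of_hasCompactSupport ?_
    refine HasCompactSupport.intro (isCompact_closedBall x (δ * (q * h x))) fun y hy => ?_
    by_contra hne
    have h1 : radialBump ((δ * h y)⁻¹ • (x - y)) ≠ 0 := fun h0 => hne (by rw [h0, smul_zero])
    have h2 := norm_le_of_kernel_ne_zero hzero (mul_pos hδ (H.pos y)) h1
    have h3 := (H.comparable hδ hτ hτ1 h2).1
    apply hy
    rw [Metric.mem_closedBall, dist_eq_norm, norm_sub_rev]
    exact h2.trans (by gcongr)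
  constructor
  · have hs : 0 < q * (δ * h x) := by positivity
    have key : ∀ y, (h y ^ (2 - m : ℤ)) • radialBump ((δ * h y)⁻¹ • (x - y)) ≤
        q ^ (2 + m) * h x ^ (2 - m : ℤ) * radialBump ((q * (δ * h x))⁻¹ • (x - y)) := by
      intro y
      have hy := H.pos y
      by_cases h1 : radialBump ((δ * h y)⁻¹ • (x - y)) = 0
      · rw [h1, smul_zero]
        have := radialBump_nonneg ((q * (δ * h x))⁻¹ • (x - y))
        positivity
      · have h2 := norm_le_of_kernel_ne_zero hzero (mul_pos hδ hy) h1
        obtain ⟨h3, h4⟩ := H.comparable hδ hτ hτ1 h2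
        rw [smul_eq_mul]
        refine mul_le_mul (hw y h3 h4).1 ?_ (radialBump_nonneg _) (by positivity)
        apply radialBump_smul_le (by positivity)
        apply inv_anti₀ (by positivity)
        nlinarith
    have := integral_mono hAint ((hbd _ hs).const_mul _) key
    rw [integral_const_mul, integral_radialBump_scaled μ hs] at this
    refine this.trans (le_of_eq ?_)
    rw [← hzp, mul_pow, mul_pow]
    ring
  · have hs : 0 < q⁻¹ * (δ * h x) := by positivity
    have key : ∀ y, h x ^ (2 - m : ℤ) * radialBump ((q⁻¹ * (δ * h x))⁻¹ • (x - y)) ≤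
        q ^ (2 + m) * (h y ^ (2 - m : ℤ)) • radialBump ((δ * h y)⁻¹ • (x - y)) := by
      intro y
      have hy := H.pos y
      by_cases h1 : radialBump ((q⁻¹ * (δ * h x))⁻¹ • (x - y)) = 0
      · rw [h1, mul_zero]
        have := radialBump_nonneg ((δ * h y)⁻¹ • (x - y))
        positivity
      · have h2 := norm_le_of_kernel_ne_zero hzero hs h1
        -- Here the distance is controlled by `h x` and not by `h y`, so `comparable` does not
        -- apply. With `t = h x / q`, slow variation gives `h y ≥ (q - τ) t ≥ t`.
        have h5 := H.slow x y
        have h1t : 0 < 1 - τ := by linarith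
        have hqi : q⁻¹ = (1 - τ) / (1 + τ) := inv_div _ _
        have h6 : δ * |h x - h y| ≤ δ * (τ * (q⁻¹ * h x)) := by
          nlinarith [mul_le_mul_of_nonneg_left h2 hτ]
        have h7 := le_of_mul_le_mul_left h6 hδ
        rw [abs_le] at h7
        have h8 : q * (q⁻¹ * h x) = h x := by field_simp
        have h9 : (1 - τ) * q = 1 + τ := by
          simp only [q]; field_simp
        set t := q⁻¹ * h x
        have ht : 0 < t := by positivity
        have h3 : h y ≤ q * h x := by
          have : (1 - τ) * h y ≤ (1 - τ) * (q * h x) := by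
            rw [← mul_assoc, h9]
            have : t ≤ h x := by nlinarith
            nlinarith [mul_nonneg hτ ht.le, mul_nonneg hτ hx.le, mul_nonneg hτ hy.le,
              mul_nonneg (mul_nonneg hτ hτ) ht.le]
          exact le_of_mul_le_mul_left this h1t
        have h4 : t ≤ h y := by
          have : (1 - τ) * t ≤ (1 - τ) * h y := by nlinarith [mul_nonneg hτ ht.le]
          exact le_of_mul_le_mul_left this h1t
        have h4' : h x ≤ q * h y := by rw [← h8]; gcongr
        rw [smul_eq_mul, ← mul_assoc (q ^ (2 + m))]
        refine mul_le_mul (hw y h3 h4').2 ?_ (radialBump_nonneg _) (by positivity)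
        apply radialBump_smul_le (by positivity)
        apply inv_anti₀ (by positivity)
        nlinarith
    have := integral_mono ((hbd _ hs).const_mul _) (hAint.const_mul (q ^ (2 + m))) key
    rw [integral_const_mul, integral_const_mul, integral_radialBump_scaled μ hs] at this
    have h10 : q ^ m * (q⁻¹) ^ m = 1 := by rw [← mul_pow, mul_inv_cancel₀ hq0.ne', one_pow]
    calc δ ^ m * I * h x ^ 2
        = q ^ m * (h x ^ (2 - m : ℤ) * ((q⁻¹ * (δ * h x)) ^ m * I)) := by
          rw [← hzp, mul_pow, mul_pow]
          linear_combination (-(δ ^ m * I * h x ^ (2 - m : ℤ) * h x ^ m)) * h10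
      _ ≤ q ^ m * (q ^ (2 + m) * scaleAverage μ δ h (2 - m : ℤ) radialBump x) := by
          exact mul_le_mul_of_nonneg_left this (by positivity)
      _ = _ := by ring

/-- Every positive Lipschitz function has a smooth regularization at its own scale, uniformly in
the function. -/
theorem exists_regularization (L : ℝ) (hL : 0 ≤ L) {κ : ℝ} (hκ : 0 < κ) :
    ∃ K : ℕ → ℝ, ∀ h : E → ℝ, (∀ y, 0 < h y) → (∀ x y, |h x - h y| ≤ L * ‖x - y‖) →
      ∃ φ : E → ℝ, ContDiff ℝ ∞ φ ∧ (∀ x, h x ^ 2 ≤ φ x ∧ φ x ≤ (1 + κ) * h x ^ 2) ∧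
        ∀ n x, ‖iteratedFDeriv ℝ n φ x‖ ≤ K n * h x ^ (2 - n : ℤ) := by
  set m := Module.finrank ℝ E
  -- The loss occurs in both bounds, hence the square. A relative error as small as desired matters:
  -- it will be compared with the expansion rate of the dynamics. The bound `τ ≤ 1/3` is what the
  -- derivative estimates require.
  obtain ⟨τ, hτ0, hτ3, hτκ⟩ : ∃ τ : ℝ, 0 < τ ∧ τ ≤ 1 / 3 ∧
      (((1 + τ) / (1 - τ)) ^ (2 + 2 * m)) ^ 2 < 1 + κ := by
    have hc : ContinuousAt (fun τ : ℝ => (((1 + τ) / (1 - τ)) ^ (2 + 2 * m)) ^ 2) 0 := by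
      have : ContinuousAt (fun τ : ℝ => (1 + τ) / (1 - τ)) 0 :=
        ContinuousAt.div (by fun_prop) (by fun_prop) (by norm_num)
      exact (this.pow _).pow _
    have h1 : ∀ᶠ τ : ℝ in nhds 0, (((1 + τ) / (1 - τ)) ^ (2 + 2 * m)) ^ 2 < 1 + κ :=
      hc.eventually (gt_mem_nhds (by simpa using hκ))
    obtain ⟨r, hr, hb⟩ := Metric.eventually_nhds_iff.1 h1
    refine ⟨min (r / 2) (1 / 3), by positivity, min_le_right _ _, hb ?_⟩
    rw [Real.dist_eq, sub_zero, abs_of_pos (by positivity)]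
    exact (min_le_left _ _).trans_lt (by linarith)
  set q : ℝ := (1 + τ) / (1 - τ)
  have h1τ : 0 < 1 - τ := by linarith
  have hq0 : 0 < q := by positivity
  set δ : ℝ := τ / (L + 1)
  have hδ : 0 < δ := by positivity
  have hδL : δ * L ≤ τ := by
    rw [div_mul_eq_mul_div, div_le_iff₀ (by positivity)]
    nlinarith
  let μ : Measure E := Measure.addHaar
  set c : ℝ := δ ^ m * ∫ z : E, radialBump z ∂μ
  have hc : 0 < c := mul_pos (by positivity) (integral_radialBump_pos μ)
  choose K hK using fun n : ℕ => scaleAverage_regular μ hδ n (radialBump : E → ℝ)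
    contDiff_radialBump (fun z hz => radialBump_eq_zero hz.le) (2 - m)
  refine ⟨fun n => |q ^ (2 + 2 * m) / c| * K n, fun h hpos hlip => ?_⟩
  have H : ∀ σ, τ ≤ σ → SlowlyVarying δ σ h := fun σ hσ =>
    { continuous := by
        have : LipschitzWith (Real.toNNReal L) h := LipschitzWith.of_dist_le_mul fun x y => by
          rw [Real.dist_eq, dist_eq_norm, Real.coe_toNNReal _ hL]; exact hlip x y
        exact this.continuous
      pos := hpos
      slow := fun x y => by
        have := mul_le_mul_of_nonneg_left (hlip x y) hδ.le
        nlinarith [norm_nonneg (x - y), mul_le_mul_of_nonneg_right (hδL.trans hσ)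
          (norm_nonneg (x - y))] }
  have hcd : ContDiff ℝ ∞ (scaleAverage μ δ h (2 - m) radialBump) := by
    rw [contDiff_infty]
    exact fun n => (hK n h (H _ hτ3)).1
  -- This normalization makes the lower bound `h² ≤ φ` exact and leaves all the error in the upper
  -- bound.
  refine ⟨fun x => (q ^ (2 + 2 * m) / c) • scaleAverage μ δ h (2 - m) radialBump x,
    hcd.const_smul _, fun x => ?_, fun n x => ?_⟩
  · obtain ⟨h1, h2⟩ := scaleAverage_radialBump_bounds μ hδ hτ0.le (by linarith) (H τ le_rfl) x
    beta_reduce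
    rw [smul_eq_mul, div_mul_eq_mul_div]
    constructor
    · rw [le_div_iff₀ hc, mul_comm]
      exact h2
    · rw [div_le_iff₀ hc]
      calc _ ≤ q ^ (2 + 2 * m) * (q ^ (2 + 2 * m) * c * h x ^ 2) := by gcongr
        _ = (q ^ (2 + 2 * m)) ^ 2 * (h x ^ 2 * c) := by ring
        _ ≤ (1 + κ) * (h x ^ 2 * c) := by gcongr
        _ = _ := by ring
  · have h1 := iteratedFDeriv_const_smul_apply' (𝕜 := ℝ) (i := n) (a := q ^ (2 + 2 * m) / c)
      (f := scaleAverage μ δ h (2 - m) radialBump) (x := x)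
      ((hcd.of_le (by exact_mod_cast le_top)).contDiffAt)
    rw [h1, norm_smul, Real.norm_eq_abs, mul_assoc]
    refine mul_le_mul_of_nonneg_left (((hK n h (H _ hτ3)).2 x).trans (le_of_eq ?_)) (abs_nonneg _)
    congr 2
    simp only [m]
    ring

end Regularization

/-! ### Differentiable maps of the phase space -/

section PhaseMaps

variable {d J : ℕ}

/-- `Ψ` is strictly differentiable at `ρ`, with derivative `A`, in the coordinates of the copies. -/
def HasPhaseDeriv (Ψ : PhaseSpace d J → PhaseSpace d J) (A : CotSpace d →L[ℝ] CotSpace d)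
    (ρ : PhaseSpace d J) : Prop :=
  HasStrictFDerivAt (fun x : CotSpace d => (Ψ (ρ.1, x)).2) A ρ.2

lemma eventually_fst_eq {Ψ : PhaseSpace d J → PhaseSpace d J} {ρ : PhaseSpace d J}
    (hc : ContinuousAt Ψ ρ) :
    ∀ᶠ x : CotSpace d in nhds ρ.2, (Ψ (ρ.1, x)).1 = (Ψ ρ).1 := by
  have h1 : ContinuousAt (fun x : CotSpace d => Ψ (ρ.1, x)) ρ.2 :=
    ContinuousAt.comp (f := fun x : CotSpace d => (ρ.1, x)) (x := ρ.2) hc (by fun_prop)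
  have h2 : ∀ᶠ μ : PhaseSpace d J in nhds (Ψ ρ), μ.1 = (Ψ ρ).1 :=
    continuousAt_fst.eventually ((isOpen_discrete {(Ψ ρ).1}).mem_nhds rfl)
  exact h1.eventually h2

lemma HasPhaseDeriv.comp {Ψ Ψ' : PhaseSpace d J → PhaseSpace d J}
    {A A' : CotSpace d →L[ℝ] CotSpace d} {ρ : PhaseSpace d J} (h' : HasPhaseDeriv Ψ' A' (Ψ ρ))
    (h : HasPhaseDeriv Ψ A ρ) (hc : ContinuousAt Ψ ρ) :
    HasPhaseDeriv (Ψ' ∘ Ψ) (A'.comp A) ρ := by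
  have h1 : HasStrictFDerivAt (fun x : CotSpace d => (Ψ' ((Ψ ρ).1, (Ψ (ρ.1, x)).2)).2)
      (A'.comp A) ρ.2 := HasStrictFDerivAt.comp ρ.2
        (g := fun y : CotSpace d => (Ψ' ((Ψ ρ).1, y)).2)
        (f := fun x : CotSpace d => (Ψ (ρ.1, x)).2) h' h
  refine HasStrictFDerivAt.congr_of_eventuallyEq h1 ?_
  filter_upwards [eventually_fst_eq hc] with x hx
  rw [← hx]; rfl

lemma HasPhaseDeriv.derivMap_eq {Ψ : PhaseSpace d J → PhaseSpace d J}
    {A : CotSpace d →L[ℝ] CotSpace d} {ρ : PhaseSpace d J} (h : HasPhaseDeriv Ψ A ρ) :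
    derivMap Ψ ρ = A :=
  h.hasFDerivAt.fderiv

lemma HasPhaseDeriv.congr {Ψ Ψ' : PhaseSpace d J → PhaseSpace d J}
    {A : CotSpace d →L[ℝ] CotSpace d} {ρ : PhaseSpace d J} (h : HasPhaseDeriv Ψ A ρ)
    (he : Ψ =ᶠ[nhds ρ] Ψ') : HasPhaseDeriv Ψ' A ρ := by
  refine HasStrictFDerivAt.congr_of_eventuallyEq h ?_
  have h1 : ContinuousAt (fun x : CotSpace d => (ρ.1, x)) ρ.2 := by fun_prop
  filter_upwards [h1.eventually he] with x hx
  rw [hx]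

lemma hasPhaseDeriv_id (ρ : PhaseSpace d J) :
    HasPhaseDeriv id (ContinuousLinearMap.id ℝ (CotSpace d)) ρ :=
  hasStrictFDerivAt_id ρ.2

lemma symplForm_nondegenerate {u : CotSpace d} (h : ∀ v, symplForm u v = 0) : u = 0 := by
  classical
  ext i
  rcases i with i | i
  · have := h (EuclideanSpace.single (Sum.inr i) 1)
    simpa [symplForm, PiLp.single_apply] using this
  · have := h (EuclideanSpace.single (Sum.inl i) 1)
    simpa [symplForm, PiLp.single_apply] using this

end PhaseMaps

/-! ### Time reversal, the tails and their compactness -/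

namespace OpenMap

variable {d J : ℕ} (F : OpenMap d J)

lemma hasPhaseDeriv {ρ : PhaseSpace d J} (hρ : ρ ∈ F.Φ.source) :
    HasPhaseDeriv F.Φ (derivMap F.Φ ρ) ρ :=
  (F.smooth ρ hρ).hasStrictFDerivAt (by simp)

/-- The map between two copies of `T*ℝ^d` in their coordinates. -/
def chart (j k : Fin J) : OpenPartialHomeomorph (CotSpace d) (CotSpace d) where
  toFun x := (F.Φ (j, x)).2
  invFun y := (F.Φ.symm (k, y)).2
  source := {x | (j, x) ∈ F.Φ.source ∧ (F.Φ (j, x)).1 = k}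
  target := {y | (k, y) ∈ F.Φ.target ∧ (F.Φ.symm (k, y)).1 = j}
  map_source' := by
    rintro x ⟨hx, rfl⟩
    refine ⟨F.Φ.map_source hx, ?_⟩
    rw [Prod.mk.eta, F.Φ.left_inv hx]
  map_target' := by
    rintro y ⟨hy, rfl⟩
    refine ⟨F.Φ.map_target hy, ?_⟩
    rw [Prod.mk.eta, F.Φ.right_inv hy]
  left_inv' := by
    rintro x ⟨hx, rfl⟩
    rw [Prod.mk.eta, F.Φ.left_inv hx]
  right_inv' := by
    rintro y ⟨hy, rfl⟩
    rw [Prod.mk.eta, F.Φ.right_inv hy]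
  open_source := by
    have h1 : IsOpen (F.Φ.source ∩ F.Φ ⁻¹' (Prod.fst ⁻¹' {k})) :=
      F.Φ.isOpen_inter_preimage ((isOpen_discrete {k}).preimage continuous_fst)
    exact h1.preimage (f := fun x : CotSpace d => (j, x)) (by fun_prop)
  open_target := by
    have h1 : IsOpen (F.Φ.symm.source ∩ F.Φ.symm ⁻¹' (Prod.fst ⁻¹' {j})) :=
      F.Φ.symm.isOpen_inter_preimage ((isOpen_discrete {j}).preimage continuous_fst)
    exact h1.preimage (f := fun x : CotSpace d => (k, x)) (by fun_prop)
  continuousOn_toFun := by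
    refine continuous_snd.comp_continuousOn (F.Φ.continuousOn.comp (by fun_prop) ?_)
    exact fun x hx => hx.1
  continuousOn_invFun := by
    refine continuous_snd.comp_continuousOn (F.Φ.symm.continuousOn.comp (by fun_prop) ?_)
    exact fun x hx => hx.1

/-- A map that preserves a nondegenerate form is injective. This makes the tangent map invertible,
hence the inverse of `F` smooth. -/
lemma derivMap_injective {ρ : PhaseSpace d J} (hρ : ρ ∈ F.Φ.source) :
    Function.Injective (derivMap F.Φ ρ) := by
  rw [injective_iff_map_eq_zero]
  intro u hu
  apply symplForm_nondegenerate
  intro v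
  rw [← F.symplectic ρ hρ u v, hu]
  simp [symplForm]

/-- The tangent map, as an isomorphism. -/
def derivEquiv {ρ : PhaseSpace d J} (hρ : ρ ∈ F.Φ.source) : CotSpace d ≃L[ℝ] CotSpace d :=
  (LinearEquiv.ofInjectiveEndo (derivMap F.Φ ρ : CotSpace d →ₗ[ℝ] CotSpace d)
    (F.derivMap_injective hρ)).toContinuousLinearEquiv

lemma derivEquiv_coe {ρ : PhaseSpace d J} (hρ : ρ ∈ F.Φ.source) :
    (F.derivEquiv hρ : CotSpace d →L[ℝ] CotSpace d) = derivMap F.Φ ρ := by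
  ext1 v; rfl

/-- The inverse function theorem is a statement about normed spaces, so it is applied to `chart`,
between the copy that contains the preimage and the copy that contains the point. -/
lemma smooth_symm (ρ : PhaseSpace d J) (hρ : ρ ∈ F.Φ.target) :
    ContDiffAt ℝ ∞ (fun x : CotSpace d => (F.Φ.symm (ρ.1, x)).2) ρ.2 := by
  have hs := F.Φ.map_target hρ
  have h1 : ρ.2 ∈ (F.chart (F.Φ.symm ρ).1 ρ.1).target := ⟨hρ, rfl⟩
  have h2 : HasFDerivAt (F.chart (F.Φ.symm ρ).1 ρ.1)
      (F.derivEquiv hs : CotSpace d →L[ℝ] CotSpace d)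
      ((F.chart (F.Φ.symm ρ).1 ρ.1).symm ρ.2) := by
    rw [derivEquiv_coe]
    exact (F.hasPhaseDeriv hs).hasFDerivAt
  exact (F.chart (F.Φ.symm ρ).1 ρ.1).contDiffAt_symm h1 h2 (F.smooth _ hs)

lemma hasPhaseDeriv_symm {ρ : PhaseSpace d J} (hρ : ρ ∈ F.Φ.target) :
    HasPhaseDeriv F.Φ.symm (derivMap F.Φ.symm ρ) ρ :=
  (F.smooth_symm ρ hρ).hasStrictFDerivAt (by simp)

lemma derivMap_symm_comp {ρ : PhaseSpace d J} (hρ : ρ ∈ F.Φ.source) :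
    (derivMap F.Φ.symm (F.Φ ρ)).comp (derivMap F.Φ ρ) = ContinuousLinearMap.id ℝ _ := by
  have h1 := (F.hasPhaseDeriv_symm (F.Φ.map_source hρ)).comp (F.hasPhaseDeriv hρ)
    (F.Φ.continuousAt hρ)
  have h2 := (hasPhaseDeriv_id ρ).congr (Ψ' := F.Φ.symm ∘ F.Φ) (by
    filter_upwards [F.Φ.open_source.mem_nhds hρ] with x hx
    exact (F.Φ.left_inv hx).symm)
  rw [← h1.derivMap_eq, h2.derivMap_eq]

lemma derivMap_comp_symm {ρ : PhaseSpace d J} (hρ : ρ ∈ F.Φ.source) :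
    (derivMap F.Φ ρ).comp (derivMap F.Φ.symm (F.Φ ρ)) = ContinuousLinearMap.id ℝ _ := by
  have h0 : F.Φ.symm (F.Φ ρ) = ρ := F.Φ.left_inv hρ
  have h1 := HasPhaseDeriv.comp (Ψ' := F.Φ) (A' := derivMap F.Φ ρ)
    (by rw [h0]; exact F.hasPhaseDeriv hρ)
    (F.hasPhaseDeriv_symm (F.Φ.map_source hρ))
    (F.Φ.symm.continuousAt (F.Φ.map_source hρ))
  have h2 := (hasPhaseDeriv_id (F.Φ ρ)).congr (Ψ' := F.Φ ∘ F.Φ.symm) (by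
    filter_upwards [F.Φ.open_target.mem_nhds (F.Φ.map_source hρ)] with x hx
    exact (F.Φ.right_inv hx).symm)
  rw [← h1.derivMap_eq, h2.derivMap_eq]

/-- The time reversal of an open map. -/
def rev : OpenMap d J where
  Y := F.Y
  isOpen_Y := F.isOpen_Y
  bounded_Y := F.bounded_Y
  contractible_Y := F.contractible_Y
  U := F.U
  isOpen_U := F.isOpen_U
  U_compactlyIn := F.U_compactlyIn
  Φ := F.Φ.symm
  smooth := F.smooth_symm
  symplectic := by
    intro ρ hρ u v
    have hs : F.Φ.symm ρ ∈ F.Φ.source := F.Φ.map_target hρ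
    have h1 := F.derivMap_comp_symm hs
    rw [F.Φ.right_inv hρ] at h1
    rw [← F.symplectic _ hs, ← ContinuousLinearMap.comp_apply, ← ContinuousLinearMap.comp_apply, h1]
    rfl
  D := F.Φ '' F.D
  isCompact_D := F.isCompact_D.image_of_continuousOn (F.Φ.continuousOn.mono F.D_subset_source)
  D_subset_source := by
    rintro _ ⟨ρ, hρ, rfl⟩
    exact F.Φ.map_source (F.D_subset_source hρ)
  D_subset_U := F.image_subset_U
  image_subset_U := by
    rintro _ ⟨_, ⟨ρ, hρ, rfl⟩, rfl⟩
    rw [F.Φ.left_inv (F.D_subset_source hρ)]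
    exact F.D_subset_U hρ

lemma rev_Φ : F.rev.Φ = F.Φ.symm := rfl
lemma rev_U : F.rev.U = F.U := rfl

lemma rel_rev (ρ' ρ : PhaseSpace d J) : F.rev.Rel ρ ρ' ↔ F.Rel ρ' ρ := by
  constructor
  · rintro ⟨⟨σ, hσ, rfl⟩, h2⟩
    rw [rev_Φ, F.Φ.left_inv (F.D_subset_source hσ)] at h2
    subst h2
    exact ⟨hσ, rfl⟩
  · rintro ⟨h1, rfl⟩
    exact ⟨⟨ρ, h1, rfl⟩, (F.Φ.left_inv (F.D_subset_source h1)).symm⟩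

lemma relIter_succ' (n : ℕ) (ρ' ρ : PhaseSpace d J) :
    F.RelIter (n + 1) ρ' ρ ↔ ∃ σ, F.Rel ρ' σ ∧ F.RelIter n σ ρ := by
  induction n generalizing ρ with
  | zero => simp [RelIter]
  | succ n ih =>
    constructor
    · rintro ⟨σ, h1, h2⟩
      obtain ⟨τ, h3, h4⟩ := (ih σ).1 h1
      exact ⟨τ, h3, σ, h4, h2⟩
    · rintro ⟨τ, h3, σ, h4, h2⟩
      exact ⟨σ, (ih σ).2 ⟨τ, h3, h4⟩, h2⟩

lemma relIter_rev (n : ℕ) (ρ' ρ : PhaseSpace d J) :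
    F.rev.RelIter n ρ ρ' ↔ F.RelIter n ρ' ρ := by
  induction n generalizing ρ' with
  | zero => exact eq_comm
  | succ n ih =>
    rw [relIter_succ' F]
    refine exists_congr fun σ => ?_
    rw [ih, rel_rev, and_comm]

/-- Reversal exchanges the tails: each property of `𝒯₊` below is one of `𝒯₋`, read for `rev`. -/
lemma tailMinus_rev : F.rev.tailMinus = F.tailPlus := by
  ext ρ
  simp only [tailMinus, tailPlus, mem_ofPred_eq, relIter_rev, rev_U]

lemma tailPlus_rev : F.rev.tailPlus = F.tailMinus := by
  ext ρ
  simp only [tailMinus, tailPlus, mem_ofPred_eq, relIter_rev, rev_U]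

lemma trapped_rev : F.rev.trapped = F.trapped := by
  rw [trapped, trapped, tailMinus_rev, tailPlus_rev, inter_comm]

lemma relIter_iff (n : ℕ) (ρ' ρ : PhaseSpace d J) :
    F.RelIter n ρ' ρ ↔ (∀ k < n, F.Φ^[k] ρ ∈ F.D) ∧ ρ' = F.Φ^[n] ρ := by
  induction n generalizing ρ with
  | zero => simp [RelIter]
  | succ n ih =>
    constructor
    · rintro ⟨σ, h1, h2, rfl⟩
      obtain ⟨h3, h4⟩ := (ih _).1 h1
      refine ⟨fun k hk => ?_, by rw [h4]; rfl⟩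
      cases k with
      | zero => exact h2
      | succ k => exact h3 k (by omega)
    · rintro ⟨h1, h2⟩
      exact ⟨F.Φ ρ, (ih _).2 ⟨fun k hk => h1 (k + 1) (by omega), h2⟩, h1 0 (by omega), rfl⟩

/-- The iterates are those of a total function, but only values on the departure set occur, so what
`Φ` does off its source is irrelevant. -/
lemma mem_tailMinus {ρ : PhaseSpace d J} : ρ ∈ F.tailMinus ↔ ∀ n, F.Φ^[n] ρ ∈ F.D := by
  constructor
  · intro h n
    -- The `n`-th iterate is in the departure set because one more step is defined.
    obtain ⟨ρ', _, _, h1⟩ := h (n + 1)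
    exact ((F.relIter_iff _ _ _).1 h1).1 n (by omega)
  · intro h n
    exact ⟨F.Φ^[n] ρ, F.D_subset_U (h n), F.D_subset_U (h 0),
      (F.relIter_iff _ _ _).2 ⟨fun k _ => h k, rfl⟩⟩

lemma tailMinus_subset : F.tailMinus ⊆ F.D := fun _ h => F.mem_tailMinus.1 h 0

lemma map_tailMinus {ρ : PhaseSpace d J} (h : ρ ∈ F.tailMinus) : F.Φ ρ ∈ F.tailMinus :=
  F.mem_tailMinus.2 fun n => F.mem_tailMinus.1 h (n + 1)

lemma iterate_tailMinus {ρ : PhaseSpace d J} (h : ρ ∈ F.tailMinus) (n : ℕ) :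
    F.Φ^[n] ρ ∈ F.tailMinus :=
  F.mem_tailMinus.2 fun k => by
    rw [← Function.iterate_add_apply]; exact F.mem_tailMinus.1 h _

lemma mem_tailMinus_of_map {ρ : PhaseSpace d J} (hD : ρ ∈ F.D) (h : F.Φ ρ ∈ F.tailMinus) :
    ρ ∈ F.tailMinus := by
  refine F.mem_tailMinus.2 fun n => ?_
  cases n with
  | zero => exact hD
  | succ n => exact F.mem_tailMinus.1 h n

lemma map_tailPlus {ρ : PhaseSpace d J} (hD : ρ ∈ F.D) (h : ρ ∈ F.tailPlus) :
    F.Φ ρ ∈ F.tailPlus := by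
  rw [← tailMinus_rev] at h ⊢
  refine F.rev.mem_tailMinus_of_map ⟨ρ, hD, rfl⟩ ?_
  rwa [rev_Φ, F.Φ.left_inv (F.D_subset_source hD)]

lemma mem_tailPlus_of_map {ρ : PhaseSpace d J} (hD : ρ ∈ F.D) (h : F.Φ ρ ∈ F.tailPlus) :
    ρ ∈ F.tailPlus := by
  rw [← tailMinus_rev] at h ⊢
  have := F.rev.map_tailMinus h
  rwa [rev_Φ, F.Φ.left_inv (F.D_subset_source hD)] at this

lemma trapped_subset_D : F.trapped ⊆ F.D := fun _ h => F.tailMinus_subset h.2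

lemma trapped_subset_source : F.trapped ⊆ F.Φ.source :=
  F.trapped_subset_D.trans F.D_subset_source

lemma map_trapped {ρ : PhaseSpace d J} (h : ρ ∈ F.trapped) : F.Φ ρ ∈ F.trapped :=
  ⟨F.map_tailPlus (F.trapped_subset_D h) h.1, F.map_tailMinus h.2⟩

lemma symm_trapped {ρ : PhaseSpace d J} (h : ρ ∈ F.trapped) : F.Φ.symm ρ ∈ F.trapped := by
  rw [← trapped_rev] at h ⊢
  exact F.rev.map_trapped h

lemma trapped_subset_target : F.trapped ⊆ F.Φ.target := fun ρ h => by
  rw [← trapped_rev] at h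
  exact F.rev.trapped_subset_source h

lemma iterate_trapped {ρ : PhaseSpace d J} (h : ρ ∈ F.trapped) (n : ℕ) :
    F.Φ^[n] ρ ∈ F.trapped := by
  induction n with
  | zero => exact h
  | succ n ih => rw [Function.iterate_succ_apply']; exact F.map_trapped ih

/-- The iterates are not continuous on the whole space. The points with `n + 1` steps inside the
departure set are those of the departure set whose image has `n` of them, so closedness goes by
induction and uses continuity on the departure set only. -/
lemma isCompact_tailMinus : IsCompact F.tailMinus := by
  have h1 : ∀ n, IsClosed {ρ | ∀ k ≤ n, F.Φ^[k] ρ ∈ F.D} := by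
    intro n
    induction n with
    | zero =>
      simpa using F.isCompact_D.isClosed
    | succ n ih =>
      have h2 := (F.Φ.continuousOn.mono F.D_subset_source).preimage_isClosed_of_isClosed
        F.isCompact_D.isClosed ih
      convert h2 using 1
      ext ρ
      constructor
      · exact fun h => ⟨h 0 (by omega), fun k hk => h (k + 1) (by omega)⟩
      · rintro ⟨h3, h4⟩ k hk
        cases k with
        | zero => exact h3
        | succ k => exact h4 k (by omega)
  have h2 : F.tailMinus = ⋂ n, {ρ | ∀ k ≤ n, F.Φ^[k] ρ ∈ F.D} := by
    ext ρ
    rw [mem_tailMinus, mem_iInter]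
    exact ⟨fun h n k _ => h k, fun h n => h n n le_rfl⟩
  refine F.isCompact_D.of_isClosed_subset ?_ F.tailMinus_subset
  rw [h2]
  exact isClosed_iInter h1

lemma isCompact_tailPlus : IsCompact F.tailPlus := by
  rw [← tailMinus_rev]; exact F.rev.isCompact_tailMinus

lemma isCompact_trapped : IsCompact F.trapped :=
  F.isCompact_tailPlus.inter F.isCompact_tailMinus

lemma trapped_subset_interior_rev (hint : F.trapped ⊆ interior F.D) :
    F.rev.trapped ⊆ interior F.rev.D := by
  rw [trapped_rev]
  intro ρ hρ
  have h1 : IsOpen (F.Φ '' interior F.D) :=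
    F.Φ.isOpen_image_of_subset_source isOpen_interior (interior_subset.trans F.D_subset_source)
  refine interior_maximal (image_mono interior_subset) h1 ?_
  exact ⟨F.Φ.symm ρ, hint (F.symm_trapped hρ), F.Φ.right_inv (F.trapped_subset_target hρ)⟩

lemma hasPhaseDeriv_iterate {ρ : PhaseSpace d J} (n : ℕ)
    (h : ∀ k < n, F.Φ^[k] ρ ∈ F.Φ.source) :
    ContinuousAt F.Φ^[n] ρ ∧ HasPhaseDeriv F.Φ^[n] (derivMapIter F.Φ n ρ) ρ := by
  induction n generalizing ρ with
  | zero => exact ⟨continuousAt_id, hasPhaseDeriv_id ρ⟩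
  | succ n ih =>
    have h0 : ρ ∈ F.Φ.source := h 0 (by omega)
    obtain ⟨h1, h2⟩ := ih (ρ := F.Φ ρ) fun k hk => h (k + 1) (by omega)
    exact ⟨ContinuousAt.comp (f := F.Φ) (x := ρ) h1 (F.Φ.continuousAt h0),
      h2.comp (F.hasPhaseDeriv h0) (F.Φ.continuousAt h0)⟩

lemma iterate_trapped_source {ρ : PhaseSpace d J} (h : ρ ∈ F.trapped) (k : ℕ) :
    F.Φ^[k] ρ ∈ F.Φ.source := F.trapped_subset_source (F.iterate_trapped h k)

/-- The trapped set attracts the incoming tail, uniformly. -/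
lemma tailMinus_attracted (hne : F.trapped.Nonempty) {η : ℝ} (hη : 0 < η) :
    ∃ δ > 0, ∀ ρ ∈ F.tailMinus, Metric.infDist ρ F.trapped < δ →
      ∀ n, Metric.infDist (F.Φ^[n] ρ) F.trapped < η := by
  have hmaps : MapsTo F.Φ F.tailMinus F.tailMinus := fun _ h => F.map_tailMinus h
  have hcont : ∀ n, ContinuousOn F.Φ^[n] F.tailMinus := fun n =>
    (F.Φ.continuousOn.mono (F.tailMinus_subset.trans F.D_subset_source)).iterate hmaps n
  -- The images of `𝒯₋` form a decreasing sequence of compact sets with intersection inside `𝒯`, so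
  -- one of them is already in the thickening. This settles all `n ≥ N`.
  obtain ⟨N, hN⟩ : ∃ N, F.Φ^[N] '' F.tailMinus ⊆ Metric.thickening η F.trapped := by
    refine exists_subset_nhds_of_isCompact (V := fun n => F.Φ^[n] '' F.tailMinus) ?_
      (fun n => F.isCompact_tailMinus.image_of_continuousOn (hcont n)) ?_
    · refine directed_of_isDirected_le (r := fun x y : Set (PhaseSpace d J) => x ⊇ y) fun m n hmn => ?_
      rintro _ ⟨ρ, hρ, rfl⟩
      refine ⟨F.Φ^[n - m] ρ, F.iterate_tailMinus hρ _, ?_⟩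
      rw [← Function.iterate_add_apply]
      congr 2; omega
    · intro ρ hρ
      rw [mem_iInter] at hρ
      have hm : ρ ∈ F.tailMinus := by
        obtain ⟨σ, hσ, rfl⟩ := hρ 0; exact hσ
      have hp : ρ ∈ F.trapped := by
        refine ⟨fun n => ?_, hm⟩
        obtain ⟨σ, hσ, h1⟩ := hρ n
        exact ⟨σ, F.D_subset_U (F.tailMinus_subset hσ), F.D_subset_U (F.tailMinus_subset hm),
          (F.relIter_iff _ _ _).2 ⟨fun k _ => F.mem_tailMinus.1 hσ k, h1.symm⟩⟩
      exact Metric.isOpen_thickening.mem_nhds (Metric.self_subset_thickening hη _ hp)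
  -- The finitely many times `n < N` are treated by continuity: the starting points that stray at
  -- time `n` form a closed set disjoint from `𝒯`.
  set B : ℕ → Set (PhaseSpace d J) := fun n =>
    F.tailMinus ∩ F.Φ^[n] ⁻¹' {ρ | η ≤ Metric.infDist ρ F.trapped}
  have hB : ∀ n, IsClosed (B n) := fun n =>
    (hcont n).preimage_isClosed_of_isClosed F.isCompact_tailMinus.isClosed
      (isClosed_le continuous_const (Metric.continuous_infDist_pt _))
  have hBc : IsClosed (⋃ n ∈ Finset.range N, B n) :=
    isClosed_biUnion_finset fun n _ => hB n
  obtain ⟨δ, hδ, hsub⟩ := F.isCompact_trapped.exists_thickening_subset_open hBc.isOpen_compl (by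
    intro ρ hρ hmem
    rw [mem_iUnion₂] at hmem
    obtain ⟨n, _, _, h2⟩ := hmem
    have h3 : η ≤ Metric.infDist (F.Φ^[n] ρ) F.trapped := h2
    rw [Metric.infDist_zero_of_mem (F.iterate_trapped hρ n)] at h3
    linarith)
  refine ⟨δ, hδ, fun ρ hρ hd n => ?_⟩
  rcases lt_or_ge n N with hn | hn
  · have h1 : ρ ∉ ⋃ n ∈ Finset.range N, B n := hsub ((Metric.mem_thickening_iff_infDist_lt hne).2 hd)
    by_contra h2
    exact h1 (mem_iUnion₂.2 ⟨n, by simpa using hn, hρ, not_lt.1 h2⟩)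
  · have h1 : F.Φ^[n] ρ ∈ F.Φ^[N] '' F.tailMinus := by
      refine ⟨F.Φ^[n - N] ρ, F.iterate_tailMinus hρ _, ?_⟩
      rw [← Function.iterate_add_apply]
      congr 2; omega
    exact (Metric.mem_thickening_iff_infDist_lt hne).1 (hN h1)

end OpenMap

/-! ### Shadowing for nonautonomous hyperbolic sequences -/

section Shadowing

variable {E : Type*} [NormedAddCommGroup E] [NormedSpace ℝ E] [CompleteSpace E]

/-- A nonautonomous hyperbolic sequence of maps has an orbit close to zero, if zero is almost an
orbit. -/
theorem exists_orbit_near_zero (P B : ℤ → E →L[ℝ] E) (f : ℤ → E → E) {r c : ℝ} (hc : 0 ≤ c)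
    (hcr : 4 * c ≤ r)
    (hP : ∀ n v, P n (P n v) = P n v) (hPB : ∀ n v, P n (B n v) = B n v)
    (hstable : ∀ n v w, ‖v‖ ≤ r → ‖w‖ ≤ r →
      ‖(f n v - f n w) - P (n + 1) (f n v - f n w)‖ ≤ 1 / 8 * ‖v - w‖)
    (hunstable : ∀ n v w, ‖v‖ ≤ r → ‖w‖ ≤ r →
      ‖P n (v - w) - B n (f n v - f n w)‖ ≤ 1 / 8 * ‖v - w‖)
    (hB : ∀ n v, ‖B n v‖ ≤ 1 / 8 * ‖v‖)
    (hinj : ∀ n u, P (n + 1) u = u → B n u = 0 → u = 0)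
    (hjump : ∀ n, ‖f n 0 - P (n + 1) (f n 0)‖ ≤ c ∧ ‖B n (f n 0)‖ ≤ c) :
    ∃ w : ℤ → E, (∀ n, ‖w n‖ ≤ 4 * c) ∧ ∀ n, w (n + 1) = f n (w n) := by
  have hr : 0 ≤ r := by linarith
  -- The stable component at time `n` is pushed from the past, and the unstable one is pulled back
  -- from the future by `B`. Each of the three terms is `1/8`-Lipschitz in the sup norm, so `T`
  -- contracts by `3/8`.
  let T : (ℤ → E) → ℤ → E := fun w n =>
    (f (n - 1) (w (n - 1)) - P n (f (n - 1) (w (n - 1)))) +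
      (P n (w n) - B n (f n (w n))) + B n (w (n + 1))
  have hlip : ∀ v w : ℤ → E, (∀ n, ‖v n‖ ≤ r) → (∀ n, ‖w n‖ ≤ r) → ∀ D, (∀ n, ‖v n - w n‖ ≤ D) →
      ∀ n, ‖T v n - T w n‖ ≤ 3 / 8 * D := by
    intro v w hv hw D hD n
    have h1 := hstable (n - 1) (v (n - 1)) (w (n - 1)) (hv _) (hw _)
    have h2 := hunstable n (v n) (w n) (hv _) (hw _)
    have h3 := hB n (v (n + 1) - w (n + 1))
    have e : T v n - T w n =
        ((f (n - 1) (v (n - 1)) - f (n - 1) (w (n - 1))) -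
          P n (f (n - 1) (v (n - 1)) - f (n - 1) (w (n - 1)))) +
        (P n (v n - w n) - B n (f n (v n) - f n (w n))) + B n (v (n + 1) - w (n + 1)) := by
      simp only [T, map_sub]; abel
    rw [sub_add_cancel] at h1
    rw [e]
    refine (norm_add₃_le).trans ?_
    linarith [hD (n - 1), hD n, hD (n + 1)]
  have hT0 : ∀ n, ‖T 0 n‖ ≤ 2 * c := by
    intro n
    have h1 := (hjump (n - 1)).1
    have h2 := (hjump n).2
    rw [sub_add_cancel] at h1
    have e : T 0 n = (f (n - 1) 0 - P n (f (n - 1) 0)) - B n (f n 0) := by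
      simp only [T, Pi.zero_apply, map_zero]; abel
    rw [e]
    refine (norm_sub_le _ _).trans ?_
    linarith
  let W : ℕ → ℤ → E := fun k => T^[k] 0
  have hWs : ∀ k, W (k + 1) = T (W k) := fun k => Function.iterate_succ_apply' T k 0
  -- The ball of radius `4c` is invariant: `3/8 · 4c + 2c ≤ 4c`.
  have hWb : ∀ k n, ‖W k n‖ ≤ 4 * c := by
    intro k
    induction k with
    | zero => intro n; simp only [W, Function.iterate_zero, id, Pi.zero_apply, norm_zero]; linarith
    | succ k ih =>
      intro n
      have h1 := hlip (W k) 0 (fun n => (ih n).trans hcr) (by simpa using hr) (4 * c)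
        (by simpa using ih) n
      rw [hWs]
      have h2 := norm_le_norm_add_norm_sub' (T (W k) n) (T 0 n)
      linarith [hT0 n]
  have hWd : ∀ k n, ‖W k n - W (k + 1) n‖ ≤ 8 * c * (3 / 8) ^ k := by
    intro k
    induction k with
    | zero =>
      intro n
      refine (norm_sub_le _ _).trans ?_
      linarith [hWb 0 n, hWb 1 n]
    | succ k ih =>
      intro n
      have h1 := hlip (W k) (W (k + 1)) (fun n => (hWb _ n).trans hcr)
        (fun n => (hWb _ n).trans hcr) _ ih n
      rw [hWs (k + 1)]
      nth_rw 1 [hWs k]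
      refine h1.trans (le_of_eq ?_)
      rw [pow_succ]; ring
  have hcau : ∀ n, CauchySeq fun k => W k n := fun n =>
    cauchySeq_of_le_geometric (3 / 8) (8 * c) (by norm_num) fun k => by
      rw [dist_eq_norm]; exact hWd k n
  choose w hw using fun n => cauchySeq_tendsto_of_complete (hcau n)
  have hwb : ∀ n, ‖w n‖ ≤ 4 * c := fun n =>
    le_of_tendsto (hw n).norm (Filter.Eventually.of_forall fun k => hWb k n)
  -- The rate is uniform in `n`; pointwise convergence would not allow the use of `hlip` in the
  -- limit.
  have hwk : ∀ k n, ‖W k n - w n‖ ≤ 8 * c * (3 / 8) ^ k / (1 - 3 / 8) := fun k n => by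
    rw [← dist_eq_norm]
    exact dist_le_of_le_geometric_of_tendsto (3 / 8) (8 * c) (by norm_num)
      (fun k => by rw [dist_eq_norm]; exact hWd k n) (hw n) k
  have hfix : ∀ n, w n = T w n := by
    intro n
    have h1 : Filter.Tendsto (fun k => W (k + 1) n) Filter.atTop (nhds (T w n)) := by
      rw [tendsto_iff_norm_sub_tendsto_zero]
      have hz : Filter.Tendsto (fun k : ℕ => 3 / 8 * (8 * c * (3 / 8 : ℝ) ^ k / (1 - 3 / 8)))
          Filter.atTop (nhds 0) := by
        have h3 := (tendsto_pow_atTop_nhds_zero_of_lt_one (r := (3 / 8 : ℝ)) (by norm_num)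
          (by norm_num)).const_mul (3 / 8 * (8 * c) / (1 - 3 / 8))
        rw [mul_zero] at h3
        refine h3.congr fun k => by ring
      refine squeeze_zero (fun k => norm_nonneg _) (fun k => ?_) hz
      rw [hWs]
      exact hlip (W k) w (fun n => (hWb _ n).trans hcr) (fun n => (hwb n).trans hcr) _ (hwk k) n
    exact tendsto_nhds_unique ((Filter.tendsto_add_atTop_iff_nat 1).2 (hw n)) h1
  refine ⟨w, hwb, ?_⟩
  -- the defect is in the range of `P` and in the kernel of `B`
  have hdef : ∀ n, (w n - f (n - 1) (w (n - 1))) - P n (w n - f (n - 1) (w (n - 1))) =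
      B n (w (n + 1) - f n (w n)) := by
    intro n
    have h1 := hfix n
    simp only [T] at h1
    rw [map_sub, map_sub]
    nth_rw 1 [h1]
    abel
  -- In `hdef` the left side is killed by `P n` and the right side is fixed by it, so both vanish.
  -- The defect at time `n + 1` is then in the range of `P (n + 1)` and in the kernel of `B n`,
  -- where `hinj` applies.
  have hker : ∀ n, B n (w (n + 1) - f n (w n)) = 0 := by
    intro n
    have h1 := hPB n (w (n + 1) - f n (w n))
    rw [← hdef n, map_sub, hP, sub_self] at h1
    rw [← hdef n]
    exact h1.symm
  intro n
  have h1 := hdef (n + 1)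
  rw [hker, add_sub_cancel_right] at h1
  exact sub_eq_zero.1 (hinj n _ (sub_eq_zero.1 h1).symm (hker n))

end Shadowing

/-! ### Uniform strict differentiability on compact sets -/

section UniformDerivative

/-- The map `f - A` is `κ`-Lipschitz near `y`, so its derivative there has norm at most `κ`. Thus
strict differentiability at one point controls the derivatives at nearby points, and no continuity
of the derivative has to be assumed. -/
lemma norm_deriv_sub_le_of_approx {E E' : Type*} [NormedAddCommGroup E] [NormedSpace ℝ E]
    [NormedAddCommGroup E'] [NormedSpace ℝ E'] {f : E → E'} {A B : E →L[ℝ] E'} {x y : E} {r κ : ℝ}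
    (hκ : 0 ≤ κ) (hd : HasFDerivAt f B y) (hy : y ∈ Metric.ball x r)
    (H : ∀ u ∈ Metric.ball x r, ∀ u' ∈ Metric.ball x r, ‖f u - f u' - A (u - u')‖ ≤ κ * ‖u - u'‖) :
    ‖B - A‖ ≤ κ := by
  have h4 : LipschitzOnWith (Real.toNNReal κ) (fun u => f u - A u) (Metric.ball x r) := by
    refine LipschitzOnWith.of_dist_le_mul fun u hu u' hu' => ?_
    rw [dist_eq_norm, dist_eq_norm, Real.coe_toNNReal _ hκ]
    refine le_trans (le_of_eq ?_) (H u hu u' hu')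
    rw [map_sub]; congr 1; abel
  have h5 := (hd.sub A.hasFDerivAt).le_of_lipschitzOn (Metric.isOpen_ball.mem_nhds hy) h4
  rwa [Real.coe_toNNReal _ hκ] at h5

variable {d J : ℕ}

/-- Strict differentiability is uniform on compact sets. -/
lemma exists_uniform_strict_deriv {Ψ : PhaseSpace d J → PhaseSpace d J}
    {A : PhaseSpace d J → CotSpace d →L[ℝ] CotSpace d} {K : Set (PhaseSpace d J)}
    (hK : IsCompact K) (h : ∀ x ∈ K, ContinuousAt Ψ x ∧ HasPhaseDeriv Ψ (A x) x) {κ : ℝ}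
    (hκ : 0 < κ) :
    ∃ r > 0, ∀ x ∈ K, ∀ v w : CotSpace d, dist v x.2 < r → dist w x.2 < r →
      (Ψ (x.1, v)).1 = (Ψ x).1 ∧
      ‖(Ψ (x.1, v)).2 - (Ψ (x.1, w)).2 - A x (v - w)‖ ≤ κ * ‖v - w‖ := by
  refine hK.induction_on (p := fun s => ∃ r > 0, ∀ x ∈ s, ∀ v w : CotSpace d, dist v x.2 < r →
    dist w x.2 < r → (Ψ (x.1, v)).1 = (Ψ x).1 ∧
      ‖(Ψ (x.1, v)).2 - (Ψ (x.1, w)).2 - A x (v - w)‖ ≤ κ * ‖v - w‖) ?_ ?_ ?_ ?_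
  · exact ⟨1, one_pos, fun x hx => hx.elim⟩
  · rintro s t hst ⟨r, hr, H⟩
    exact ⟨r, hr, fun x hx => H x (hst hx)⟩
  · rintro s t ⟨r, hr, H⟩ ⟨r', hr', H'⟩
    refine ⟨min r r', lt_min hr hr', fun x hx v w hv hw => ?_⟩
    rcases hx with hx | hx
    · exact H x hx v w (hv.trans_le (min_le_left _ _)) (hw.trans_le (min_le_left _ _))
    · exact H' x hx v w (hv.trans_le (min_le_right _ _)) (hw.trans_le (min_le_right _ _))
  · intro x hx
    obtain ⟨hc, hd⟩ := h x hx
    -- One half of `κ` is for the estimate at `x`, the other for replacing `A x` by the derivative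
    -- at a neighbouring point.
    have h1 := (hasStrictFDerivAt_iff_isLittleO.1 hd).def (half_pos hκ)
    obtain ⟨r1, hr1, H1⟩ := Metric.eventually_nhds_iff.1 (eventually_fst_eq hc)
    obtain ⟨r2, hr2, H2⟩ := Metric.eventually_nhds_iff.1 h1
    set r := min (min r1 r2) 1
    have hr : 0 < r := by positivity
    have hrr1 : r ≤ r1 := (min_le_left _ _).trans (min_le_left _ _)
    have hrr2 : r ≤ r2 := (min_le_left _ _).trans (min_le_right _ _)
    refine ⟨Metric.ball x (r / 2) ∩ K,
      Filter.inter_mem (mem_nhdsWithin_of_mem_nhds (Metric.ball_mem_nhds _ (by positivity)))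
        self_mem_nhdsWithin, r / 2, by positivity, ?_⟩
    rintro ⟨j, y⟩ ⟨hy, hyK⟩ v w hv hw
    rw [Metric.mem_ball] at hy
    have hj : j = x.1 := fst_eq_of_dist_lt_one
      (hy.trans_le ((half_le_self hr.le).trans (min_le_right _ _)))
    subst hj
    have hy2 : dist y x.2 < r / 2 := (dist_snd_le (x.1, y) x).trans_lt hy
    have hball : ∀ u : CotSpace d, dist u y < r / 2 → dist u x.2 < r := fun u hu => by
      have := dist_triangle u y x.2; linarith
    have hfst : ∀ u : CotSpace d, dist u y < r / 2 → (Ψ (x.1, u)).1 = (Ψ x).1 := fun u hu =>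
      H1 ((hball u hu).trans_le hrr1)
    have hest : ∀ u ∈ Metric.ball x.2 r, ∀ u' ∈ Metric.ball x.2 r,
        ‖(Ψ (x.1, u)).2 - (Ψ (x.1, u')).2 - A x (u - u')‖ ≤ κ / 2 * ‖u - u'‖ := fun u hu u' hu' =>
      H2 (y := (u, u')) (max_lt (lt_of_lt_of_le hu hrr2) (lt_of_lt_of_le hu' hrr2))
    -- the derivative at nearby points is close
    have hA : ‖A (x.1, y) - A x‖ ≤ κ / 2 :=
      norm_deriv_sub_le_of_approx (by positivity) (h _ hyK).2.hasFDerivAt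
        (hy2.trans (half_lt_self hr)) hest
    refine ⟨?_, ?_⟩
    · have e1 : dist y y < r / 2 := by rw [dist_self]; positivity
      exact (hfst v hv).trans (hfst y e1).symm
    · have h6 := hest v (hball v hv) w (hball w hw)
      have h7 := (A (x.1, y) - A x).le_of_opNorm_le hA (v - w)
      have e : (Ψ (x.1, v)).2 - (Ψ (x.1, w)).2 - A (x.1, y) (v - w) =
          ((Ψ (x.1, v)).2 - (Ψ (x.1, w)).2 - A x (v - w)) - (A (x.1, y) - A x) (v - w) := by
        rw [sub_apply]; abel
      show ‖(Ψ (x.1, v)).2 - (Ψ (x.1, w)).2 - A (x.1, y) (v - w)‖ ≤ κ * ‖v - w‖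
      rw [e]
      refine (norm_sub_le _ _).trans ?_
      linarith

/-- A map that is strictly differentiable on a compact set is uniformly Lipschitz near its
points. -/
lemma exists_uniform_lipschitz {Ψ : PhaseSpace d J → PhaseSpace d J}
    {A : PhaseSpace d J → CotSpace d →L[ℝ] CotSpace d} {K : Set (PhaseSpace d J)}
    (hK : IsCompact K) (h : ∀ x ∈ K, ContinuousAt Ψ x ∧ HasPhaseDeriv Ψ (A x) x) :
    ∃ r > 0, ∃ L ≥ 1, (∀ x ∈ K, ‖A x‖ ≤ L) ∧ ∀ x ∈ K, ∀ p q : PhaseSpace d J, dist p x < r →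
      dist q x < r → dist (Ψ p) (Ψ q) ≤ L * dist p q := by
  obtain ⟨r, hr, H⟩ := exists_uniform_strict_deriv hK h one_pos
  -- a uniform Lipschitz bound for the coordinates near each point
  have hloc : ∃ L : ℝ, ∀ x ∈ K, ‖A x‖ ≤ L := by
    refine hK.induction_on (p := fun s => ∃ L : ℝ, ∀ x ∈ s, ‖A x‖ ≤ L) ?_ ?_ ?_ ?_
    · exact ⟨0, fun x hx => hx.elim⟩
    · rintro s t hst ⟨L, hL⟩
      exact ⟨L, fun x hx => hL x (hst hx)⟩
    · rintro s t ⟨L, hL⟩ ⟨L', hL'⟩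
      refine ⟨max L L', fun x hx => ?_⟩
      rcases hx with hx | hx
      · exact (hL x hx).trans (le_max_left _ _)
      · exact (hL' x hx).trans (le_max_right _ _)
    · intro x hx
      refine ⟨Metric.ball x (min r 1) ∩ K,
        Filter.inter_mem (mem_nhdsWithin_of_mem_nhds (Metric.ball_mem_nhds _ (by positivity)))
        self_mem_nhdsWithin, ‖A x‖ + 1, ?_⟩
      rintro ⟨j, y⟩ ⟨hy, hyK⟩
      rw [Metric.mem_ball] at hy
      have hj : j = x.1 := fst_eq_of_dist_lt_one (hy.trans_le (min_le_right _ _))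
      subst hj
      have hy2 : dist y x.2 < r := (dist_snd_le (x.1, y) x).trans_lt (hy.trans_le (min_le_left _ _))
      have h5 : ‖A (x.1, y) - A x‖ ≤ 1 :=
        norm_deriv_sub_le_of_approx zero_le_one (h _ hyK).2.hasFDerivAt hy2
          fun u hu u' hu' => (H x hx u u' hu hu').2
      have h6 := norm_le_norm_add_norm_sub' (A (x.1, y)) (A x)
      linarith
  obtain ⟨L, hL⟩ := hloc
  refine ⟨min r 1, by positivity, max L 0 + 1, by linarith [le_max_right L 0], fun x hx => ?_,
    fun x hx p q hp hq => ?_⟩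
  · linarith [hL x hx, le_max_left L 0]
  · have hp1 : p.1 = x.1 := fst_eq_of_dist_lt_one (hp.trans_le (min_le_right _ _))
    have hq1 : q.1 = x.1 := fst_eq_of_dist_lt_one (hq.trans_le (min_le_right _ _))
    have hp2 : dist p.2 x.2 < r := (dist_snd_le p x).trans_lt (hp.trans_le (min_le_left _ _))
    have hq2 : dist q.2 x.2 < r := (dist_snd_le q x).trans_lt (hq.trans_le (min_le_left _ _))
    obtain ⟨h1, h2⟩ := H x hx p.2 q.2 hp2 hq2
    have h3 := (H x hx q.2 p.2 hq2 hp2).1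
    have ep : p = (x.1, p.2) := Prod.ext hp1 rfl
    have eq' : q = (x.1, q.2) := Prod.ext hq1 rfl
    rw [← ep, ← eq'] at h2
    rw [← ep] at h1
    rw [← eq'] at h3
    rw [dist_of_fst_eq (h1.trans h3.symm), dist_of_fst_eq (hp1.trans hq1.symm), dist_eq_norm,
      dist_eq_norm]
    have h4 := (A x).le_of_opNorm_le (hL x hx) (p.2 - q.2)
    have h5 := norm_le_norm_add_norm_sub' ((Ψ p).2 - (Ψ q).2) (A x (p.2 - q.2))
    have h6 : L * ‖p.2 - q.2‖ ≤ max L 0 * ‖p.2 - q.2‖ := by gcongr; exact le_max_left _ _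
    linarith

end UniformDerivative

/-! ### Continuity of the projections of a splitting -/

section ObliqueProjection

variable {E : Type*} [NormedAddCommGroup E] [InnerProductSpace ℝ E] [FiniteDimensional ℝ E]

/-- The projection onto `R` along `N`, in terms of the orthogonal projections. -/
def obliqueProj (R N : Submodule ℝ E) : E →L[ℝ] E :=
  R.starProjection * Ring.inverse (R.starProjection - N.starProjection)

/-- If the two orthogonal projections of `v` agree, their common value lies in `R ∩ N = 0`; so `v`
is orthogonal to `R + N`, which is everything. -/
lemma isUnit_starProjection_sub {R N : Submodule ℝ E} (h : IsCompl R N) :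
    IsUnit (R.starProjection - N.starProjection) := by
  have hinj : Function.Injective (R.starProjection - N.starProjection) := by
    rw [injective_iff_map_eq_zero]
    intro v hv
    rw [sub_apply, sub_eq_zero] at hv
    have h1 : R.starProjection v ∈ R := R.starProjection_apply_mem v
    have h2 : R.starProjection v ∈ N := by rw [hv]; exact N.starProjection_apply_mem v
    have h0 : R.starProjection v = 0 := by
      have := h.disjoint
      rw [Submodule.disjoint_def] at this
      exact this _ h1 h2
    have h3 : v ∈ Rᗮ := R.starProjection_apply_eq_zero_iff.1 h0
    have h4 : v ∈ Nᗮ := N.starProjection_apply_eq_zero_iff.1 (hv ▸ h0)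
    have h5 : v ∈ (R ⊔ N)ᗮ := by
      rw [← Submodule.inf_orthogonal]; exact ⟨h3, h4⟩
    rw [h.sup_eq_top, Submodule.top_orthogonal_eq_bot] at h5
    exact h5
  let e : E ≃L[ℝ] E := (LinearEquiv.ofInjectiveEndo
    ((R.starProjection - N.starProjection : E →L[ℝ] E) : E →ₗ[ℝ] E) hinj).toContinuousLinearEquiv
  have he : (e : E →L[ℝ] E) = R.starProjection - N.starProjection := by ext1 v; rfl
  rw [← he]
  exact (ContinuousLinearEquiv.toUnit e).isUnit

/-- The projection `M` along `N` satisfies `M (P_R - P_N) = P_R`, whence the formula. It expresses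
`M` by the orthogonal projections through a product and an inverse, so the continuity assumed of the
splitting passes to `M`. -/
lemma obliqueProj_apply {R N : Submodule ℝ E} (h : IsCompl R N) :
    (∀ v ∈ R, obliqueProj R N v = v) ∧ (∀ v ∈ N, obliqueProj R N v = 0) ∧
      (∀ v, obliqueProj R N v ∈ R) ∧ ∀ v, v - obliqueProj R N v ∈ N := by
  let M : E →L[ℝ] E := LinearMap.toContinuousLinearMap (R.subtype ∘ₗ R.projectionOnto N h)
  have hMR : ∀ v ∈ R, M v = v := fun v hv => by
    show ((R.projectionOnto N h v : R) : E) = v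
    have := Submodule.projectionOnto_apply_left h ⟨v, hv⟩
    exact congrArg Subtype.val this
  have hMN : ∀ v ∈ N, M v = 0 := fun v hv => by
    show ((R.projectionOnto N h v : R) : E) = 0
    rw [(Submodule.projectionOnto_apply_eq_zero_iff h).2 hv]; rfl
  have hM : obliqueProj R N = M := by
    have h1 : M * (R.starProjection - N.starProjection) = R.starProjection := by
      ext1 v
      rw [mul_apply_eq_comp, sub_apply, map_sub,
        hMR _ (R.starProjection_apply_mem v), hMN _ (N.starProjection_apply_mem v), sub_zero]
    rw [obliqueProj]
    nth_rw 1 [← h1]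
    rw [mul_assoc, Ring.mul_inverse_cancel _ (isUnit_starProjection_sub h), mul_one]
  rw [hM]
  have hmem : ∀ v, M v ∈ R := fun v => (R.projectionOnto N h v : R).2
  refine ⟨hMR, hMN, hmem, fun v => ?_⟩
  have h2 : M (v - M v) = 0 := by rw [map_sub, hMR _ (hmem v), sub_self]
  have h3 : R.projectionOnto N h (v - M v) = 0 := Subtype.ext h2
  exact (Submodule.projectionOnto_apply_eq_zero_iff h).1 h3

lemma continuousOn_obliqueProj {X : Type*} [TopologicalSpace X] {R N : X → Submodule ℝ E}
    {s : Set X} (hR : ContinuousOn (fun x => (R x).starProjection) s)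
    (hN : ContinuousOn (fun x => (N x).starProjection) s) (h : ∀ x ∈ s, IsCompl (R x) (N x)) :
    ContinuousOn (fun x => obliqueProj (R x) (N x)) s := by
  intro x hx
  obtain ⟨u, hu⟩ := isUnit_starProjection_sub (h x hx)
  have h1 : ContinuousWithinAt (fun x => Ring.inverse ((R x).starProjection -
      (N x).starProjection)) s x := by
    have h2 := NormedRing.inverse_continuousAt u
    rw [hu] at h2
    exact ContinuousAt.comp_continuousWithinAt (g := Ring.inverse) h2 ((hR x hx).sub (hN x hx))
  exact (hR x hx).mul h1

end ObliqueProjection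

/-! ### Hyperbolicity in terms of projections; orbits near the trapped set -/

namespace OpenMap

variable {d J : ℕ} (F : OpenMap d J)

/-- Hyperbolicity in terms of the projections onto the unstable along the stable directions. -/
structure HypProj (P : PhaseSpace d J → CotSpace d →L[ℝ] CotSpace d) (M C θ : ℝ) : Prop where
  continuousOn : ContinuousOn P F.trapped
  idem : ∀ ρ ∈ F.trapped, ∀ v, P ρ (P ρ v) = P ρ v
  equivariant : ∀ ρ ∈ F.trapped, ∀ v, derivMap F.Φ ρ (P ρ v) = P (F.Φ ρ) (derivMap F.Φ ρ v)
  norm_le : ∀ ρ ∈ F.trapped, ‖P ρ‖ ≤ M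
  M_nonneg : 0 ≤ M
  θ_pos : 0 < θ
  θ_lt_one : θ < 1
  stable : ∀ ρ ∈ F.trapped, ∀ (n : ℕ) v, ‖derivMapIter F.Φ n ρ (v - P ρ v)‖ ≤ C * θ ^ n * ‖v‖
  unstable : ∀ ρ ∈ F.trapped, ∀ (n : ℕ) v, ‖derivMapIter F.Φ.symm n ρ (P ρ v)‖ ≤ C * θ ^ n * ‖v‖

variable {F}

lemma IsHyperbolic.exists_hypProj (hF : F.IsHyperbolic) (hne : F.trapped.Nonempty) :
    ∃ P M C θ, F.HypProj P M C θ := by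
  obtain ⟨Ep, Em, hcp, hcm, hsplit, C, θ, hθ0, hθ1, hest⟩ := hF
  set P : PhaseSpace d J → CotSpace d →L[ℝ] CotSpace d := fun ρ => obliqueProj (Ep ρ) (Em ρ)
  have hcompl : ∀ ρ ∈ F.trapped, IsCompl (Ep ρ) (Em ρ) := fun ρ h => (hsplit ρ h).1
  have hcont : ContinuousOn P F.trapped := continuousOn_obliqueProj hcp hcm hcompl
  obtain ⟨M0, hM0⟩ := F.isCompact_trapped.exists_bound_of_continuousOn hcont
  have hM : 0 ≤ M0 := by
    obtain ⟨ρ, hρ⟩ := hne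
    exact (norm_nonneg _).trans (hM0 ρ hρ)
  refine ⟨P, M0, max C 0 * (1 + M0), θ, hcont, ?_, ?_, hM0, hM, hθ0, hθ1, ?_, ?_⟩
  · intro ρ hρ v
    obtain ⟨h1, _, h3, _⟩ := obliqueProj_apply (hcompl ρ hρ)
    exact h1 _ (h3 v)
  · intro ρ hρ v
    obtain ⟨_, _, h3, h4⟩ := obliqueProj_apply (hcompl ρ hρ)
    obtain ⟨h1', h2', _, _⟩ := obliqueProj_apply (hcompl _ (F.map_trapped hρ))
    obtain ⟨_, _, _, hp, hm⟩ := hsplit ρ hρ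
    have h5 : derivMap F.Φ ρ (P ρ v) ∈ Ep (F.Φ ρ) := by
      rw [← hp]; exact Submodule.mem_map_of_mem (h3 v)
    have h6 : derivMap F.Φ ρ (v - P ρ v) ∈ Em (F.Φ ρ) := by
      rw [← hm]; exact Submodule.mem_map_of_mem (h4 v)
    have h7 : derivMap F.Φ ρ v = derivMap F.Φ ρ (P ρ v) + derivMap F.Φ ρ (v - P ρ v) := by
      rw [← map_add, add_sub_cancel]
    rw [h7, map_add]
    show _ = obliqueProj _ _ _ + obliqueProj _ _ _
    rw [h1' _ h5, h2' _ h6, add_zero]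
  · intro ρ hρ n v
    obtain ⟨_, _, _, h4⟩ := obliqueProj_apply (hcompl ρ hρ)
    refine ((hest ρ hρ n).1 _ (h4 v)).trans ?_
    have h5 : ‖v - P ρ v‖ ≤ (1 + M0) * ‖v‖ := by
      have := (P ρ).le_of_opNorm_le (hM0 ρ hρ) v
      have := norm_sub_le v (P ρ v)
      linarith
    calc C * θ ^ n * ‖v - P ρ v‖ ≤ max C 0 * θ ^ n * ((1 + M0) * ‖v‖) := by
          gcongr; exact le_max_left _ _
      _ = _ := by ring
  · intro ρ hρ n v
    obtain ⟨_, _, h3, _⟩ := obliqueProj_apply (hcompl ρ hρ)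
    refine ((hest ρ hρ n).2 _ (h3 v)).trans ?_
    have h5 : ‖P ρ v‖ ≤ (1 + M0) * ‖v‖ := by
      have := (P ρ).le_of_opNorm_le (hM0 ρ hρ) v
      linarith [norm_nonneg v]
    calc C * θ ^ n * ‖P ρ v‖ ≤ max C 0 * θ ^ n * ((1 + M0) * ‖v‖) := by
          gcongr; exact le_max_left _ _
      _ = _ := by ring

lemma IsHyperbolic.rev (hF : F.IsHyperbolic) : F.rev.IsHyperbolic := by
  obtain ⟨Ep, Em, hcp, hcm, hsplit, C, θ, hθ0, hθ1, hest⟩ := hF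
  refine ⟨Em, Ep, ?_⟩
  rw [trapped_rev, rev_Φ, F.Φ.symm_symm]
  have hmap : ∀ ρ ∈ F.trapped, ∀ S : PhaseSpace d J → Submodule ℝ (CotSpace d),
      (S (F.Φ.symm ρ)).map (derivMap F.Φ (F.Φ.symm ρ) : CotSpace d →ₗ[ℝ] CotSpace d) =
        S (F.Φ (F.Φ.symm ρ)) →
      (S ρ).map (derivMap F.Φ.symm ρ : CotSpace d →ₗ[ℝ] CotSpace d) = S (F.Φ.symm ρ) := by
    intro ρ hρ S hS
    have hs := F.trapped_subset_source (F.symm_trapped hρ)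
    have h1 := F.derivMap_symm_comp hs
    rw [F.Φ.right_inv (F.trapped_subset_target hρ)] at hS h1
    rw [← hS, ← Submodule.map_comp]
    have h2 : (derivMap F.Φ.symm ρ : CotSpace d →ₗ[ℝ] CotSpace d) ∘ₗ
        (derivMap F.Φ (F.Φ.symm ρ) : CotSpace d →ₗ[ℝ] CotSpace d) = LinearMap.id := by
      ext1 v
      exact congrArg (fun A : CotSpace d →L[ℝ] CotSpace d => A v) h1
    rw [h2, Submodule.map_id]
  refine ⟨hcm, hcp, fun ρ hρ => ?_, C, θ, hθ0, hθ1, fun ρ hρ n => ?_⟩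
  · obtain ⟨h1, h2, h3, _, _⟩ := hsplit ρ hρ
    obtain ⟨_, _, _, h4, h5⟩ := hsplit _ (F.symm_trapped hρ)
    exact ⟨h1.symm, h3, h2, hmap ρ hρ Em h5, hmap ρ hρ Ep h4⟩
  · exact ⟨(hest ρ hρ n).2, (hest ρ hρ n).1⟩

/-- The points with a long orbit in the source form a neighbourhood. -/
lemma eventually_iterate_source {ρ : PhaseSpace d J} (hρ : ρ ∈ F.trapped) (n : ℕ) :
    ∀ᶠ x in nhds ρ, ∀ k < n, F.Φ^[k] x ∈ F.Φ.source := by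
  have h1 : ∀ k ∈ Finset.range n, ∀ᶠ x in nhds ρ, F.Φ^[k] x ∈ F.Φ.source := fun k _ =>
    (F.hasPhaseDeriv_iterate k fun i _ => F.iterate_trapped_source hρ i).1.eventually
      (F.Φ.open_source.mem_nhds (F.iterate_trapped_source hρ k))
  have h2 := (Finset.range n).eventually_all.2 h1
  filter_upwards [h2] with x hx k hk
  exact hx k (by simpa using hk)

lemma symm_iterate_iterate {x : PhaseSpace d J} (n : ℕ)
    (h : ∀ k < n, F.Φ^[k] x ∈ F.Φ.source) : F.Φ.symm^[n] (F.Φ^[n] x) = x := by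
  induction n with
  | zero => rfl
  | succ n ih =>
    rw [Function.iterate_succ_apply' F.Φ n x, Function.iterate_succ_apply F.Φ.symm n,
      F.Φ.left_inv (h n (by omega))]
    exact ih fun k hk => h k (by omega)

lemma derivMapIter_symm_comp {ρ : PhaseSpace d J} (hρ : ρ ∈ F.trapped) (n : ℕ) :
    (derivMapIter F.Φ.symm n (F.Φ^[n] ρ)).comp (derivMapIter F.Φ n ρ) =
      ContinuousLinearMap.id ℝ _ := by
  obtain ⟨h1, h2⟩ := F.hasPhaseDeriv_iterate n fun i _ => F.iterate_trapped_source hρ i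
  have hT : F.Φ^[n] ρ ∈ F.rev.trapped := by
    rw [trapped_rev]; exact F.iterate_trapped hρ n
  obtain ⟨h3, h4⟩ := F.rev.hasPhaseDeriv_iterate n fun i _ => F.rev.iterate_trapped_source hT i
  have h5 := HasPhaseDeriv.comp h4 h2 h1
  have h6 := (hasPhaseDeriv_id ρ).congr (Ψ' := F.Φ.symm^[n] ∘ F.Φ^[n]) (by
    filter_upwards [eventually_iterate_source hρ n] with x hx
    exact (symm_iterate_iterate n hx).symm)
  rw [← h6.derivMap_eq]
  exact h5.derivMap_eq.symm

lemma derivMapIter_comp_symm {ρ : PhaseSpace d J} (hρ : ρ ∈ F.trapped) (n : ℕ) :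
    (derivMapIter F.Φ n ρ).comp (derivMapIter F.Φ.symm n (F.Φ^[n] ρ)) =
      ContinuousLinearMap.id ℝ _ := by
  have hT : F.Φ^[n] ρ ∈ F.rev.trapped := by
    rw [trapped_rev]; exact F.iterate_trapped hρ n
  have h1 := derivMapIter_symm_comp hT n
  have h2 : F.rev.Φ^[n] (F.Φ^[n] ρ) = ρ :=
    symm_iterate_iterate n fun k _ => F.iterate_trapped_source hρ k
  rw [h2, rev_Φ, F.Φ.symm_symm] at h1
  exact h1

lemma HypProj.equivariant_iterate {P : PhaseSpace d J → CotSpace d →L[ℝ] CotSpace d} {M C θ : ℝ}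
    (H : F.HypProj P M C θ) {ρ : PhaseSpace d J} (hρ : ρ ∈ F.trapped) (n : ℕ) (v : CotSpace d) :
    derivMapIter F.Φ n ρ (P ρ v) = P (F.Φ^[n] ρ) (derivMapIter F.Φ n ρ v) := by
  induction n generalizing ρ v with
  | zero => rfl
  | succ n ih =>
    simp only [derivMapIter, ContinuousLinearMap.comp_apply]
    rw [H.equivariant ρ hρ v, ih (F.map_trapped hρ)]
    rfl

lemma exists_near_of_infDist_lt (hne : F.trapped.Nonempty) {p : PhaseSpace d J} {r : ℝ}
    (h : Metric.infDist p F.trapped < r) : ∃ x ∈ F.trapped, dist p x < r :=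
  (Metric.infDist_lt_iff hne).1 h

/-- Orbits of bounded length that start near the trapped set stay near the trapped set. -/
lemma exists_iterate_near (hne : F.trapped.Nonempty) {O : Set (PhaseSpace d J)} (hO : IsOpen O)
    (hTO : F.trapped ⊆ O) (m : ℕ) :
    ∃ r > 0, ∀ p, Metric.infDist p F.trapped < r → ∀ i ≤ m, F.Φ^[i] p ∈ O := by
  have h1 : ∀ x ∈ F.trapped, ∀ᶠ p in nhds x, ∀ i ≤ m, F.Φ^[i] p ∈ O := by
    intro x hx
    have h2 : ∀ i ∈ Finset.range (m + 1), ∀ᶠ p in nhds x, F.Φ^[i] p ∈ O := fun i _ =>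
      (F.hasPhaseDeriv_iterate i fun k _ => F.iterate_trapped_source hx k).1.eventually
        (hO.mem_nhds (hTO (F.iterate_trapped hx i)))
    filter_upwards [(Finset.range (m + 1)).eventually_all.2 h2] with p hp i hi
    exact hp i (by simpa using Nat.lt_succ_of_le hi)
  have h3 : {p | ∀ i ≤ m, F.Φ^[i] p ∈ O} ∈ nhdsSet F.trapped :=
    mem_nhdsSet_iff_forall.2 h1
  obtain ⟨V, hV, hTV, hsub⟩ := mem_nhdsSet_iff_exists.1 h3
  obtain ⟨r, hr, hb⟩ := F.isCompact_trapped.exists_thickening_subset_open hV hTV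
  exact ⟨r, hr, fun p hp => hsub (hb ((Metric.mem_thickening_iff_infDist_lt hne).2 hp))⟩

/-- Points whose orbit under a power of the map stays near the trapped set are in the incoming
tail. -/
lemma exists_tailMinus_criterion (hne : F.trapped.Nonempty) (hint : F.trapped ⊆ interior F.D)
    {m : ℕ} (hm : 0 < m) :
    ∃ r > 0, ∀ z : ℕ → PhaseSpace d J, (∀ k, z (k + 1) = F.Φ^[m] (z k)) →
      (∀ k, Metric.infDist (z k) F.trapped < r) → z 0 ∈ F.tailMinus := by
  obtain ⟨r, hr, H⟩ := exists_iterate_near hne isOpen_interior hint m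
  refine ⟨r, hr, fun z hz hd => F.mem_tailMinus.2 fun n => ?_⟩
  have h1 : ∀ k, z k = F.Φ^[m * k] (z 0) := by
    intro k
    induction k with
    | zero => rfl
    | succ k ih =>
      have e : m * (k + 1) = m + m * k := by ring
      rw [hz, ih, e, Function.iterate_add_apply]
  have h2 : F.Φ^[n] (z 0) = F.Φ^[n % m] (z (n / m)) := by
    rw [h1 (n / m), ← Function.iterate_add_apply, Nat.mod_add_div]
  rw [h2]
  exact interior_subset (H _ (hd _) _ (Nat.mod_lt _ hm).le)

end OpenMap

/-! ### Single steps of a hyperbolic sequence -/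

section Links

variable {E : Type*} [NormedAddCommGroup E] [NormedSpace ℝ E]

/-- One step of a hyperbolic sequence of maps, from the splitting given by `P` to the one given by
`P'`; `B` inverts the map in the unstable directions. -/
structure HypLink (r c : ℝ) (P P' B : E →L[ℝ] E) (f : E → E) : Prop where
  idem : ∀ v, P (P v) = P v
  range : ∀ v, P (B v) = B v
  stable : ∀ v w, ‖v‖ ≤ r → ‖w‖ ≤ r → ‖(f v - f w) - P' (f v - f w)‖ ≤ 1 / 8 * ‖v - w‖
  unstable : ∀ v w, ‖v‖ ≤ r → ‖w‖ ≤ r → ‖P (v - w) - B (f v - f w)‖ ≤ 1 / 8 * ‖v - w‖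
  norm_le : ∀ v, ‖B v‖ ≤ 1 / 8 * ‖v‖
  inj : ∀ u, P' u = u → B u = 0 → u = 0
  jump : ‖f 0 - P' (f 0)‖ ≤ c ∧ ‖B (f 0)‖ ≤ c

theorem exists_orbit_of_hypLink [CompleteSpace E] (P B : ℤ → E →L[ℝ] E) (f : ℤ → E → E) {r c : ℝ}
    (hc : 0 ≤ c) (hcr : 4 * c ≤ r) (h : ∀ n, HypLink r c (P n) (P (n + 1)) (B n) (f n)) :
    ∃ w : ℤ → E, (∀ n, ‖w n‖ ≤ 4 * c) ∧ ∀ n, w (n + 1) = f n (w n) :=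
  exists_orbit_near_zero P B f hc hcr (fun n => (h n).idem) (fun n => (h n).range)
    (fun n => (h n).stable) (fun n => (h n).unstable) (fun n => (h n).norm_le)
    (fun n => (h n).inj) (fun n => (h n).jump)

/-- A linear model step, which keeps the splitting. -/
lemma hypLink_linear {P : E →L[ℝ] E} {M r c : ℝ} (hM : 0 ≤ M) (hc : 0 ≤ c) (hP : ‖P‖ ≤ M)
    (hidem : ∀ v, P (P v) = P v) :
    HypLink r c P P ((8 * (M + 1))⁻¹ • P) (fun v => (8 * (M + 1)) • P v) := by
  -- The factor `8 (M + 1)` compensates `‖P‖ ≤ M`, so the inverse step has norm at most `1/8`.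
  have hM1 : (8 * (M + 1)) ≠ 0 := by positivity
  refine ⟨hidem, fun v => ?_, fun v w _ _ => ?_, fun v w _ _ => ?_, fun v => ?_, fun u h1 h2 => ?_,
    ?_⟩
  · simp only [smul_apply, map_smul, hidem]
  · rw [← smul_sub, ← map_sub, map_smul, hidem, sub_self, norm_zero]; positivity
  · rw [← smul_sub, ← map_sub, smul_apply, map_smul, hidem, smul_smul, inv_mul_cancel₀ hM1,
      one_smul, sub_self, norm_zero]; positivity
  · rw [smul_apply, norm_smul, norm_inv, Real.norm_of_nonneg (by positivity), inv_mul_le_iff₀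
      (by positivity)]
    have := P.le_of_opNorm_le hP v
    have h0 := norm_nonneg v
    nlinarith
  · rw [smul_apply, h1] at h2
    exact (smul_eq_zero.1 h2).resolve_left (inv_ne_zero hM1)
  · simp [hc]

end Links

/-! ### Powers of the map as hyperbolic steps -/

section PhaseSteps

variable {d J : ℕ}

/-- The map `Ψ`, in coordinates centred at `p` and at `q`. -/
def stepMap (Ψ : PhaseSpace d J → PhaseSpace d J) (p q : PhaseSpace d J) (w : CotSpace d) :
    CotSpace d := (Ψ (p.1, p.2 + w)).2 - q.2

/-- The translation of a point of the phase space, in its copy of `T*ℝ^d`. -/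
def phaseShift (p : PhaseSpace d J) (w : CotSpace d) : PhaseSpace d J := (p.1, p.2 + w)

lemma dist_phaseShift (p : PhaseSpace d J) (w : CotSpace d) : dist (phaseShift p w) p = ‖w‖ := by
  rw [dist_of_fst_eq (ρ := phaseShift p w) (μ := p) rfl]
  show dist (p.2 + w) p.2 = ‖w‖
  rw [dist_eq_norm, add_sub_cancel_left]

lemma phaseShift_step {Ψ : PhaseSpace d J → PhaseSpace d J} {p q : PhaseSpace d J}
    {w : CotSpace d} (h : (Ψ (phaseShift p w)).1 = q.1) :
    phaseShift q (stepMap Ψ p q w) = Ψ (phaseShift p w) := by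
  refine Prod.ext h.symm ?_
  show q.2 + ((Ψ (phaseShift p w)).2 - q.2) = _
  rw [add_sub_cancel]

end PhaseSteps

namespace OpenMap

variable {d J : ℕ} {F : OpenMap d J}

/-- The inverse of the `m`-th iterate on the unstable directions. -/
def unstableInv (F : OpenMap d J) (P : PhaseSpace d J → CotSpace d →L[ℝ] CotSpace d) (m : ℕ)
    (x : PhaseSpace d J) : CotSpace d →L[ℝ] CotSpace d :=
  (derivMapIter F.Φ.symm m (F.Φ^[m] x)).comp (P (F.Φ^[m] x))

variable {P : PhaseSpace d J → CotSpace d →L[ℝ] CotSpace d} {M C θ : ℝ}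

lemma HypProj.norm_unstableInv_le (H : F.HypProj P M C θ) {x : PhaseSpace d J} (hx : x ∈ F.trapped)
    (m : ℕ) (u : CotSpace d) : ‖F.unstableInv P m x u‖ ≤ C * θ ^ m * ‖u‖ :=
  H.unstable _ (F.iterate_trapped hx m) m u

lemma HypProj.unstableInv_deriv (H : F.HypProj P M C θ) {x : PhaseSpace d J} (hx : x ∈ F.trapped)
    (m : ℕ) (u : CotSpace d) : F.unstableInv P m x (derivMapIter F.Φ m x u) = P x u := by
  rw [unstableInv, ContinuousLinearMap.comp_apply, ← H.equivariant_iterate hx]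
  exact congrArg (fun A : CotSpace d →L[ℝ] CotSpace d => A (P x u)) (derivMapIter_symm_comp hx m)

lemma deriv_unstableInv {x : PhaseSpace d J} (hx : x ∈ F.trapped)
    (m : ℕ) (u : CotSpace d) :
    derivMapIter F.Φ m x (F.unstableInv P m x u) = P (F.Φ^[m] x) u :=
  congrArg (fun A : CotSpace d →L[ℝ] CotSpace d => A (P (F.Φ^[m] x) u))
    (derivMapIter_comp_symm hx m)

lemma HypProj.proj_unstableInv (H : F.HypProj P M C θ) {x : PhaseSpace d J} (hx : x ∈ F.trapped)
    (m : ℕ) (u : CotSpace d) : P x (F.unstableInv P m x u) = F.unstableInv P m x u := by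
  rw [← H.unstableInv_deriv hx, deriv_unstableInv hx, unstableInv,
    ContinuousLinearMap.comp_apply, ContinuousLinearMap.comp_apply,
    H.idem _ (F.iterate_trapped hx m)]

lemma HypProj.exists_pow_small (H : F.HypProj P M C θ) {b : ℝ} (hb : 0 < b) :
    ∃ m > 0, C * θ ^ m ≤ b := by
  have h1 : Filter.Tendsto (fun m : ℕ => C * θ ^ m) Filter.atTop (nhds 0) := by
    simpa using (tendsto_pow_atTop_nhds_zero_of_lt_one H.θ_pos.le H.θ_lt_one).const_mul C
  have h2 := (h1.eventually (gt_mem_nhds hb)).and (Filter.eventually_gt_atTop 0)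
  obtain ⟨m, h3, h4⟩ := h2.exists
  exact ⟨m, h4, h3.le⟩

/-- Near the trapped set, a power of the map is a hyperbolic step. -/
lemma HypProj.exists_hypLink (H : F.HypProj P M C θ) {m : ℕ} (hm : C * θ ^ m ≤ 1 / 16) :
    ∃ r > 0, r < 1 ∧ ∀ x ∈ F.trapped, ∀ x' ∈ F.trapped, ∀ p p' : PhaseSpace d J, dist p x < r →
      dist p' x' < r → ∀ r₀ ≤ r, dist (F.Φ^[m] p) p' ≤ r₀ →
      HypLink r ((1 + M) * r₀) (P x) (P x') (F.unstableInv P m x) (stepMap F.Φ^[m] p p') ∧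
      ∀ w : CotSpace d, ‖w‖ ≤ r → (F.Φ^[m] (phaseShift p w)).1 = p'.1 := by
  have hder : ∀ x ∈ F.trapped, ContinuousAt F.Φ^[m] x ∧
      HasPhaseDeriv F.Φ^[m] (derivMapIter F.Φ m x) x := fun x hx =>
    F.hasPhaseDeriv_iterate m fun k _ => F.iterate_trapped_source hx k
  have hM := H.M_nonneg
  obtain ⟨rL, hrL, L, hL1, hLA, hLip⟩ := exists_uniform_lipschitz F.isCompact_trapped hder
  -- The budget `1/8` of the stable estimate is `1/16` for the linear contraction, `1/32` for the
  -- nonlinear remainder seen through `1 - P x'`, of norm at most `1 + M`, and `1/32` for the change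
  -- of splitting seen through a derivative of norm at most `L`.
  set κ : ℝ := 1 / (32 * (1 + M))
  have hκ : 0 < κ := by positivity
  have hκM : (1 + M) * κ = 1 / 32 := by simp only [κ]; field_simp
  obtain ⟨rS, hrS, hS⟩ := exists_uniform_strict_deriv F.isCompact_trapped hder hκ
  have hunif := F.isCompact_trapped.uniformContinuousOn_of_continuous H.continuousOn
  rw [Metric.uniformContinuousOn_iff] at hunif
  obtain ⟨rP, hrP, hP⟩ := hunif (1 / (32 * L)) (by positivity)
  -- The path from `F^m(x)` to `F^m(p)`, to `p'` and to `x'` is shorter than `(L + 2) r`; the factor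
  -- `L + 3` leaves a margin. Being below `1` keeps the points in one copy, being below `rP` keeps
  -- the splittings close.
  set r : ℝ := min (min (rL / 2) (rS / 3)) (min (min rP 1 / (L + 3)) (1 / 2))
  have hr : 0 < r := by positivity
  have hr1 : r ≤ rL / 2 := (min_le_left _ _).trans (min_le_left _ _)
  have hr2 : r ≤ rS / 3 := (min_le_left _ _).trans (min_le_right _ _)
  have hr3 : r ≤ min rP 1 / (L + 3) := (min_le_right _ _).trans (min_le_left _ _)
  have hr4 : r ≤ 1 / 2 := (min_le_right _ _).trans (min_le_right _ _)
  rw [le_div_iff₀ (by linarith), le_min_iff] at hr3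
  obtain ⟨hr3, hr5⟩ := hr3
  refine ⟨r, hr, by linarith, fun x hx x' hx' p p' hp hp' r₀ hr₀ hd => ?_⟩
  have hGx := F.iterate_trapped hx m
  have hp1 : p.1 = x.1 := fst_eq_of_dist_lt_one (by linarith)
  have hpx2 : dist p.2 x.2 < r := lt_of_le_of_lt (dist_snd_le p x) hp
  have hG : dist (F.Φ^[m] p) (F.Φ^[m] x) ≤ L * dist p x :=
    hLip x hx p x (by linarith) (by rw [dist_self]; exact hrL)
  -- the splittings at the image and at the next point are close
  have hPP : ‖P (F.Φ^[m] x) - P x'‖ ≤ 1 / (32 * L) := by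
    rw [← dist_eq_norm]
    refine (hP _ hGx _ hx' ?_).le
    have h1 := dist_triangle4 (F.Φ^[m] x) (F.Φ^[m] p) p' x'
    rw [dist_comm (F.Φ^[m] x) (F.Φ^[m] p)] at h1
    have h2 : L * dist p x ≤ L * r := by gcongr
    linarith
  have hPPu : ∀ u, ‖P (F.Φ^[m] x) u - P x' u‖ ≤ 1 / (32 * L) * ‖u‖ := fun u => by
    rw [← sub_apply]; exact (P (F.Φ^[m] x) - P x').le_of_opNorm_le hPP u
  have hnear : ∀ w : CotSpace d, ‖w‖ ≤ r → dist (p.2 + w) x.2 < rS := by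
    intro w hw
    have h1 := dist_triangle (p.2 + w) p.2 x.2
    have h2 : dist (p.2 + w) p.2 = ‖w‖ := by rw [dist_eq_norm, add_sub_cancel_left]
    linarith
  have hstep : ∀ v w : CotSpace d, ‖v‖ ≤ r → ‖w‖ ≤ r →
      ‖stepMap F.Φ^[m] p p' v - stepMap F.Φ^[m] p p' w - derivMapIter F.Φ m x (v - w)‖ ≤
        κ * ‖v - w‖ := by
    intro v w hv hw
    have h1 := (hS x hx _ _ (hnear v hv) (hnear w hw)).2
    rw [add_sub_add_left_eq_sub, ← hp1] at h1
    refine le_trans (le_of_eq ?_) h1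
    simp only [stepMap]
    congr 1; abel
  have hPx' : ∀ u, ‖u - P x' u‖ ≤ (1 + M) * ‖u‖ := fun u => by
    have h1 := norm_sub_le u (P x' u)
    have h2 := (P x').le_of_opNorm_le (H.norm_le _ hx') u
    linarith
  have hB : ∀ u, ‖F.unstableInv P m x u‖ ≤ 1 / 16 * ‖u‖ := fun u =>
    (H.norm_unstableInv_le hx m u).trans (by gcongr)
  have hf0 : ‖stepMap F.Φ^[m] p p' 0‖ ≤ r₀ := by
    refine le_trans ?_ hd
    rw [stepMap, add_zero, ← dist_eq_norm]
    exact dist_snd_le _ _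
  refine ⟨⟨H.idem x hx, H.proj_unstableInv hx m, fun v w hv hw => ?_, fun v w hv hw => ?_,
    fun u => (hB u).trans ?_, fun u h1 h2 => ?_, ?_, ?_⟩, fun w hw => ?_⟩
  · set R := stepMap F.Φ^[m] p p' v - stepMap F.Φ^[m] p p' w - derivMapIter F.Φ m x (v - w)
    set A := derivMapIter F.Φ m x
    have e : stepMap F.Φ^[m] p p' v - stepMap F.Φ^[m] p p' w = A (v - w) + R := by
      simp only [R]; abel
    -- Equivariance moves the projection across the derivative: the first term is contracted, the
    -- second measures the change of splitting, the third is the remainder.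
    have e2 : A (v - w) + R - P x' (A (v - w) + R) =
        A (v - w - P x (v - w)) + (P (F.Φ^[m] x) (A (v - w)) - P x' (A (v - w))) +
          (R - P x' R) := by
      rw [map_sub A (v - w), H.equivariant_iterate hx, map_add (P x')]; abel
    have h1 := H.stable x hx m (v - w)
    have h2 := hPPu (A (v - w))
    have h3 := hPx' R
    have h4 := hstep v w hv hw
    have h5 := A.le_of_opNorm_le (hLA x hx) (v - w)
    rw [e, e2]
    refine (norm_add₃_le).trans ?_
    have h6 : C * θ ^ m * ‖v - w‖ ≤ 1 / 16 * ‖v - w‖ := by gcongr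
    have h7 : 1 / (32 * L) * ‖A (v - w)‖ ≤ 1 / 32 * ‖v - w‖ := by
      calc 1 / (32 * L) * ‖A (v - w)‖ ≤ 1 / (32 * L) * (L * ‖v - w‖) := by gcongr
        _ = _ := by field_simp
    have h8 : (1 + M) * ‖R‖ ≤ 1 / 32 * ‖v - w‖ := by
      rw [← hκM, mul_assoc]; gcongr
    linarith
  · set R := stepMap F.Φ^[m] p p' v - stepMap F.Φ^[m] p p' w - derivMapIter F.Φ m x (v - w)
    have e : stepMap F.Φ^[m] p p' v - stepMap F.Φ^[m] p p' w =
        derivMapIter F.Φ m x (v - w) + R := by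
      simp only [R]; abel
    rw [e, map_add, H.unstableInv_deriv hx, sub_add_cancel_left, norm_neg]
    have h4 := hstep v w hv hw
    have h5 : κ * ‖v - w‖ ≤ 1 / 32 * ‖v - w‖ := by
      rw [← hκM]
      have : κ ≤ (1 + M) * κ := by nlinarith
      gcongr
    linarith [hB R, norm_nonneg (v - w)]
  · linarith [norm_nonneg u]
  -- If `B u = 0`, the projection at `F^m(x)` kills `u`, whereas the one at `x'` fixes it; these
  -- projections are so close that `‖u‖ ≤ ‖u‖/32`.
  · have h3 := deriv_unstableInv (P := P) hx m u
    rw [h2, map_zero] at h3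
    have h4 := hPPu u
    rw [← h3, h1, zero_sub, norm_neg] at h4
    have h5 : 1 / (32 * L) ≤ 1 / 32 := by
      apply one_div_le_one_div_of_le (by norm_num); linarith
    have h6 : 1 / (32 * L) * ‖u‖ ≤ 1 / 32 * ‖u‖ := by gcongr
    exact norm_le_zero_iff.1 (by linarith)
  · refine (hPx' _).trans ?_
    gcongr
  · refine (hB _).trans ?_
    have h0 : 0 ≤ r₀ := (norm_nonneg _).trans hf0
    nlinarith [mul_nonneg hM h0]
  · have h1 := (hS x hx _ _ (hnear w hw) (hnear w hw)).1
    have h2 : (F.Φ^[m] p).1 = (F.Φ^[m] x).1 := fst_eq_of_dist_lt_one (by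
      have h2 : L * dist p x ≤ L * r := by gcongr
      linarith)
    have h3 : (F.Φ^[m] p).1 = p'.1 := fst_eq_of_dist_lt_one (by linarith)
    rw [← h3, h2, ← h1, phaseShift, hp1]

end OpenMap

/-! ### Expansion transverse to a tail, and transversality of the tails -/

namespace OpenMap

variable {d J : ℕ} {F : OpenMap d J}

/-- A power of the map expands the distance to the incoming tail, near the trapped set. -/
theorem IsHyperbolic.exists_expansion (hF : F.IsHyperbolic) (hne : F.trapped.Nonempty)
    (hint : F.trapped ⊆ interior F.D) :
    ∃ m > 0, ∃ r > 0, ∀ ρ, Metric.infDist ρ F.trapped < r →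
      2 * Metric.infDist ρ F.tailMinus ≤ Metric.infDist (F.Φ^[m] ρ) F.tailMinus := by
  -- With `y` the point of `𝒯₋` nearest to `F^m(ρ)`, the sequence `ρ, y, F^m(y), …` is a
  -- pseudo-orbit whose only jump is `r₀ = d(F^m(ρ), 𝒯₋)`. Shadowing moves `ρ` into `𝒯₋` by a vector
  -- `w 0`. If `w 0` is in the unstable direction, the strongly contracting inverse gives `‖w 0‖ ≤
  -- r₀/2`.
  obtain ⟨P, M, C, θ, H⟩ := hF.exists_hypProj hne
  have hM := H.M_nonneg
  -- The vector to be pulled back has norm at most `4 (1 + M) r₀ + r₀ = (5 + 4M) r₀`; after the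
  -- pull-back, `r₀/16` remains.
  set b : ℝ := 1 / (16 * (5 + 4 * M))
  have hb : 0 < b := by positivity
  have hbM : b * (5 + 4 * M) = 1 / 16 := by simp only [b]; field_simp
  have hb16 : b ≤ 1 / 16 := by nlinarith
  obtain ⟨m, hm0, hm⟩ := H.exists_pow_small hb
  obtain ⟨rl, hrl, hrl1, hlink⟩ := H.exists_hypLink (hm.trans hb16)
  obtain ⟨rc, hrc, hcrit⟩ := exists_tailMinus_criterion hne hint hm0
  -- The bound `rl` makes the pseudo-orbit admissible for `hlink`; `rc / 2` leaves room for the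
  -- correction, at most `rc / 4`, before `hcrit` is applied.
  obtain ⟨δ, hδ, hattr⟩ := F.tailMinus_attracted hne (η := min rl (rc / 2)) (by positivity)
  obtain ⟨rL, hrL, L, hL1, _, hLip⟩ := exists_uniform_lipschitz F.isCompact_trapped
    (Ψ := F.Φ^[m]) (A := derivMapIter F.Φ m) fun x hx =>
      F.hasPhaseDeriv_iterate m fun k _ => F.iterate_trapped_source hx k
  have hL0 : 0 < L := by linarith
  set r : ℝ := min (min (min rl (rc / 4)) rL)
    (min (δ / (2 * L)) (min rl (rc / 4) / (4 * (1 + M) * L)))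
  have hr : 0 < r := by positivity
  have hr1 : r ≤ rl := (min_le_left _ _).trans ((min_le_left _ _).trans (min_le_left _ _))
  have hr2 : r ≤ rc / 4 := (min_le_left _ _).trans ((min_le_left _ _).trans (min_le_right _ _))
  have hr3 : r ≤ rL := (min_le_left _ _).trans (min_le_right _ _)
  have hr4 : r ≤ δ / (2 * L) := (min_le_right _ _).trans (min_le_left _ _)
  have hr5 : r ≤ min rl (rc / 4) / (4 * (1 + M) * L) := (min_le_right _ _).trans (min_le_right _ _)
  rw [le_div_iff₀ (by positivity)] at hr4
  rw [le_div_iff₀ (by positivity), le_min_iff] at hr5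
  refine ⟨m, hm0, r, hr, fun ρ hρ => ?_⟩
  obtain ⟨x₀, hx₀, hd₀⟩ := exists_near_of_infDist_lt hne hρ
  have hG : dist (F.Φ^[m] ρ) (F.Φ^[m] x₀) ≤ L * r :=
    (hLip x₀ hx₀ ρ x₀ (by linarith) (by rw [dist_self]; exact hrL)).trans (by gcongr)
  obtain ⟨y, hy, hyd⟩ := F.isCompact_tailMinus.exists_infDist_eq_dist
    ⟨x₀, hx₀.2⟩ (F.Φ^[m] ρ)
  set r₀ := Metric.infDist (F.Φ^[m] ρ) F.tailMinus
  have hr₀ : r₀ ≤ L * r :=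
    (Metric.infDist_le_dist_of_mem (F.iterate_trapped hx₀ m).2).trans hG
  have hr₀0 : 0 ≤ r₀ := Metric.infDist_nonneg
  have hyT : Metric.infDist y F.trapped < δ := by
    have h1 : Metric.infDist y F.trapped ≤ dist y (F.Φ^[m] x₀) :=
      Metric.infDist_le_dist_of_mem (F.iterate_trapped hx₀ m)
    have h2 := dist_triangle y (F.Φ^[m] ρ) (F.Φ^[m] x₀)
    rw [dist_comm y (F.Φ^[m] ρ)] at h2
    have h4 : dist ρ x₀ < r := hd₀
    have hG' : dist (F.Φ^[m] ρ) (F.Φ^[m] x₀) ≤ L * dist ρ x₀ :=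
      hLip x₀ hx₀ ρ x₀ (by linarith) (by rw [dist_self]; exact hrL)
    have h5 : L * dist ρ x₀ < L * r := by gcongr
    linarith [hyd]
  -- the pseudo-orbit
  let p : ℕ → PhaseSpace d J := fun k => Nat.casesOn k ρ fun k => (F.Φ^[m])^[k] y
  have hp0 : p 0 = ρ := rfl
  have hps : ∀ k, p (k + 1) = (F.Φ^[m])^[k] y := fun k => rfl
  have hpT : ∀ k, Metric.infDist (p k) F.trapped < min rl (rc / 2) := by
    intro k
    cases k with
    | zero =>
      rw [hp0]
      exact lt_min (by linarith) (by linarith)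
    | succ k =>
      rw [hps, ← Function.iterate_mul]
      exact hattr y hy hyT _
  choose x hxT hxd using fun k => exists_near_of_infDist_lt hne (hpT k)
  have hjump : ∀ k, dist (F.Φ^[m] (p k)) (p (k + 1)) ≤ r₀ := by
    intro k
    cases k with
    | zero => rw [hp0, hps]; exact hyd.ge
    | succ k => rw [hps, hps, Function.iterate_succ_apply', dist_self]; exact hr₀0
  have hr₀l : r₀ ≤ rl := by nlinarith [mul_nonneg hM (mul_pos hL0 hr).le]
  have hlk := fun k => hlink (x k) (hxT k) (x (k + 1)) (hxT (k + 1)) (p k) (p (k + 1))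
    ((hxd k).trans_le (min_le_left _ _)) ((hxd (k + 1)).trans_le (min_le_left _ _)) r₀ hr₀l
    (hjump k)
  set c := (1 + M) * r₀
  have hc0 : 0 ≤ c := by positivity
  have hcL : 4 * c ≤ r * (4 * (1 + M) * L) := by
    have : c ≤ (1 + M) * (L * r) := by simp only [c]; gcongr
    linarith
  -- A past is needed for a two-sided sequence. The linear model, with image in the range of `P (x
  -- 0)`, is used for `n < 0`; since `Int.toNat` sends these times to `0`, the splitting there is
  -- constant.
  obtain ⟨w, hwb, hw⟩ := exists_orbit_of_hypLink (fun n : ℤ => P (x n.toNat))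
    (fun n => if n < 0 then (8 * (M + 1))⁻¹ • P (x 0) else F.unstableInv P m (x n.toNat))
    (fun n => if n < 0 then fun v => (8 * (M + 1)) • P (x 0) v else
      stepMap F.Φ^[m] (p n.toNat) (p (n.toNat + 1))) (r := rl) hc0 (by linarith) (by
      intro n
      rcases lt_or_ge n 0 with hn | hn
      · have h1 : n.toNat = 0 := by omega
        have h2 : (n + 1).toNat = 0 := by omega
        simp only [hn, if_true, h1, h2]
        exact hypLink_linear hM hc0 (H.norm_le _ (hxT 0)) (H.idem _ (hxT 0))
      · have h2 : (n + 1).toNat = n.toNat + 1 := by omega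
        simp only [not_lt.2 hn, if_false, h2]
        exact (hlk _).1)
  have hw' : ∀ k : ℕ, w (k + 1) = stepMap F.Φ^[m] (p k) (p (k + 1)) (w k) := fun k => by
    have h1 := hw k
    have h2 : ¬ ((k : ℤ) < 0) := by omega
    simpa only [h2, if_false, Int.toNat_natCast] using h1
  have hwl : ∀ n, ‖w n‖ ≤ rl := fun n => (hwb n).trans (by linarith)
  let z : ℕ → PhaseSpace d J := fun k => phaseShift (p k) (w k)
  have hz : ∀ k, z (k + 1) = F.Φ^[m] (z k) := by
    intro k
    show phaseShift (p (k + 1)) (w ((k + 1 : ℕ) : ℤ)) = _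
    rw [Nat.cast_succ, hw' k]
    exact phaseShift_step ((hlk k).2 _ (hwl _))
  have hzT : z 0 ∈ F.tailMinus := by
    refine hcrit z hz fun k => ?_
    refine (Metric.infDist_le_dist_of_mem (hxT k)).trans_lt ?_
    refine (dist_triangle (z k) (p k) (x k)).trans_lt ?_
    have h1 : dist (z k) (p k) = ‖w k‖ := dist_phaseShift _ _
    have h2 := (hxd k).trans_le (min_le_right _ _)
    linarith [hwb k]
  -- This is the purpose of the artificial past: the last model step forces `w 0` into the unstable
  -- direction.
  have hw0 : P (x 0) (w 0) = w 0 := by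
    have h1 := hw (-1)
    simp only [neg_add_cancel, Int.reduceNeg, Int.reduceLT, if_true] at h1
    rw [h1, map_smul, H.idem _ (hxT 0)]
  have hsmall : ‖w 0‖ ≤ r₀ / 2 := by
    have h1 := (hlk 0).1.unstable (w 0) 0 (hwl 0) (by rw [norm_zero]; exact hrl.le)
    have h2 := hw' 0
    simp only [Nat.cast_zero, zero_add] at h2 h1
    rw [sub_zero, hw0, ← h2] at h1
    have h3 : ‖stepMap F.Φ^[m] (p 0) (p 1) 0‖ ≤ r₀ := by
      refine le_trans ?_ (hjump 0)
      rw [stepMap, add_zero, ← dist_eq_norm]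
      exact dist_snd_le _ _
    have h4 := H.norm_unstableInv_le (hxT 0) m (w 1 - stepMap F.Φ^[m] (p 0) (p 1) 0)
    have h5 : ‖w 1 - stepMap F.Φ^[m] (p 0) (p 1) 0‖ ≤ 4 * c + r₀ :=
      (norm_sub_le _ _).trans (add_le_add (hwb 1) h3)
    have h6 : C * θ ^ m * ‖w 1 - stepMap F.Φ^[m] (p 0) (p 1) 0‖ ≤ b * (4 * c + r₀) := by gcongr
    have h7 : b * (4 * c + r₀) = 1 / 16 * r₀ := by
      rw [← hbM]; simp only [c]; ring
    have h8 := norm_le_norm_add_norm_sub' (w 0)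
      (F.unstableInv P m (x 0) (w 1 - stepMap F.Φ^[m] (p 0) (p 1) 0))
    linarith
  have hfin : Metric.infDist ρ F.tailMinus ≤ ‖w 0‖ := by
    refine (Metric.infDist_le_dist_of_mem hzT).trans (le_of_eq ?_)
    rw [dist_comm]
    exact dist_phaseShift _ _
  linarith

lemma iterate_symm_iterate {σ : PhaseSpace d J} (hσ : σ ∈ F.tailPlus) (m : ℕ) :
    F.Φ^[m] (F.Φ.symm^[m] σ) = σ := by
  rw [← tailMinus_rev] at hσ
  have h1 := symm_iterate_iterate (F := F.rev) (x := σ) m fun k _ =>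
    F.rev.D_subset_source (F.rev.mem_tailMinus.1 hσ k)
  rwa [rev_Φ, F.Φ.symm_symm] at h1

/-- The tails are transverse near the trapped set. -/
theorem IsHyperbolic.exists_transversality (hF : F.IsHyperbolic) (hne : F.trapped.Nonempty)
    (hint : F.trapped ⊆ interior F.D) :
    ∃ C > 0, ∃ r > 0, ∀ ρ, Metric.infDist ρ F.trapped < r →
      Metric.infDist ρ F.trapped ≤
        C * (Metric.infDist ρ F.tailPlus + Metric.infDist ρ F.tailMinus) := by
  -- The points of `𝒯₊` and `𝒯₋` nearest to `ρ` are `a` and `b`. The backward orbit of `a` followed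
  -- by the forward orbit of `b` has the single jump `dist a b`, and the orbit that shadows it stays
  -- near `𝒯` for all times, so it lies in `𝒯`.
  obtain ⟨P, M, C, θ, H⟩ := hF.exists_hypProj hne
  have hM := H.M_nonneg
  obtain ⟨m, hm0, hm⟩ := H.exists_pow_small (b := 1 / 16) (by norm_num)
  obtain ⟨rl, hrl, hrl1, hlink⟩ := H.exists_hypLink hm
  obtain ⟨rc, hrc, hcrit⟩ := exists_tailMinus_criterion hne hint hm0
  have hη : 0 < min rl (rc / 2) := by positivity
  obtain ⟨δ, hδ, hattr⟩ := F.tailMinus_attracted hne hη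
  obtain ⟨δ', hδ', hattr'⟩ := F.rev.tailMinus_attracted (by rw [trapped_rev]; exact hne) hη
  rw [trapped_rev, tailMinus_rev, rev_Φ] at hattr'
  set r : ℝ := min (min (δ / 2) (δ' / 2)) (min rl (rc / 4) / (8 * (1 + M)))
  have hr : 0 < r := by positivity
  have hr1 : r ≤ δ / 2 := (min_le_left _ _).trans (min_le_left _ _)
  have hr2 : r ≤ δ' / 2 := (min_le_left _ _).trans (min_le_right _ _)
  have hr3 : r ≤ min rl (rc / 4) / (8 * (1 + M)) := min_le_right _ _
  rw [le_div_iff₀ (by positivity), le_min_iff] at hr3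
  refine ⟨1 + 4 * (1 + M), by positivity, r, hr, fun ρ hρ => ?_⟩
  obtain ⟨x₀, hx₀, hd₀⟩ := exists_near_of_infDist_lt hne hρ
  obtain ⟨a, ha, had⟩ := F.isCompact_tailPlus.exists_infDist_eq_dist ⟨x₀, hx₀.1⟩ ρ
  obtain ⟨b, hb, hbd⟩ := F.isCompact_tailMinus.exists_infDist_eq_dist ⟨x₀, hx₀.2⟩ ρ
  have ha' : dist ρ a < r := by
    rw [← had]; exact (Metric.infDist_le_dist_of_mem hx₀.1).trans_lt hd₀
  have hb' : dist ρ b < r := by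
    rw [← hbd]; exact (Metric.infDist_le_dist_of_mem hx₀.2).trans_lt hd₀
  have haT : Metric.infDist a F.trapped < δ' := by
    refine (Metric.infDist_le_dist_of_mem hx₀).trans_lt ?_
    have := dist_triangle_left a x₀ ρ
    linarith
  have hbT : Metric.infDist b F.trapped < δ := by
    refine (Metric.infDist_le_dist_of_mem hx₀).trans_lt ?_
    have := dist_triangle_left b x₀ ρ
    linarith
  set r₀ := dist a b
  have hr₀0 : 0 ≤ r₀ := dist_nonneg
  have hr₀ : r₀ ≤ dist ρ a + dist ρ b := dist_triangle_left _ _ _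
  -- Time `0` is occupied by `b`; `a` itself is skipped and appears only as the image of the point
  -- at time `-1`.
  let p : ℤ → PhaseSpace d J := fun n => match n with
    | Int.ofNat k => (F.Φ^[m])^[k] b
    | Int.negSucc k => (F.Φ.symm^[m])^[k + 1] a
  have hpT : ∀ n, Metric.infDist (p n) F.trapped < min rl (rc / 2) := by
    intro n
    cases n with
    | ofNat k =>
      show Metric.infDist ((F.Φ^[m])^[k] b) F.trapped < _
      rw [← Function.iterate_mul]; exact hattr b hb hbT _
    | negSucc k =>
      show Metric.infDist ((F.Φ.symm^[m])^[k + 1] a) F.trapped < _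
      rw [← Function.iterate_mul]; exact hattr' a ha haT _
  choose x hxT hxd using fun n => exists_near_of_infDist_lt hne (hpT n)
  have hplus : ∀ n, F.Φ.symm^[n] a ∈ F.tailPlus := fun n => by
    rw [← tailMinus_rev] at ha ⊢
    exact F.rev.iterate_tailMinus ha n
  have hback : ∀ k, F.Φ^[m] ((F.Φ.symm^[m])^[k + 1] a) = (F.Φ.symm^[m])^[k] a := fun k => by
    rw [Function.iterate_succ_apply']
    apply iterate_symm_iterate
    rw [← Function.iterate_mul]
    exact hplus _
  have hjump : ∀ n, dist (F.Φ^[m] (p n)) (p (n + 1)) ≤ r₀ := by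
    intro n
    cases n with
    | ofNat k =>
      show dist (F.Φ^[m] ((F.Φ^[m])^[k] b)) ((F.Φ^[m])^[k + 1] b) ≤ r₀
      rw [Function.iterate_succ_apply', dist_self]; exact hr₀0
    | negSucc k =>
      cases k with
      | zero =>
        show dist (F.Φ^[m] ((F.Φ.symm^[m])^[0 + 1] a)) b ≤ r₀
        rw [hback]; exact le_rfl
      | succ k =>
        show dist (F.Φ^[m] ((F.Φ.symm^[m])^[k + 1 + 1] a)) ((F.Φ.symm^[m])^[k + 1] a) ≤ r₀
        rw [hback, dist_self]; exact hr₀0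
  have hr₀l : r₀ ≤ rl := by nlinarith [mul_nonneg hM hr.le]
  have hlk := fun n => hlink (x n) (hxT n) (x (n + 1)) (hxT (n + 1)) (p n) (p (n + 1))
    ((hxd n).trans_le (min_le_left _ _)) ((hxd (n + 1)).trans_le (min_le_left _ _)) r₀ hr₀l
    (hjump n)
  set c := (1 + M) * r₀
  have hc0 : 0 ≤ c := by positivity
  have hcL : 4 * c ≤ r * (8 * (1 + M)) := by
    have : c ≤ (1 + M) * (r + r) := by simp only [c]; gcongr; linarith
    linarith
  obtain ⟨w, hwb, hw⟩ := exists_orbit_of_hypLink (fun n : ℤ => P (x n))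
    (fun n => F.unstableInv P m (x n)) (fun n => stepMap F.Φ^[m] (p n) (p (n + 1)))
    (r := rl) hc0 (by linarith) fun n => (hlk n).1
  have hwl : ∀ n, ‖w n‖ ≤ rl := fun n => (hwb n).trans (by linarith)
  let z : ℤ → PhaseSpace d J := fun n => phaseShift (p n) (w n)
  have hz : ∀ n, z (n + 1) = F.Φ^[m] (z n) := by
    intro n
    show phaseShift (p (n + 1)) (w (n + 1)) = _
    rw [hw n]
    exact phaseShift_step ((hlk n).2 _ (hwl _))
  have hzd : ∀ n, Metric.infDist (z n) F.trapped < rc := by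
    intro n
    refine (Metric.infDist_le_dist_of_mem (hxT n)).trans_lt ?_
    refine (dist_triangle (z n) (p n) (x n)).trans_lt ?_
    have h1 : dist (z n) (p n) = ‖w n‖ := dist_phaseShift _ _
    have h2 := (hxd n).trans_le (min_le_right _ _)
    linarith [hwb n]
  have hzT : ∀ n, z n ∈ F.tailMinus := by
    intro n
    have h1 := hcrit (fun k => z (n + k)) (fun k => by
      rw [← hz]; congr 1; push_cast; ring) fun k => hzd _
    simpa using h1
  have hzit : ∀ (k : ℕ) n, F.Φ^[m * k] (z n) = z (n + k) := by
    intro k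
    induction k with
    | zero => intro n; simp
    | succ k ih =>
      intro n
      have e : m * (k + 1) = m + m * k := by ring
      rw [e, Function.iterate_add_apply, ih, ← hz]
      congr 1; push_cast; ring
  have hz0 : z 0 ∈ F.trapped := by
    refine ⟨fun n => ?_, hzT 0⟩
    -- Membership in `𝒯₊` asks for a preimage of each order `n`. The corrected orbit gives one of
    -- order `mn`, which is advanced by `mn - n` steps.
    have hnm : n ≤ m * n := Nat.le_mul_of_pos_left n hm0
    have h1 : F.Φ^[m * n - n] (z (-n)) ∈ F.tailMinus := F.iterate_tailMinus (hzT _) _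
    refine ⟨_, F.D_subset_U (F.tailMinus_subset h1), F.D_subset_U (F.tailMinus_subset (hzT 0)),
      (F.relIter_iff _ _ _).2 ⟨fun k _ => F.mem_tailMinus.1 h1 k, ?_⟩⟩
    rw [← Function.iterate_add_apply, Nat.add_sub_cancel' hnm, hzit, neg_add_cancel]
  have hfin : Metric.infDist ρ F.trapped ≤ dist ρ b + 4 * c := by
    refine (Metric.infDist_le_dist_of_mem hz0).trans ((dist_triangle ρ b (z 0)).trans ?_)
    have h1 : dist (z 0) b = ‖w 0‖ := dist_phaseShift (p 0) (w 0)
    rw [dist_comm b]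
    linarith [hwb 0]
  rw [had, hbd]
  have h2 : c ≤ (1 + M) * (dist ρ a + dist ρ b) := by simp only [c]; gcongr
  have h3 : 0 ≤ dist ρ a := dist_nonneg
  linarith

end OpenMap

/-! ### Regularized squares of Lipschitz functions -/

section RegularizedSquares

variable {d J : ℕ}

/-- Hence `√(D² + ε)` inherits the Lipschitz constant of `D`, independently of `ε`. -/
lemma abs_sqrt_sq_add_sub_le {e : ℝ} (he : 0 ≤ e) (a b : ℝ) :
    |Real.sqrt (a ^ 2 + e) - Real.sqrt (b ^ 2 + e)| ≤ |a - b| := by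
  have key : ∀ a b : ℝ, Real.sqrt (a ^ 2 + e) ≤ Real.sqrt (b ^ 2 + e) + |a - b| := by
    intro a b
    have h0 : 0 ≤ Real.sqrt (b ^ 2 + e) := Real.sqrt_nonneg _
    rw [Real.sqrt_le_left (by positivity)]
    have h1 : Real.sqrt (b ^ 2 + e) ^ 2 = b ^ 2 + e := Real.sq_sqrt (by positivity)
    have h2 : |b| ≤ Real.sqrt (b ^ 2 + e) := Real.abs_le_sqrt (by linarith)
    have h3 : |a| ≤ |b| + |a - b| := by
      have := abs_add_le b (a - b)
      rwa [add_sub_cancel] at this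
    have h4 : |a| ^ 2 ≤ (|b| + |a - b|) ^ 2 := by gcongr
    rw [sq_abs] at h4
    have h5 := sq_abs b
    nlinarith [mul_le_mul_of_nonneg_right h2 (abs_nonneg (a - b))]
  rw [abs_le]
  constructor
  · have := key b a
    rw [abs_sub_comm] at this
    linarith
  · linarith [key a b]

/-- The exponent `1 - n/2` changes sign at `n = 2`, so the lower bound on `φ` serves for small `n`
and the upper bound for large `n`. -/
lemma zpow_two_sub_le {s φ : ℝ} (hs : 0 < s) (h1 : s ^ 2 ≤ φ) (h2 : φ ≤ 2 * s ^ 2) (n : ℕ) :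
    s ^ (2 - n : ℤ) ≤ 2 ^ n * φ ^ (1 - (n : ℝ) / 2) := by
  have hφ : 0 < φ := lt_of_lt_of_le (by positivity) h1
  have h3 : s ^ (2 - n : ℤ) = (s ^ 2) ^ (1 - (n : ℝ) / 2) := by
    rw [← Real.rpow_natCast, ← Real.rpow_mul hs.le, ← Real.rpow_intCast]
    congr 1
    push_cast; ring
  rw [h3]
  rcases le_or_gt 0 (1 - (n : ℝ) / 2) with hn | hn
  · calc (s ^ 2) ^ (1 - (n : ℝ) / 2) ≤ φ ^ (1 - (n : ℝ) / 2) :=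
        Real.rpow_le_rpow (by positivity) h1 hn
      _ ≤ 2 ^ n * φ ^ (1 - (n : ℝ) / 2) :=
        le_mul_of_one_le_left (by positivity) (one_le_pow₀ (by norm_num))
  · calc (s ^ 2) ^ (1 - (n : ℝ) / 2) ≤ (φ / 2) ^ (1 - (n : ℝ) / 2) :=
        Real.rpow_le_rpow_of_nonpos (by positivity) (by linarith) hn.le
      _ = φ ^ (1 - (n : ℝ) / 2) * 2 ^ ((n : ℝ) / 2 - 1) := by
        rw [Real.div_rpow hφ.le (by norm_num), div_eq_mul_inv, ← Real.rpow_neg (by norm_num)]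
        congr 2; ring
      _ ≤ φ ^ (1 - (n : ℝ) / 2) * 2 ^ (n : ℝ) := by
        gcongr
        · norm_num
        · have : (0 : ℝ) ≤ n := n.cast_nonneg
          linarith
      _ = _ := by rw [Real.rpow_natCast, mul_comm]

/-- The square of a Lipschitz function on a part of the phase space has a regularization at every
scale `√ε`. -/
theorem exists_regularized_square {D : PhaseSpace d J → ℝ} {S : Set (PhaseSpace d J)} {L κ : ℝ}
    (hL : 0 ≤ L) (hD : ∀ p ∈ S, ∀ q ∈ S, |D p - D q| ≤ L * dist p q) (hκ : 0 < κ) (hκ1 : κ ≤ 1) :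
    ∃ K : ℕ → ℝ, ∃ φ : ℝ → PhaseSpace d J → ℝ, ∀ ε > 0, SmoothOn (φ ε) univ ∧ ∀ ρ ∈ S,
      D ρ ^ 2 + ε ≤ φ ε ρ ∧ φ ε ρ ≤ (1 + κ) * (D ρ ^ 2 + ε) ∧
      ∀ n : ℕ, derivNorm n (φ ε) ρ ≤ K n * φ ε ρ ^ (1 - (n : ℝ) / 2) := by
  obtain ⟨K, hK⟩ := exists_regularization (E := CotSpace d) L hL hκ
  -- The averages involve the values on a whole copy, while `D` is Lipschitz on `S` only; hence a
  -- Lipschitz extension.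
  have hext : ∀ j : Fin J, ∃ g : CotSpace d → ℝ, (∀ x y, |g x - g y| ≤ L * ‖x - y‖) ∧
      ∀ x, (j, x) ∈ S → D (j, x) = g x := by
    intro j
    have h1 : LipschitzOnWith (Real.toNNReal L) (fun x : CotSpace d => D (j, x))
        {x | (j, x) ∈ S} := by
      refine LipschitzOnWith.of_dist_le_mul fun x hx y hy => ?_
      rw [Real.dist_eq, Real.coe_toNNReal _ hL, ← phase_dist_mk j]
      exact hD _ hx _ hy
    obtain ⟨g, hg, hge⟩ := h1.extend_real
    refine ⟨g, fun x y => ?_, fun x hx => hge hx⟩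
    have := hg.dist_le_mul x y
    rwa [Real.dist_eq, Real.coe_toNNReal _ hL, dist_eq_norm] at this
  choose g hgL hgD using hext
  have hreg : ∀ (ε : ℝ) (j : Fin J), ∃ φ : CotSpace d → ℝ, 0 < ε → ContDiff ℝ ∞ φ ∧
      (∀ x, g j x ^ 2 + ε ≤ φ x ∧ φ x ≤ (1 + κ) * (g j x ^ 2 + ε)) ∧
      ∀ n x, ‖iteratedFDeriv ℝ n φ x‖ ≤ K n * Real.sqrt (g j x ^ 2 + ε) ^ (2 - n : ℤ) := by
    intro ε j
    by_cases hε : 0 < ε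
    · obtain ⟨φ, h1, h2, h3⟩ := hK (fun x => Real.sqrt (g j x ^ 2 + ε))
        (fun x => Real.sqrt_pos.2 (by positivity))
        (fun x y => (abs_sqrt_sq_add_sub_le hε.le _ _).trans (hgL j x y))
      refine ⟨φ, fun _ => ⟨h1, fun x => ?_, h3⟩⟩
      have h4 := h2 x
      rwa [Real.sq_sqrt (by positivity)] at h4
    · exact ⟨0, fun h => absurd h hε⟩
  choose φ hφ using hreg
  refine ⟨fun n => |K n| * 2 ^ n, fun ε ρ => φ ε ρ.1 ρ.2, fun ε hε =>
    ⟨fun j => ((hφ ε j hε).1).contDiffOn, fun ρ hρ => ?_⟩⟩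
  obtain ⟨_, h2, h3⟩ := hφ ε ρ.1 hε
  have hDg : D ρ = g ρ.1 ρ.2 := hgD ρ.1 ρ.2 hρ
  rw [hDg]
  refine ⟨(h2 ρ.2).1, (h2 ρ.2).2, fun n => (h3 n ρ.2).trans ?_⟩
  set s := Real.sqrt (g ρ.1 ρ.2 ^ 2 + ε)
  have hs : 0 < s := Real.sqrt_pos.2 (by positivity)
  have hs2 : s ^ 2 = g ρ.1 ρ.2 ^ 2 + ε := Real.sq_sqrt (by positivity)
  have h4 : s ^ (2 - n : ℤ) ≤ 2 ^ n * φ ε ρ.1 ρ.2 ^ (1 - (n : ℝ) / 2) := by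
    refine zpow_two_sub_le hs (by rw [hs2]; exact (h2 _).1) ((h2 _).2.trans ?_) n
    rw [hs2]
    have : 0 ≤ g ρ.1 ρ.2 ^ 2 + ε := by positivity
    nlinarith
  calc K n * s ^ (2 - n : ℤ) ≤ |K n| * s ^ (2 - n : ℤ) := by gcongr; exact le_abs_self _
    _ ≤ |K n| * (2 ^ n * φ ε ρ.1 ρ.2 ^ (1 - (n : ℝ) / 2)) := by gcongr
    _ = _ := by ring

end RegularizedSquares

/-! ### An adapted distance, expanded by one step -/

namespace OpenMap

variable {d J : ℕ} {F : OpenMap d J}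

lemma exists_iterate_lipschitz (F : OpenMap d J) (m : ℕ) :
    ∃ r > 0, ∃ L ≥ 1, ∀ k ≤ m, ∀ x ∈ F.trapped, ∀ p q : PhaseSpace d J, dist p x < r →
      dist q x < r → dist (F.Φ^[k] p) (F.Φ^[k] q) ≤ L * dist p q := by
  induction m with
  | zero =>
    refine ⟨1, one_pos, 1, le_rfl, fun k hk x _ p q _ _ => ?_⟩
    obtain rfl : k = 0 := by omega
    simp
  | succ m ih =>
    obtain ⟨r, hr, L, hL, H⟩ := ih
    obtain ⟨r', hr', L', hL', _, H'⟩ := exists_uniform_lipschitz F.isCompact_trapped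
      (Ψ := F.Φ^[m + 1]) (A := derivMapIter F.Φ (m + 1)) fun x hx =>
        F.hasPhaseDeriv_iterate (m + 1) fun k _ => F.iterate_trapped_source hx k
    refine ⟨min r r', by positivity, max L L', le_max_of_le_left hL,
      fun k hk x hx p q hp hq => ?_⟩
    rcases Nat.lt_or_ge k (m + 1) with h | h
    · refine (H k (by omega) x hx p q (hp.trans_le (min_le_left _ _))
        (hq.trans_le (min_le_left _ _))).trans ?_
      gcongr
      exact le_max_left _ _
    · obtain rfl : k = m + 1 := by omega
      refine (H' x hx p q (hp.trans_le (min_le_right _ _))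
        (hq.trans_le (min_le_right _ _))).trans ?_
      gcongr
      exact le_max_right _ _

/-- Near the trapped set, there is a function comparable to the distance to the incoming tail that
is expanded by the map itself. -/
theorem IsHyperbolic.exists_adapted_distance (hF : F.IsHyperbolic) (hne : F.trapped.Nonempty)
    (hint : F.trapped ⊆ interior F.D) :
    ∃ c > 0, ∃ r > 0, ∃ L ≥ 1, ∃ D : PhaseSpace d J → ℝ,
      (∀ ρ, Metric.infDist ρ F.tailMinus ≤ D ρ) ∧
      (∀ ρ, Metric.infDist ρ F.trapped < r → D ρ ≤ L * Metric.infDist ρ F.tailMinus) ∧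
      (∀ p ∈ {ρ | Metric.infDist ρ F.trapped < r}, ∀ q ∈ {ρ | Metric.infDist ρ F.trapped < r},
        |D p - D q| ≤ L * dist p q) ∧
      (∀ ρ, Metric.infDist ρ F.trapped < r → (1 + c) * D ρ ≤ D (F.Φ ρ)) ∧
      (∀ ρ, Metric.infDist ρ F.trapped < r → Metric.infDist (F.Φ ρ) F.trapped < r →
        D (F.Φ ρ) ≤ L * D ρ) := by
  obtain ⟨m, hm, r₁, hr₁, hexp⟩ := hF.exists_expansion hne hint
  obtain ⟨r₂, hr₂, L, hL, hLip⟩ := F.exists_iterate_lipschitz m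
  have hneM : F.tailMinus.Nonempty := hne.mono fun _ h => h.2
  set r := min r₁ (r₂ / 2)
  have hr : 0 < r := by positivity
  have hrr1 : r ≤ r₁ := min_le_left _ _
  have hrr2 : 2 * r ≤ r₂ := by linarith [min_le_right r₁ (r₂ / 2)]
  have hm1 : (1 : ℝ) ≤ m := by exact_mod_cast hm
  -- The sum along `m` iterates telescopes: `D(F(ρ)) - D(ρ) = d(F^m(ρ), 𝒯₋) - d(ρ, 𝒯₋) ≥ d(ρ, 𝒯₋) ≥
  -- D(ρ)/(mL)`. This is where the rate `c = 1/(mL)` comes from.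
  set D : PhaseSpace d J → ℝ := fun ρ =>
    ∑ k ∈ Finset.range m, Metric.infDist (F.Φ^[k] ρ) F.tailMinus
  have hterm : ∀ ρ, Metric.infDist ρ F.trapped < r → ∀ k ≤ m,
      Metric.infDist (F.Φ^[k] ρ) F.tailMinus ≤ L * Metric.infDist ρ F.tailMinus := by
    intro ρ hρ k hk
    obtain ⟨x, hx, hdx⟩ := exists_near_of_infDist_lt hne hρ
    obtain ⟨y, hy, hyd⟩ := F.isCompact_tailMinus.exists_infDist_eq_dist hneM ρ
    have h1 : dist ρ y < r := by
      rw [← hyd]; exact (Metric.infDist_le_dist_of_mem hx.2).trans_lt hdx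
    have h2 := dist_triangle_left y x ρ
    rw [hyd]
    exact (Metric.infDist_le_dist_of_mem (F.iterate_tailMinus hy k)).trans
      (hLip k hk x hx ρ y (by linarith) (by linarith))
  have hDlow : ∀ ρ, Metric.infDist ρ F.tailMinus ≤ D ρ := by
    intro ρ
    have h1 := Finset.single_le_sum (f := fun k => Metric.infDist (F.Φ^[k] ρ) F.tailMinus)
      (fun k _ => Metric.infDist_nonneg) (Finset.mem_range.2 hm)
    simpa only [Function.iterate_zero, id] using h1
  have hDup : ∀ ρ, Metric.infDist ρ F.trapped < r →
      D ρ ≤ m * L * Metric.infDist ρ F.tailMinus := by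
    intro ρ hρ
    refine (Finset.sum_le_card_nsmul _ _ _ fun k hk =>
      hterm ρ hρ k (Finset.mem_range.1 hk).le).trans (le_of_eq ?_)
    rw [Finset.card_range, nsmul_eq_mul, mul_assoc]
  have hD0 : ∀ ρ, 0 ≤ D ρ := fun ρ => Metric.infDist_nonneg.trans (hDlow ρ)
  have hmL : 1 ≤ m * L := by nlinarith
  have hmLL : m * L ≤ m * L * L := by nlinarith
  refine ⟨1 / (m * L), by positivity, r, hr, m * L * L, by linarith, D, hDlow, fun ρ hρ => ?_,
    fun p hp q hq => ?_, fun ρ hρ => ?_, fun ρ hρ hρ' => ?_⟩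
  · refine (hDup ρ hρ).trans ?_
    have := Metric.infDist_nonneg (x := ρ) (s := F.tailMinus)
    gcongr
  · have hdist : |D p - D q| ≤ m * L * dist p q := by
      rcases lt_or_ge (dist p q) r with h | h
      · obtain ⟨x, hx, hdx⟩ := exists_near_of_infDist_lt hne hp
        have h2 := dist_triangle_left q x p
        simp only [D]
        rw [← Finset.sum_sub_distrib]
        refine (Finset.abs_sum_le_sum_abs _ _).trans ?_
        have h3 : ∀ k ∈ Finset.range m, |Metric.infDist (F.Φ^[k] p) F.tailMinus -
            Metric.infDist (F.Φ^[k] q) F.tailMinus| ≤ L * dist p q := fun k hk => by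
          have h4 := (Metric.lipschitz_infDist_pt F.tailMinus).dist_le_mul (F.Φ^[k] p) (F.Φ^[k] q)
          rw [Real.dist_eq, NNReal.coe_one, one_mul] at h4
          exact h4.trans (hLip k (Finset.mem_range.1 hk).le x hx p q (by linarith) (by linarith))
        refine (Finset.sum_le_card_nsmul _ _ _ h3).trans (le_of_eq ?_)
        rw [Finset.card_range, nsmul_eq_mul, mul_assoc]
      -- For points at least `r` apart no local estimate is needed, since `D` itself is at most `m L
      -- r`.
      · have key : ∀ ρ, Metric.infDist ρ F.trapped < r → D ρ ≤ m * L * dist p q := by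
          intro ρ hρ
          refine (hDup ρ hρ).trans ?_
          obtain ⟨x, hx, hdx⟩ := exists_near_of_infDist_lt hne hρ
          have h3 : Metric.infDist ρ F.tailMinus ≤ dist p q :=
            (Metric.infDist_le_dist_of_mem hx.2).trans (hdx.le.trans h)
          gcongr
        rw [abs_le]
        constructor
        · linarith [key q hq, hD0 p]
        · linarith [key p hp, hD0 q]
    refine hdist.trans ?_
    gcongr
  · have h1 : D (F.Φ ρ) - D ρ = Metric.infDist (F.Φ^[m] ρ) F.tailMinus -
        Metric.infDist ρ F.tailMinus := by
      have h2 := Finset.sum_range_succ (fun k => Metric.infDist (F.Φ^[k] ρ) F.tailMinus) m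
      have h3 := Finset.sum_range_succ' (fun k => Metric.infDist (F.Φ^[k] ρ) F.tailMinus) m
      have h4 : D (F.Φ ρ) = ∑ k ∈ Finset.range m, Metric.infDist (F.Φ^[k + 1] ρ) F.tailMinus := rfl
      simp only [Function.iterate_zero, id] at h3
      simp only [h4, D]
      linarith
    have h2 := hexp ρ (hρ.trans_le hrr1)
    have h3 := hDup ρ hρ
    have h4 : 1 / (m * L) * D ρ ≤ Metric.infDist ρ F.tailMinus := by
      rw [div_mul_eq_mul_div, one_mul, div_le_iff₀ (by positivity)]
      linarith
    linarith
  · refine (hDup _ hρ').trans ?_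
    have h1 := hterm ρ hρ 1 hm
    have h2 : L * Metric.infDist ρ F.tailMinus ≤ L * D ρ := by
      gcongr; exact hDlow ρ
    calc m * L * Metric.infDist (F.Φ ρ) F.tailMinus ≤ m * L * (L * D ρ) := by
          gcongr; exact h1.trans h2
      _ = _ := by ring

end OpenMap

/-! ### Inequalities for regularized squares -/

section Arithmetic

/-- The comparisons between regularized squared distances. -/
lemma regularized_comparison {ε c C Ct Lp Lm dp dm dt Dp Dm φp φm : ℝ} (hε : 0 < ε) (hc1 : c ≤ 1)
    (hdp : 0 ≤ dp) (hdm : 0 ≤ dm) (hdt : 0 ≤ dt) (hpt : dp ≤ dt) (hmt : dm ≤ dt)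
    (htr : dt ≤ Ct * (dp + dm)) (hDp : dp ≤ Dp) (hDm : dm ≤ Dm) (hup : Dp ≤ Lp * dp)
    (hum : Dm ≤ Lm * dm) (hp1 : Dp ^ 2 + ε ≤ φp) (hp2 : φp ≤ (1 + c) * (Dp ^ 2 + ε))
    (hm1 : Dm ^ 2 + ε ≤ φm) (hm2 : φm ≤ (1 + c) * (Dm ^ 2 + ε)) (k4 : 4 ≤ C)
    (k3 : 2 * Lp ^ 2 + 2 * Lm ^ 2 ≤ C) (k5 : 2 * Ct ^ 2 + 1 ≤ C) :
    ε ≤ φp ∧ ε ≤ φm ∧ (dp ^ 2 + ε) / C ≤ φp ∧ φp ≤ C * (dp ^ 2 + ε) ∧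
      (dm ^ 2 + ε) / C ≤ φm ∧ φm ≤ C * (dm ^ 2 + ε) ∧
      (dt ^ 2 + ε) / C ≤ φp + φm ∧ φp + φm ≤ C * (dt ^ 2 + ε) := by
  have hC0 : 0 < C := by linarith
  have e1 : dp ^ 2 ≤ Dp ^ 2 := by gcongr
  have e2 : dm ^ 2 ≤ Dm ^ 2 := by gcongr
  have hDp0 : 0 ≤ Dp := hdp.trans hDp
  have hDm0 : 0 ≤ Dm := hdm.trans hDm
  have e3 : Dp ^ 2 ≤ Lp ^ 2 * dp ^ 2 := by rw [← mul_pow]; gcongr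
  have e4 : Dm ^ 2 ≤ Lm ^ 2 * dm ^ 2 := by rw [← mul_pow]; gcongr
  have e5 : dp ^ 2 ≤ dt ^ 2 := by gcongr
  have e6 : dm ^ 2 ≤ dt ^ 2 := by gcongr
  have e7 : dt ^ 2 ≤ 2 * Ct ^ 2 * (dp ^ 2 + dm ^ 2) := by
    have h1 : dt ^ 2 ≤ (Ct * (dp + dm)) ^ 2 := by gcongr
    have h2 : 0 ≤ Ct ^ 2 * (dp - dm) ^ 2 := by positivity
    nlinarith
  have u1 : φp ≤ 2 * (Lp ^ 2 * dp ^ 2 + ε) := by nlinarith [sq_nonneg Dp]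
  have u2 : φm ≤ 2 * (Lm ^ 2 * dm ^ 2 + ε) := by nlinarith [sq_nonneg Dm]
  have q1 := sq_nonneg dp
  have q2 := sq_nonneg dm
  have q3 := sq_nonneg dt
  have k1 : 2 * Lp ^ 2 ≤ C := by nlinarith [sq_nonneg Lm]
  have k2 : 2 * Lm ^ 2 ≤ C := by nlinarith [sq_nonneg Lp]
  have hpε : ε ≤ φp := by linarith [sq_nonneg Dp]
  have hmε : ε ≤ φm := by linarith [sq_nonneg Dm]
  have hdiv : ∀ s t : ℝ, s ≤ t → 0 ≤ t → s / C ≤ t := fun s t hst ht => by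
    rw [div_le_iff₀ hC0]; nlinarith
  have hCε : 4 * ε ≤ C * ε := by gcongr
  have w1 := mul_le_mul_of_nonneg_right k1 q1
  have w2 := mul_le_mul_of_nonneg_right k2 q2
  have w3 := mul_le_mul_of_nonneg_right k3 q3
  refine ⟨hpε, hmε, hdiv _ _ (by linarith) (by linarith), by linarith,
    hdiv _ _ (by linarith) (by linarith), by linarith, ?_, ?_⟩
  · rw [div_le_iff₀ hC0]
    have h4 : dp ^ 2 + dm ^ 2 ≤ φp + φm := by linarith
    have h5 : 2 * Ct ^ 2 * (dp ^ 2 + dm ^ 2) ≤ 2 * Ct ^ 2 * (φp + φm) := by gcongr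
    have h6 : (2 * Ct ^ 2 + 1) * (φp + φm) ≤ C * (φp + φm) := by
      gcongr; linarith
    linarith
  · have h3 : Lp ^ 2 * dp ^ 2 ≤ Lp ^ 2 * dt ^ 2 := by gcongr
    have h4 : Lm ^ 2 * dm ^ 2 ≤ Lm ^ 2 * dt ^ 2 := by gcongr
    linarith

/-- The monotonicity of regularized squared distances. -/
lemma regularized_monotone {ε c C Lm Dp Dm φp φm Dp' Dm' φp' φm' : ℝ} (hε : 0 < ε) (hc : 0 < c)
    (hc1 : c ≤ 1) (hDm : 0 ≤ Dm) (hDp' : 0 ≤ Dp') (hDm' : 0 ≤ Dm')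
    (p1 : Dp ^ 2 + ε ≤ φp) (m1 : Dm ^ 2 + ε ≤ φm)
    (m2 : φm ≤ (1 + c) * (Dm ^ 2 + ε)) (p1' : Dp' ^ 2 + ε ≤ φp')
    (p2' : φp' ≤ (1 + c) * (Dp' ^ 2 + ε)) (m1' : Dm' ^ 2 + ε ≤ φm')
    (m2' : φm' ≤ (1 + c) * (Dm' ^ 2 + ε))
    (x1 : (1 + c) * Dm ≤ Dm') (x2 : (1 + c) * Dp' ≤ Dp) (x3 : Dm' ≤ Lm * Dm)
    (k1 : 2 / c ≤ C) (k3 : 2 * Lm ^ 2 + 2 + (1 + c) ^ 2 ≤ C) :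
    φp / C ≤ (φp - φp') + (1 + c) ^ 2 * ε ∧ (φp - φp') + (1 + c) ^ 2 * ε ≤ C * φp ∧
      φm / C ≤ -(φm - φm') + (1 + c) ^ 2 * ε ∧ -(φm - φm') + (1 + c) ^ 2 * ε ≤ C * φm := by
  have hC0 : 0 < C := lt_of_lt_of_le (by positivity) k1
  have y1 : (1 + c) ^ 2 * Dm ^ 2 ≤ Dm' ^ 2 := by
    rw [← mul_pow]; gcongr
  have y2 : (1 + c) ^ 2 * Dp' ^ 2 ≤ Dp ^ 2 := by
    rw [← mul_pow]; gcongr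
  have y3 : Dm' ^ 2 ≤ Lm ^ 2 * Dm ^ 2 := by
    rw [← mul_pow]; gcongr
  have hp0 : ε ≤ φp := by linarith [sq_nonneg Dp]
  have hm0 : ε ≤ φm := by linarith [sq_nonneg Dm]
  have hp0' : ε ≤ φp' := by linarith [sq_nonneg Dp']
  have hCc : 2 ≤ C * c := by rwa [div_le_iff₀ hc] at k1
  have hdiv : ∀ t, 0 ≤ t → t / C ≤ c / 2 * t := by
    intro t ht
    rw [div_le_iff₀ hC0]
    nlinarith
  refine ⟨?_, ?_, ?_, ?_⟩
  · refine (hdiv _ (by linarith)).trans ?_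
    -- The square of the expansion factor pays twice: one factor `1 + c` absorbs the error of the
    -- regularization, the other is the gain.
    have z1 : (1 + c) * φp' ≤ Dp ^ 2 + (1 + c) ^ 2 * ε := by
      calc (1 + c) * φp' ≤ (1 + c) * ((1 + c) * (Dp' ^ 2 + ε)) := by gcongr
        _ = (1 + c) ^ 2 * Dp' ^ 2 + (1 + c) ^ 2 * ε := by ring
        _ ≤ _ := by gcongr
    have z2 : 0 ≤ c * ((1 + c) ^ 2 * ε) := by positivity
    have z3 : c / 2 * (1 + c) ≤ c := by nlinarith
    have z4 : c / 2 * (1 + c) * φp ≤ c * φp :=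
      mul_le_mul_of_nonneg_right z3 (by linarith)
    have z5 : (1 + c) * (c / 2 * φp) ≤ (1 + c) * (φp - φp' + (1 + c) ^ 2 * ε) := by
      linarith
    exact le_of_mul_le_mul_left z5 (by linarith)
  · have z1 : (1 + c) ^ 2 * ε ≤ (1 + c) ^ 2 * φp := by gcongr
    have z2 : (1 + (1 + c) ^ 2) * φp ≤ C * φp := by
      have : 0 ≤ φp := by linarith
      have : 0 ≤ Lm ^ 2 := sq_nonneg _
      gcongr; linarith
    linarith
  · refine (hdiv _ (by linarith)).trans ?_
    have z1 : (1 + c) * φm ≤ (1 + c) ^ 2 * Dm ^ 2 + (1 + c) ^ 2 * ε := by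
      calc (1 + c) * φm ≤ (1 + c) * ((1 + c) * (Dm ^ 2 + ε)) := by gcongr
        _ = _ := by ring
    have z2 : 0 ≤ c * φm := mul_nonneg hc.le (by linarith)
    linarith
  · have z1 : φm' ≤ 2 * (Lm ^ 2 * Dm ^ 2 + ε) := by
      refine m2'.trans ?_
      have : 0 ≤ Dm' ^ 2 + ε := by positivity
      nlinarith
    have z2 : Lm ^ 2 * Dm ^ 2 ≤ Lm ^ 2 * φm := by gcongr; linarith
    have z3 : (2 * Lm ^ 2 + 2 + (1 + c) ^ 2) * φm ≤ C * φm := by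
      gcongr; linarith
    have z4 : (1 + c) ^ 2 * ε ≤ (1 + c) ^ 2 * φm := by gcongr
    linarith

end Arithmetic

/-! ### Existence of regularized pairs -/

namespace OpenMap

variable {d J : ℕ} {F : OpenMap d J}

/-- The trapped set has small neighbourhoods whose image is small too. -/
lemma exists_small_neighbourhood (hne : F.trapped.Nonempty) (hint : F.trapped ⊆ interior F.D)
    {N : Set (PhaseSpace d J)} (hN : F.trapped ⊆ interior N) {r : ℝ} (hr : 0 < r) :
    ∃ V, IsOpen V ∧ F.trapped ⊆ V ∧ CompactlyIn V F.D ∧ CompactlyIn V N ∧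
      (∀ ρ ∈ V, Metric.infDist ρ F.trapped < r) ∧
      ∀ ρ ∈ V, Metric.infDist (F.Φ ρ) F.trapped < r := by
  obtain ⟨r₁, hr₁, h₁⟩ := exists_iterate_near hne (O := Metric.thickening r F.trapped)
    Metric.isOpen_thickening (Metric.self_subset_thickening hr _) 1
  obtain ⟨r₂, hr₂, h₂⟩ := F.isCompact_trapped.exists_cthickening_subset_open
    (isOpen_interior.inter isOpen_interior) (subset_inter hint hN)
  have hlt : ∀ ρ : PhaseSpace d J, ρ ∈ Metric.thickening r F.trapped ↔
      Metric.infDist ρ F.trapped < r := fun ρ => Metric.mem_thickening_iff_infDist_lt hne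
  set s := min r₁ r₂
  have hs : 0 < s := by positivity
  have hcl : closure (Metric.thickening s F.trapped) ⊆ Metric.cthickening r₂ F.trapped :=
    (Metric.closure_thickening_subset_cthickening _ _).trans
      (Metric.cthickening_mono (min_le_right _ _) _)
  have hcomp : IsCompact (closure (Metric.thickening s F.trapped)) :=
    (F.isCompact_trapped.cthickening).of_isClosed_subset isClosed_closure hcl
  have hmem : ∀ ρ ∈ Metric.thickening s F.trapped, Metric.infDist ρ F.trapped < r₁ := by
    intro ρ hρ
    exact ((Metric.mem_thickening_iff_infDist_lt hne).1 hρ).trans_le (min_le_left _ _)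
  refine ⟨Metric.thickening s F.trapped, Metric.isOpen_thickening,
    Metric.self_subset_thickening hs _, ⟨hcomp, fun ρ hρ => (h₂ (hcl hρ)).1⟩,
    ⟨hcomp, fun ρ hρ => (h₂ (hcl hρ)).2⟩, fun ρ hρ => ?_, fun ρ hρ => ?_⟩
  · exact (hlt ρ).1 (h₁ ρ (hmem ρ hρ) 0 (by omega))
  · exact (hlt (F.Φ ρ)).1 (h₁ ρ (hmem ρ hρ) 1 le_rfl)

/-- Regularized distances to the tails exist near the trapped set. -/
theorem IsHyperbolic.exists_isRegularizedPair (hF : F.IsHyperbolic) (hne : F.trapped.Nonempty)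
    (hint : F.trapped ⊆ interior F.D) {N : Set (PhaseSpace d J)} (hN : F.trapped ⊆ interior N) :
    ∃ (V : Set (PhaseSpace d J)) (ε₀ : ℝ) (φp φm : ℝ → PhaseSpace d J → ℝ),
      CompactlyIn V N ∧ F.IsRegularizedPair V ε₀ φp φm := by
  obtain ⟨cm, hcm, rm, hrm, Lm, hLm, Dm, hmlow, hmup, hmLip, hmexp, hmup'⟩ :=
    hF.exists_adapted_distance hne hint
  obtain ⟨cp, hcp, rp, hrp, Lp, hLp, Dp, hplow, hpup, hpLip, hpexp, -⟩ :=
    hF.rev.exists_adapted_distance (by rw [trapped_rev]; exact hne)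
      (F.trapped_subset_interior_rev hint)
  rw [trapped_rev, tailMinus_rev] at *
  obtain ⟨Ct, hCt, rt, hrt, htrans⟩ := hF.exists_transversality hne hint
  -- One rate for both tails, which also serves below as the relative error of the regularizations.
  set c : ℝ := min (min cm cp) 1
  have hc : 0 < c := by positivity
  have hccm : c ≤ cm := (min_le_left _ _).trans (min_le_left _ _)
  have hccp : c ≤ cp := (min_le_left _ _).trans (min_le_right _ _)
  have hc1 : c ≤ 1 := min_le_right _ _
  set r : ℝ := min (min rm rp) rt
  have hr : 0 < r := by positivity
  have hr1 : r ≤ rm := (min_le_left _ _).trans (min_le_left _ _)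
  have hr2 : r ≤ rp := (min_le_left _ _).trans (min_le_right _ _)
  have hr3 : r ≤ rt := min_le_right _ _
  obtain ⟨V, hVo, hTV, hVD, hVN, hV1, hV2⟩ := exists_small_neighbourhood hne hint hN hr
  obtain ⟨Km, φm, hm⟩ := exists_regularized_square (by linarith) hmLip hc hc1
  obtain ⟨Kp, φp, hp⟩ := exists_regularized_square (by linarith) hpLip hc hc1
  have hV' : ∀ ρ ∈ F.enlarge V, Metric.infDist ρ F.trapped < r := by
    rintro ρ (hρ | ⟨σ, hσ, rfl⟩)
    · exact hV1 ρ hρ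
    · exact hV2 σ hσ
  have hVs : ∀ ρ ∈ V, ρ ∈ F.Φ.source := fun ρ hρ =>
    F.D_subset_source (interior_subset (hVD.2 (subset_closure hρ)))
  set C₀ : ℝ := (1 + c) ^ 2
  have hC₀ : 1 ≤ C₀ := by simp only [C₀]; nlinarith
  have hc1' : 1 ≤ 1 / c := by rw [one_le_div hc]; exact hc1
  set C : ℝ := 2 * Ct ^ 2 + 1 + 2 * Lm ^ 2 + 2 * Lp ^ 2 + 4 + 2 / c + 2 * C₀
  have hC1 : 1 ≤ C := by
    have : 0 < 2 / c := by positivity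
    have : 0 ≤ Ct ^ 2 := sq_nonneg _
    simp only [C]; nlinarith
  refine ⟨V, 1 / 2, φp, φm, hVN, hVo, hTV, hVD, by norm_num, by norm_num, C₀, C,
    fun n => max (Km n) (Kp n), by linarith, hC1, fun ε hε _ => ?_⟩
  obtain ⟨hms, hm'⟩ := hm ε hε
  obtain ⟨hps, hp'⟩ := hp ε hε
  have h2c : 0 < 2 / c := by positivity
  have hCt2 : 0 ≤ Ct ^ 2 := sq_nonneg _
  have hLm2 : 0 ≤ Lm ^ 2 := sq_nonneg _
  have hLp2 : 0 ≤ Lp ^ 2 := sq_nonneg _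
  have hC0' : 0 < C := by linarith
  -- the consequences of the regularization, at one point
  have hpt : ∀ ρ, Metric.infDist ρ F.trapped < r →
      (Dp ρ ^ 2 + ε ≤ φp ε ρ ∧ φp ε ρ ≤ (1 + c) * (Dp ρ ^ 2 + ε)) ∧
      (Dm ρ ^ 2 + ε ≤ φm ε ρ ∧ φm ε ρ ≤ (1 + c) * (Dm ρ ^ 2 + ε)) ∧
      0 ≤ Dp ρ ∧ 0 ≤ Dm ρ := by
    intro ρ hρ
    have h1 := hp' ρ (hρ.trans_le hr2)
    have h2 := hm' ρ (hρ.trans_le hr1)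
    exact ⟨⟨h1.1, h1.2.1⟩, ⟨h2.1, h2.2.1⟩, Metric.infDist_nonneg.trans (hplow ρ),
      Metric.infDist_nonneg.trans (hmlow ρ)⟩
  refine ⟨fun j => (hps j).mono (subset_univ _), fun j => (hms j).mono (subset_univ _),
    fun ρ hρ => ?_, fun ρ hρ => ?_⟩
  · have hρr := hV' ρ hρ
    obtain ⟨⟨hp1, hp2⟩, ⟨hm1, hm2⟩, hDp0, hDm0⟩ := hpt ρ hρr
    simp only [distTo_eq_infDist]
    obtain ⟨a1, a2, a3, a4, a5, a6, a7, a8⟩ := regularized_comparison (C := C) hε hc1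
      Metric.infDist_nonneg Metric.infDist_nonneg Metric.infDist_nonneg
      (Metric.infDist_le_infDist_of_subset (fun _ h => h.1) hne)
      (Metric.infDist_le_infDist_of_subset (fun _ h => h.2) hne)
      (htrans ρ (hρr.trans_le hr3)) (hplow ρ) (hmlow ρ) (hpup ρ (hρr.trans_le hr2))
      (hmup ρ (hρr.trans_le hr1)) hp1 hp2 hm1 hm2 (by simp only [C]; linarith)
      (by simp only [C]; linarith) (by simp only [C]; linarith)
    refine ⟨a1, a2, a3, a4, a5, a6, a7, a8, fun n => ⟨?_, ?_⟩⟩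
    · refine ((hp' ρ (hρr.trans_le hr2)).2.2 n).trans ?_
      have : 0 ≤ φp ε ρ := hε.le.trans a1
      gcongr; exact le_max_right _ _
    · refine ((hm' ρ (hρr.trans_le hr1)).2.2 n).trans ?_
      have : 0 ≤ φm ε ρ := hε.le.trans a2
      gcongr; exact le_max_left _ _
  · have h1 := hV1 ρ hρ
    have h2 := hV2 ρ hρ
    obtain ⟨⟨p1, p2⟩, ⟨m1, m2⟩, hDp0, hDm0⟩ := hpt ρ h1
    obtain ⟨⟨p1', p2'⟩, ⟨m1', m2'⟩, hDp0', hDm0'⟩ := hpt (F.Φ ρ) h2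
    have x1 : (1 + c) * Dm ρ ≤ Dm (F.Φ ρ) := by
      refine le_trans ?_ (hmexp ρ (h1.trans_le hr1)); gcongr
    have x2 : (1 + c) * Dp (F.Φ ρ) ≤ Dp ρ := by
      have := hpexp (F.Φ ρ) (h2.trans_le hr2)
      rw [rev_Φ, F.Φ.left_inv (hVs ρ hρ)] at this
      refine le_trans ?_ this; gcongr
    exact regularized_monotone hε hc hc1 hDm0 hDp0' hDm0' p1 m1 m2 p1' p2' m1' m2' x1 x2
      (hmup' ρ (h1.trans_le hr1) (h2.trans_le hr1)) (by simp only [C]; linarith)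
      (by simp only [C, C₀] at hC₀ ⊢; linarith)

end OpenMap

/-! ### Test functions on the phase space -/

section TestFunctions

variable {d J : ℕ}

/-- `g` is smooth, with compact support in `O`. -/
def TestOn (O : Set (PhaseSpace d J)) (g : PhaseSpace d J → ℝ) : Prop :=
  SmoothOn g univ ∧ HasCompactSupport g ∧ tsupport g ⊆ O

lemma smoothOn_univ_iff {φ : PhaseSpace d J → ℝ} :
    SmoothOn φ univ ↔ ∀ ρ : PhaseSpace d J, ContDiffAt ℝ ∞ (fun x : CotSpace d => φ (ρ.1, x)) ρ.2 := by
  constructor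
  · intro h ρ
    exact (h ρ.1).contDiffAt (by simp)
  · intro h j x _
    exact (h (j, x)).contDiffWithinAt

lemma contDiffAt_slice_of_eventuallyEq {φ ψ : PhaseSpace d J → ℝ} {ρ : PhaseSpace d J}
    (h : ContDiffAt ℝ ∞ (fun x : CotSpace d => φ (ρ.1, x)) ρ.2) (he : ψ =ᶠ[nhds ρ] φ) :
    ContDiffAt ℝ ∞ (fun x : CotSpace d => ψ (ρ.1, x)) ρ.2 := by
  have h1 : ContinuousAt (fun x : CotSpace d => (ρ.1, x)) ρ.2 := by fun_prop
  exact h.congr_of_eventuallyEq (h1.eventually he)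

lemma contDiffAt_slice_comp {φ : PhaseSpace d J → ℝ} {Ψ : PhaseSpace d J → PhaseSpace d J}
    {ρ : PhaseSpace d J}
    (h : ContDiffAt ℝ ∞ (fun x : CotSpace d => φ ((Ψ ρ).1, x)) (Ψ ρ).2)
    (hΨ : ContDiffAt ℝ ∞ (fun x : CotSpace d => (Ψ (ρ.1, x)).2) ρ.2) (hc : ContinuousAt Ψ ρ) :
    ContDiffAt ℝ ∞ (fun x : CotSpace d => φ (Ψ (ρ.1, x))) ρ.2 := by
  have h1 : ContDiffAt ℝ ∞ (fun x : CotSpace d => φ ((Ψ ρ).1, (Ψ (ρ.1, x)).2)) ρ.2 :=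
    ContDiffAt.comp ρ.2 (g := fun y : CotSpace d => φ ((Ψ ρ).1, y))
      (f := fun x : CotSpace d => (Ψ (ρ.1, x)).2) h hΨ
  refine h1.congr_of_eventuallyEq ?_
  filter_upwards [eventually_fst_eq hc] with x hx
  rw [← hx]

lemma TestOn.mono {O O' : Set (PhaseSpace d J)} {g : PhaseSpace d J → ℝ} (h : TestOn O g)
    (hO : O ⊆ O') : TestOn O' g := ⟨h.1, h.2.1, h.2.2.trans hO⟩

lemma TestOn.zero (O : Set (PhaseSpace d J)) : TestOn O (0 : PhaseSpace d J → ℝ) := by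
  refine ⟨fun j => contDiffOn_const, HasCompactSupport.zero, ?_⟩
  simp [tsupport]

lemma TestOn.add {O : Set (PhaseSpace d J)} {g h : PhaseSpace d J → ℝ} (hg : TestOn O g)
    (hh : TestOn O h) : TestOn O (g + h) :=
  ⟨fun j => (hg.1 j).add (hh.1 j), hg.2.1.add hh.2.1,
    (tsupport_add g h).trans (union_subset hg.2.2 hh.2.2)⟩

lemma TestOn.neg {O : Set (PhaseSpace d J)} {g : PhaseSpace d J → ℝ} (hg : TestOn O g) :
    TestOn O (-g) := by
  have h1 : tsupport (-g) = tsupport g := by simp [tsupport, Function.support_neg]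
  exact ⟨fun j => (hg.1 j).neg, (by rw [HasCompactSupport, h1]; exact hg.2.1), h1 ▸ hg.2.2⟩

lemma TestOn.sum {O : Set (PhaseSpace d J)} {ι : Type*} (s : Finset ι)
    {g : ι → PhaseSpace d J → ℝ} (hg : ∀ i ∈ s, TestOn O (g i)) : TestOn O (∑ i ∈ s, g i) :=
  Finset.sum_induction g (TestOn O) (fun _ _ => TestOn.add) (TestOn.zero O) hg

lemma TestOn.eq_zero {O : Set (PhaseSpace d J)} {g : PhaseSpace d J → ℝ} (hg : TestOn O g)
    {ρ : PhaseSpace d J} (hρ : ρ ∉ O) : g ρ = 0 :=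
  image_eq_zero_of_notMem_tsupport fun h => hρ (hg.2.2 h)

/-- A smooth bump near a given point. -/
lemma exists_testOn_one_le {O : Set (PhaseSpace d J)} (hO : IsOpen O) {ρ : PhaseSpace d J}
    (hρ : ρ ∈ O) :
    ∃ ψ, TestOn O ψ ∧ (∀ μ, 0 ≤ ψ μ) ∧ ∀ᶠ μ in nhds ρ, 1 ≤ ψ μ := by
  classical
  obtain ⟨j, x⟩ := ρ
  have h1 : IsOpen {y : CotSpace d | (j, y) ∈ O} := hO.preimage (by fun_prop)
  obtain ⟨r, hr, hb⟩ := Metric.isOpen_iff.1 h1 x hρ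
  let b : ContDiffBump x := ⟨r / 4, r / 2, by positivity, by linarith⟩
  have hsupp : Function.support (fun μ : PhaseSpace d J => if μ.1 = j then b μ.2 else 0) ⊆
      (fun y : CotSpace d => ((j, y) : PhaseSpace d J)) '' Metric.closedBall x (r / 2) := by
    rintro ⟨k, y⟩ hy
    have hk : k = j := by
      by_contra h
      exact hy (if_neg h)
    subst hk
    refine ⟨y, ?_, rfl⟩
    have h2 : y ∈ Function.support b := by simpa using hy
    rw [b.support_eq] at h2
    exact Metric.ball_subset_closedBall h2
  have hcomp : IsCompact ((fun y : CotSpace d => ((j, y) : PhaseSpace d J)) ''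
      Metric.closedBall x (r / 2)) := (isCompact_closedBall x _).image (by fun_prop)
  have hts := closure_minimal hsupp hcomp.isClosed
  refine ⟨fun μ => if μ.1 = j then b μ.2 else 0, ⟨?_, ?_, ?_⟩, fun μ => ?_, ?_⟩
  · intro k
    by_cases hk : k = j
    · simpa [hk] using b.contDiff.contDiffOn
    · simpa [hk] using contDiffOn_const
  · exact hcomp.of_isClosed_subset (isClosed_tsupport _) hts
  · refine hts.trans ?_
    rintro _ ⟨y, hy, rfl⟩
    apply hb
    rw [Metric.mem_closedBall] at hy
    rw [Metric.mem_ball]; linarith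
  · dsimp only
    split_ifs
    · exact b.nonneg
    · exact le_rfl
  · rw [nhds_prod_eq, nhds_discrete]
    refine Filter.mem_prod_iff.2 ⟨{j}, by simp, Metric.closedBall x (r / 4),
      Metric.closedBall_mem_nhds _ (by positivity), ?_⟩
    rintro ⟨k, y⟩ ⟨hk, hy⟩
    obtain rfl : k = j := hk
    have : b y = 1 := b.one_of_mem_closedBall hy
    simp [this]

end TestFunctions

/-! ### The cohomological equation and outer escape functions -/

namespace OpenMap

variable {d J : ℕ} (F : OpenMap d J)

/-- The push-forward of a function by the canonical transformation, extended by zero. -/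
def push (ψ : PhaseSpace d J → ℝ) : PhaseSpace d J → ℝ :=
  F.Φ.target.indicator (ψ ∘ F.Φ.symm)

lemma push_map (ψ : PhaseSpace d J → ℝ) {ρ : PhaseSpace d J} (h : ρ ∈ F.Φ.source) :
    F.push ψ (F.Φ ρ) = ψ ρ := by
  rw [push, indicator_of_mem (F.Φ.map_source h), Function.comp_apply, F.Φ.left_inv h]

/-- The image of the compact support is compact, hence closed in the whole space; so the extension
by zero is smooth across the boundary of the target. -/
lemma testOn_push {ψ : PhaseSpace d J → ℝ} {O O' : Set (PhaseSpace d J)} (h : TestOn O ψ)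
    (hO : O ⊆ F.Φ.source) (hO' : MapsTo F.Φ O O') : TestOn O' (F.push ψ) := by
  have hsub : tsupport ψ ⊆ F.Φ.source := h.2.2.trans hO
  have hcomp : IsCompact (F.Φ '' tsupport ψ) :=
    IsCompact.image_of_continuousOn h.2.1 (F.Φ.continuousOn.mono hsub)
  have hsupp : Function.support (F.push ψ) ⊆ F.Φ '' tsupport ψ := by
    intro τ hτ
    rw [push, Set.support_indicator] at hτ
    exact ⟨F.Φ.symm τ, subset_tsupport _ hτ.2, F.Φ.right_inv hτ.1⟩
  have hts : tsupport (F.push ψ) ⊆ F.Φ '' tsupport ψ := closure_minimal hsupp hcomp.isClosed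
  refine ⟨smoothOn_univ_iff.2 fun τ => ?_,
    hcomp.of_isClosed_subset (isClosed_tsupport _) hts,
    hts.trans ((hO'.mono_left h.2.2).image_subset)⟩
  by_cases hτ : τ ∈ F.Φ.target
  · refine contDiffAt_slice_of_eventuallyEq (φ := ψ ∘ F.Φ.symm) ?_ ?_
    · exact contDiffAt_slice_comp (smoothOn_univ_iff.1 h.1 _) (F.smooth_symm τ hτ)
        (F.Φ.symm.continuousAt hτ)
    · filter_upwards [F.Φ.open_target.mem_nhds hτ] with σ hσ
      exact indicator_of_mem hσ _
  · have h1 : τ ∉ F.Φ '' tsupport ψ := by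
      rintro ⟨σ, hσ, rfl⟩
      exact hτ (F.Φ.map_source (hsub hσ))
    refine contDiffAt_slice_of_eventuallyEq (φ := 0) contDiffAt_const ?_
    filter_upwards [hcomp.isClosed.isOpen_compl.mem_nhds h1] with σ hσ
    exact Function.notMem_support.1 fun h2 => hσ (hsupp h2)

/-- The cohomological equation `g ∘ F - g = ψ` is solvable for `ψ` supported near a point whose
forward orbit leaves the departure set. -/
lemma exists_primitive_forward (n : ℕ) (ρ : PhaseSpace d J)
    (h : ∀ i < n, F.Φ^[i] ρ ∈ F.D) (hn : F.Φ^[n] ρ ∉ F.D) :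
    ∃ O, IsOpen O ∧ ρ ∈ O ∧ ∀ ψ, TestOn O ψ →
      ∃ g, TestOn (F.U \ F.trapped) g ∧ ∀ σ ∈ F.D, g (F.Φ σ) - g σ = ψ σ := by
  induction n generalizing ρ with
  | zero =>
    -- Off the departure set the equation imposes nothing, and `g = 0` solves it.
    refine ⟨F.Dᶜ, F.isCompact_D.isClosed.isOpen_compl, hn, fun ψ hψ => ⟨0, TestOn.zero _, ?_⟩⟩
    intro σ hσ
    rw [hψ.eq_zero (fun h1 => h1 hσ)]
    simp
  | succ n ih =>
    have hD : ρ ∈ F.D := h 0 (by omega)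
    obtain ⟨O', hO', hρO', hsol⟩ := ih (F.Φ ρ) (fun i hi => h (i + 1) (by omega)) hn
    have hT : F.Φ ρ ∉ F.trapped := fun hT =>
      hn (F.mem_tailMinus.1 hT.2 n)
    have hO1 : IsOpen (O' ∩ (F.U \ F.trapped)) :=
      hO'.inter (F.isOpen_U.sdiff F.isCompact_trapped.isClosed)
    refine ⟨F.Φ.source ∩ F.Φ ⁻¹' (O' ∩ (F.U \ F.trapped)), F.Φ.isOpen_inter_preimage hO1,
      ⟨F.D_subset_source hD, hρO', F.image_subset_U ⟨ρ, hD, rfl⟩, hT⟩, fun ψ hψ => ?_⟩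
    have hpush := F.testOn_push hψ inter_subset_left (O' := O' ∩ (F.U \ F.trapped))
      fun σ hσ => hσ.2
    obtain ⟨g, hg, hg'⟩ := hsol _ (hpush.mono inter_subset_left)
    -- If `g` solves the equation for the push-forward of `ψ`, adding that push-forward solves it
    -- for `ψ`. Unrolled, the solution is the sum of the push-forwards of `ψ` along the orbit until
    -- it leaves the departure set.
    refine ⟨g + F.push ψ, hg.add (hpush.mono inter_subset_right), fun σ hσ => ?_⟩
    have h1 := hg' σ hσ
    have h2 := F.push_map ψ (F.D_subset_source hσ)
    simp only [Pi.add_apply]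
    linarith

lemma exists_primitive_of_notMem_tailMinus {ρ : PhaseSpace d J} (h : ρ ∉ F.tailMinus) :
    ∃ O, IsOpen O ∧ ρ ∈ O ∧ ∀ ψ, TestOn O ψ →
      ∃ g, TestOn (F.U \ F.trapped) g ∧ ∀ σ ∈ F.D, g (F.Φ σ) - g σ = ψ σ := by
  classical
  rw [mem_tailMinus, not_forall] at h
  exact F.exists_primitive_forward (Nat.find h) ρ
    (fun i hi => not_not.1 (Nat.find_min h hi)) (Nat.find_spec h)

/-- A point of `𝒯₋` outside `𝒯` is not in `𝒯₊`, so its image leaves in the past. The equation for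
`rev` at the image, with the push-forward of `ψ` as right side, reads `g - g ∘ F = ψ`, whence the
sign. -/
lemma exists_primitive {ρ : PhaseSpace d J} (hD : ρ ∈ F.D) (h : ρ ∉ F.trapped) :
    ∃ O, IsOpen O ∧ ρ ∈ O ∧ ∀ ψ, TestOn O ψ →
      ∃ g, TestOn (F.U \ F.trapped) g ∧ ∀ σ ∈ F.D, g (F.Φ σ) - g σ = ψ σ := by
  by_cases hm : ρ ∈ F.tailMinus
  · have hp : F.Φ ρ ∉ F.rev.tailMinus := by
      rw [tailMinus_rev]
      exact fun hp => h ⟨F.mem_tailPlus_of_map hD hp, hm⟩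
    obtain ⟨O', hO', hρO', hsol⟩ := F.rev.exists_primitive_of_notMem_tailMinus hp
    refine ⟨F.Φ.source ∩ F.Φ ⁻¹' O', F.Φ.isOpen_inter_preimage hO',
      ⟨F.D_subset_source hD, hρO'⟩, fun ψ hψ => ?_⟩
    obtain ⟨g, hg, hg'⟩ := hsol _ (F.testOn_push hψ inter_subset_left fun σ hσ => hσ.2)
    rw [trapped_rev, rev_U] at hg
    refine ⟨-g, hg.neg, fun σ hσ => ?_⟩
    have h1 := hg' (F.Φ σ) ⟨σ, hσ, rfl⟩
    rw [rev_Φ, F.Φ.left_inv (F.D_subset_source hσ), F.push_map ψ (F.D_subset_source hσ)] at h1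
    simp only [Pi.neg_apply]
    linarith
  · exact F.exists_primitive_of_notMem_tailMinus hm

lemma U_subset_cotY : F.U ⊆ F.cotY :=
  (subset_closure.trans F.U_compactlyIn.2).trans interior_subset

/-- Escape functions away from the trapped set. -/
theorem exists_isOuterEscape {W₂ W₃ : Set (PhaseSpace d J)} (h₂ : F.trapped ⊆ interior W₂)
    (h₃ : CompactlyIn W₃ F.D) : ∃ g₀, F.IsOuterEscape W₂ W₃ g₀ := by
  classical
  -- A nonnegative bump as right side makes each local solution nondecreasing along `F`, so finitely
  -- many can be added without cancellation. Their supports avoid `𝒯`, and so does that of the sum.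
  have hlocal : ∀ ρ ∈ closure W₃ \ interior W₂, ∃ O, IsOpen O ∧ ρ ∈ O ∧
      ∃ g, TestOn (F.U \ F.trapped) g ∧ (∀ σ ∈ F.D, 0 ≤ g (F.Φ σ) - g σ) ∧
        ∀ σ ∈ F.D, σ ∈ O → 1 ≤ g (F.Φ σ) - g σ := by
    rintro ρ ⟨hρ, hρ2⟩
    obtain ⟨O, hO, hρO, hsol⟩ := F.exists_primitive (interior_subset (h₃.2 hρ))
      fun hT => hρ2 (h₂ hT)
    obtain ⟨ψ, hψ, hψ0, hψ1⟩ := exists_testOn_one_le hO hρO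
    obtain ⟨g, hg, hg'⟩ := hsol ψ hψ
    obtain ⟨O₁, hO₁, hO₁o, hρO₁⟩ := eventually_nhds_iff.1 hψ1
    exact ⟨O₁, hO₁o, hρO₁, g, hg, fun σ hσ => (hg' σ hσ).symm ▸ hψ0 σ,
      fun σ hσ hσO => (hg' σ hσ).symm ▸ hO₁ σ hσO⟩
  choose! O hO hmem g hg hg0 hg1 using hlocal
  have hK : IsCompact (closure W₃ \ interior W₂) := h₃.1.diff isOpen_interior
  obtain ⟨t, htK, ht⟩ := hK.elim_nhds_subcover O fun ρ hρ => (hO ρ hρ).mem_nhds (hmem ρ hρ)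
  have hG : TestOn (F.U \ F.trapped) (∑ ρ ∈ t, g ρ) :=
    TestOn.sum t fun ρ hρ => hg ρ (htK ρ hρ)
  have hsum : ∀ σ, (∑ ρ ∈ t, g ρ) (F.Φ σ) - (∑ ρ ∈ t, g ρ) σ =
      ∑ ρ ∈ t, (g ρ (F.Φ σ) - g ρ σ) := by
    intro σ
    simp only [Finset.sum_apply, Finset.sum_sub_distrib]
  have hD3 : W₃ ⊆ F.D := (subset_closure.trans h₃.2).trans interior_subset
  refine ⟨∑ ρ ∈ t, g ρ, hG.mono (sdiff_subset.trans F.U_subset_cotY), ?_, fun σ hσ => ?_,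
    fun σ hσ => ?_⟩
  · have hsub : F.trapped ⊆ interior W₂ ∩ (tsupport (∑ ρ ∈ t, g ρ))ᶜ :=
      fun ρ hρ => ⟨h₂ hρ, fun h => (hG.2.2 h).2 hρ⟩
    obtain ⟨L, hL, hTL, hLs⟩ := exists_compact_between F.isCompact_trapped
      (isOpen_interior.inter (isClosed_tsupport _).isOpen_compl) hsub
    refine ⟨L, hTL, ⟨hL.isClosed.closure_eq.symm ▸ hL, ?_⟩, fun ρ hρ =>
      image_eq_zero_of_notMem_tsupport (hLs hρ).2⟩
    rw [hL.isClosed.closure_eq]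
    exact hLs.trans inter_subset_left
  · rw [hsum]
    exact Finset.sum_nonneg fun ρ hρ => hg0 ρ (htK ρ hρ) σ (hD3 hσ)
  · rw [hsum]
    obtain ⟨ρ, hρ, hσO⟩ := mem_iUnion₂.1 (ht ⟨subset_closure hσ.1, fun h => hσ.2 (interior_subset h)⟩)
    refine (hg1 ρ (htK ρ hρ) σ (hD3 hσ.1) hσO).trans ?_
    exact Finset.single_le_sum (f := fun ρ => g ρ (F.Φ σ) - g ρ σ)
      (fun ρ hρ => hg0 ρ (htK ρ hρ) σ (hD3 hσ.1)) hρ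

end OpenMap

/-! ### Estimates for logarithms -/

section LogEstimates

/-- A multiplicative gain of a positive quantity, on the logarithmic scale. -/
lemma log_sub_log_ge {X Y t : ℝ} (hX : 0 < X) (ht : -1 < t) (h : (1 + t) * X ≤ Y) :
    t / (1 + t) ≤ Real.log Y - Real.log X := by
  have h1 : 0 < 1 + t := by linarith
  have h2 : Real.log ((1 + t) * X) ≤ Real.log Y := Real.log_le_log (by positivity) h
  rw [Real.log_mul h1.ne' hX.ne'] at h2
  have h3 := Real.one_sub_inv_le_log_of_pos h1
  have h4 : 1 - (1 + t)⁻¹ = t / (1 + t) := by field_simp; ring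
  linarith

/-- Relative to `Mε + A`, the error `C₀ε` is at most `C₀/M ≤ 1/(32C)`. When `A ≥ Mε`, the gain `A/C`
is at least `(Mε + A)/(2C)` and prevails. The loss `2C₀/M ≤ 1/(16C)` is at most half of the gain
`1/(8C)`, so two such terms can be added. -/
lemma log_growth {C C₀ M ε A A' : ℝ} (hC : 1 ≤ C) (hC₀ : 0 < C₀) (hM : 32 * C * C₀ ≤ M)
    (hε : 0 < ε) (hA : ε ≤ A) (h : A / C ≤ A' - A + C₀ * ε) :
    -(2 * C₀ / M) ≤ Real.log (M * ε + A') - Real.log (M * ε + A) ∧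
    (M * ε ≤ A → 1 / (8 * C) ≤ Real.log (M * ε + A') - Real.log (M * ε + A)) := by
  have hCpos : 0 < C := by linarith
  have hM0 : 0 < M := by nlinarith [mul_pos hCpos hC₀]
  have hMC : 32 * C₀ ≤ M := by nlinarith
  have hX : 0 < M * ε + A := by nlinarith [mul_pos hM0 hε]
  have hq : C₀ / M ≤ 1 / 32 := by rw [div_le_div_iff₀ hM0 (by norm_num)]; linarith
  have hq0 : 0 < C₀ / M := by positivity
  have hqε : C₀ * ε ≤ C₀ / M * (M * ε + A) := by
    have : C₀ / M * (M * ε + A) = C₀ * ε + C₀ / M * A := by field_simp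
    rw [this]; nlinarith
  have hAC : 0 ≤ A / C := by apply div_nonneg <;> linarith
  constructor
  · have h1 := log_sub_log_ge (t := -(C₀ / M)) (Y := M * ε + A') hX (by linarith) (by linarith)
    refine le_trans ?_ h1
    rw [neg_div, neg_le_neg_iff, div_le_iff₀ (by linarith), mul_div_assoc]
    nlinarith
  · intro hMA
    have hq2 : C₀ / M ≤ 1 / (32 * C) := by
      rw [div_le_div_iff₀ hM0 (by positivity)]; linarith
    have h2 : 1 / (2 * C) * (M * ε + A) ≤ A / C := by
      rw [div_mul_eq_mul_div, div_le_div_iff₀ (by positivity) hCpos]; nlinarith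
    have h5 : C₀ / M * (M * ε + A) ≤ 1 / (32 * C) * (M * ε + A) := by gcongr
    have h6 : 1 / (2 * C) = 16 * (1 / (32 * C)) := by field_simp; norm_num
    have h7 : 1 / (4 * C) = 8 * (1 / (32 * C)) := by field_simp; norm_num
    have h8 : 0 < 1 / (32 * C) * (M * ε + A) := by positivity
    have h1 := log_sub_log_ge (t := 1 / (4 * C)) (Y := M * ε + A') hX
      (by have : 0 < 1 / (4 * C) := by positivity
          linarith) (by rw [h6] at h2; rw [h7]; nlinarith)
    refine le_trans ?_ h1
    have h9 : 1 / (4 * C) / (1 + 1 / (4 * C)) = 1 / (4 * C + 1) := by field_simp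
    rw [h9]
    apply one_div_le_one_div_of_le <;> linarith

/-- The same balance; but the reference is now the new value, so factors `1 ± s` must be inverted,
which `(1 - s)(1 + s) ≤ 1` does. -/
lemma log_decay {C C₀ M ε B B' : ℝ} (hC : 1 ≤ C) (hC₀ : 0 < C₀) (hM : 32 * C * C₀ ≤ M)
    (hε : 0 < ε) (hB : ε ≤ B) (hB' : ε ≤ B') (h : B / C ≤ B - B' + C₀ * ε) :
    -(2 * C₀ / M) ≤ Real.log (M * ε + B) - Real.log (M * ε + B') ∧
    (M * ε ≤ B → 1 / (8 * C) ≤ Real.log (M * ε + B) - Real.log (M * ε + B')) := by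
  have hCpos : 0 < C := by linarith
  have hM0 : 0 < M := by nlinarith [mul_pos hCpos hC₀]
  have hMC : 32 * C₀ ≤ M := by nlinarith
  have hX : 0 < M * ε + B := by nlinarith [mul_pos hM0 hε]
  have hY : 0 < M * ε + B' := by nlinarith [mul_pos hM0 hε]
  have hq : C₀ / M ≤ 1 / 32 := by rw [div_le_div_iff₀ hM0 (by norm_num)]; linarith
  have hq0 : 0 < C₀ / M := by positivity
  have hqε : C₀ * ε ≤ C₀ / M * (M * ε + B) := by
    have : C₀ / M * (M * ε + B) = C₀ * ε + C₀ / M * B := by field_simp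
    rw [this]; nlinarith
  have hBC : 0 ≤ B / C := by apply div_nonneg <;> linarith
  constructor
  · have h3 : (1 - C₀ / M) * (M * ε + B') ≤ M * ε + B := by
      have h4 : (1 - C₀ / M) * (M * ε + B') ≤ (1 - C₀ / M) * ((1 + C₀ / M) * (M * ε + B)) := by
        apply mul_le_mul_of_nonneg_left <;> linarith
      nlinarith [mul_nonneg (sq_nonneg (C₀ / M)) hX.le]
    have h1 := log_sub_log_ge (t := -(C₀ / M)) (Y := M * ε + B) hY (by linarith) (by linarith)
    refine le_trans ?_ h1
    rw [neg_div, neg_le_neg_iff, div_le_iff₀ (by linarith), mul_div_assoc]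
    nlinarith
  · intro hMB
    have hq2 : C₀ / M ≤ 1 / (32 * C) := by
      rw [div_le_div_iff₀ hM0 (by positivity)]; linarith
    have h2 : 1 / (2 * C) * (M * ε + B) ≤ B / C := by
      rw [div_mul_eq_mul_div, div_le_div_iff₀ (by positivity) hCpos]; nlinarith
    have h5 : C₀ / M * (M * ε + B) ≤ 1 / (32 * C) * (M * ε + B) := by gcongr
    have h6 : 1 / (2 * C) = 16 * (1 / (32 * C)) := by field_simp; norm_num
    have h7 : 1 / (4 * C) = 8 * (1 / (32 * C)) := by field_simp; norm_num
    have h8 : 0 < 1 / (32 * C) * (M * ε + B) := by positivity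
    have h9 : M * ε + B' ≤ (1 - 1 / (4 * C)) * (M * ε + B) := by
      rw [h6] at h2; rw [h7]; nlinarith
    have h10 : 1 / (4 * C) ≤ 1 / 4 := by
      apply one_div_le_one_div_of_le <;> linarith
    have h11 : 0 < 1 / (4 * C) := by positivity
    have h12 : (1 + 1 / (4 * C)) * (M * ε + B') ≤ M * ε + B := by
      have : (1 + 1 / (4 * C)) * (M * ε + B') ≤
          (1 + 1 / (4 * C)) * ((1 - 1 / (4 * C)) * (M * ε + B)) := by gcongr
      nlinarith [mul_nonneg (sq_nonneg (1 / (4 * C))) hX.le]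
    have h1 := log_sub_log_ge (t := 1 / (4 * C)) (Y := M * ε + B) hY (by linarith) h12
    refine le_trans ?_ h1
    have h9 : 1 / (4 * C) / (1 + 1 / (4 * C)) = 1 / (4 * C + 1) := by field_simp
    rw [h9]
    apply one_div_le_one_div_of_le <;> linarith

/-- One derivative already leaves room for a logarithm; this is why the derivative bounds carry no
factor `log(1/ε)`. -/
lemma log_inv_le {ε : ℝ} (hε : 0 < ε) (n : ℕ) (hn : 1 ≤ n) (h1 : ε < 1) :
    Real.log (1 / ε) ≤ 2 * ε ^ (-(n : ℝ) / 2) := by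
  have h2 := Real.log_le_rpow_div (x := 1 / ε) (by positivity) (show (0 : ℝ) < 1 / 2 by norm_num)
  have h3 : (1 / ε) ^ (1 / 2 : ℝ) = ε ^ (-1 / 2 : ℝ) := by
    rw [one_div, Real.inv_rpow hε.le, ← Real.rpow_neg hε.le]; norm_num
  have h4 : ε ^ (-1 / 2 : ℝ) ≤ ε ^ (-(n : ℝ) / 2) := by
    apply Real.rpow_le_rpow_of_exponent_ge hε h1.le
    have : (1 : ℝ) ≤ n := by exact_mod_cast hn
    linarith
  rw [h3] at h2
  linarith

/-- Since `log(1/ε) = log(δ²/ε) + 2 log(1/δ)` and `δ log(1/δ) ≤ 1`, a Lipschitz constant of size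
`log(1/ε)` is harmless at distances at most `1`. -/
lemma log_inv_mul_le {ε δ : ℝ} (hε : 0 < ε) (hδ : 0 ≤ δ) (hδ1 : δ ≤ 1) :
    Real.log (1 / ε) * δ ≤ Real.log (1 + δ ^ 2 / ε) + 2 := by
  rcases hδ.eq_or_lt with rfl | hδ0
  · simp
  have h0 : 1 / ε = δ ^ 2 / ε * δ⁻¹ ^ 2 := by field_simp
  have h1 : Real.log (1 / ε) = Real.log (δ ^ 2 / ε) + 2 * Real.log δ⁻¹ := by
    rw [h0, Real.log_mul (by positivity) (by positivity), Real.log_pow]; norm_num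
  have h2 : Real.log (δ ^ 2 / ε) ≤ Real.log (1 + δ ^ 2 / ε) :=
    Real.log_le_log (by positivity) (by linarith)
  have h3 : 0 ≤ Real.log (1 + δ ^ 2 / ε) := Real.log_nonneg (by
    have : 0 < δ ^ 2 / ε := by positivity
    linarith)
  have h4 : Real.log δ⁻¹ ≤ δ⁻¹ - 1 := Real.log_le_sub_one_of_pos (by positivity)
  have h5 : Real.log δ⁻¹ * δ ≤ 1 := by
    have : Real.log δ⁻¹ * δ ≤ (δ⁻¹ - 1) * δ := by gcongr
    have h6 : δ⁻¹ * δ = 1 := inv_mul_cancel₀ hδ0.ne'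
    nlinarith
  rw [h1]
  nlinarith

variable {E : Type*} [NormedAddCommGroup E] [NormedSpace ℝ E]

/-- The symbol estimates for the logarithm of a function satisfying symbol estimates. -/
lemma exists_norm_iteratedFDeriv_log_le (n : ℕ) (hn : 1 ≤ n) (K : ℕ → ℝ) :
    ∃ L, 0 ≤ L ∧ ∀ (s : Set E) (f : E → ℝ) (a : ℝ) (x : E), IsOpen s → ContDiffOn ℝ ∞ f s →
      (∀ y ∈ s, 0 < f y) → 0 ≤ a → x ∈ s →
      (∀ k : ℕ, ‖iteratedFDeriv ℝ k f x‖ ≤ K k * f x ^ (1 - (k : ℝ) / 2)) →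
      ‖iteratedFDeriv ℝ n (fun y => Real.log (a + f y)) x‖ ≤ L * f x ^ (-(n : ℝ) / 2) := by
  -- With `h = f x`, write `a + f = (a + h)(1 + f₁)` where `f₁ x = 0`. Only the derivatives of
  -- `log(1 + u)` at `u = 0` enter, so the constant depends neither on `f` nor on `a`.
  set t : Set ℝ := Ioi (-1)
  set Λ : ℝ → ℝ := fun u => Real.log (1 + u)
  set C : ℝ := ∑ i ∈ Finset.range (n + 1), ‖iteratedFDerivWithin ℝ i Λ t 0‖
  set K' : ℝ := 1 + ∑ k ∈ Finset.range (n + 1), |K k|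
  have hC0 : 0 ≤ C := Finset.sum_nonneg fun _ _ => norm_nonneg _
  have hK1 : 1 ≤ K' := by
    have : 0 ≤ ∑ k ∈ Finset.range (n + 1), |K k| := Finset.sum_nonneg fun _ _ => abs_nonneg _
    simp only [K']; linarith
  have hKk : ∀ k ≤ n, K k ≤ K' := by
    intro k hk
    have := Finset.single_le_sum (f := fun k => |K k|) (fun i _ => abs_nonneg (K i))
      (Finset.mem_range.2 (Nat.lt_succ_of_le hk))
    have h2 := le_abs_self (K k)
    simp only [K']; linarith
  have hΛ : ContDiffOn ℝ ∞ Λ t := by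
    refine ContDiffOn.log (by fun_prop) fun u hu => ?_
    have : -1 < u := hu
    have : 0 < 1 + u := by linarith
    exact this.ne'
  refine ⟨n.factorial * C * K' ^ n, by positivity, fun s f a x hs hf hpos ha hx hfK => ?_⟩
  set h : ℝ := f x
  have hh : 0 < h := hpos x hx
  have hah : 0 < a + h := by linarith
  set f₁ : E → ℝ := fun y => (a + h)⁻¹ • (f y - h)
  have hfx : ContDiffAt ℝ ∞ f x := hf.contDiffAt (hs.mem_nhds hx)
  have hf₁ : ContDiffOn ℝ ∞ f₁ s := (hf.sub contDiffOn_const).const_smul _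
  have hmap : MapsTo f₁ s t := by
    intro y hy
    have h1 := hpos y hy
    change -1 < (a + h)⁻¹ * (f y - h)
    rw [inv_mul_eq_div, lt_div_iff₀ hah]; linarith
  have hf₁x : f₁ x = 0 := by simp [f₁, h]
  have heq : ∀ y ∈ s, Real.log (a + f y) = Real.log (a + h) + (Λ ∘ f₁) y := by
    intro y hy
    have h1 : -1 < f₁ y := hmap hy
    have h2 : a + f y = (a + h) * (1 + f₁ y) := by
      simp only [f₁, smul_eq_mul]; field_simp; ring
    rw [h2, Real.log_mul hah.ne' (by linarith)]; rfl
  have hcomp : ContDiffOn ℝ ∞ (Λ ∘ f₁) s := hΛ.comp hf₁ hmap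
  have h1 : iteratedFDeriv ℝ n (fun y => Real.log (a + f y)) x =
      iteratedFDerivWithin ℝ n (Λ ∘ f₁) s x := by
    have h2 : (fun y => Real.log (a + f y)) =ᶠ[nhds x]
        (fun _ => Real.log (a + h)) + (Λ ∘ f₁) := by
      filter_upwards [hs.mem_nhds hx] with y hy using heq y hy
    rw [Filter.EventuallyEq.eq_of_nhds (Filter.EventuallyEq.iteratedFDeriv ℝ h2 n), iteratedFDerivWithin_of_isOpen n hs hx,
      iteratedFDeriv_add_apply contDiffAt_const
        ((hcomp.contDiffAt (hs.mem_nhds hx)).of_le (by exact_mod_cast le_top)),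
      iteratedFDeriv_const_of_ne (by omega)]
    simp
  have h3 : ∀ i, 1 ≤ i → i ≤ n →
      ‖iteratedFDerivWithin ℝ i f₁ s x‖ ≤ (K' * h ^ (-1 / 2 : ℝ)) ^ i := by
    intro i hi hin
    have h4 : iteratedFDeriv ℝ i f₁ x = (a + h)⁻¹ • iteratedFDeriv ℝ i f x := by
      have h5 : ContDiffAt ℝ i f x := hfx.of_le (by exact_mod_cast le_top)
      have h6 : iteratedFDeriv ℝ i (fun y => f y - h) x = iteratedFDeriv ℝ i f x := by
        rw [fun_iteratedFDeriv_sub_apply h5 contDiffAt_const, iteratedFDeriv_const_of_ne (by omega)]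
        simp
      rw [← h6]
      exact iteratedFDeriv_const_smul_apply' (h5.sub contDiffAt_const)
    have h7 : h ^ (1 - (i : ℝ) / 2) = h * h ^ (-(i : ℝ) / 2) := by
      nth_rewrite 2 [← Real.rpow_one h]
      rw [← Real.rpow_add hh]
      congr 1; ring
    have h8 : (h ^ (-1 / 2 : ℝ)) ^ i = h ^ (-(i : ℝ) / 2) := by
      rw [← Real.rpow_mul_natCast hh.le]; congr 1; ring
    rw [iteratedFDerivWithin_of_isOpen i hs hx, h4, norm_smul, norm_inv, Real.norm_of_nonneg hah.le,
      mul_pow, h8]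
    calc (a + h)⁻¹ * ‖iteratedFDeriv ℝ i f x‖
        ≤ (a + h)⁻¹ * (K' * h ^ (1 - (i : ℝ) / 2)) := by
          gcongr
          exact (hfK i).trans (by gcongr; exact hKk i hin)
      _ = ((a + h)⁻¹ * h) * (K' * h ^ (-(i : ℝ) / 2)) := by rw [h7]; ring
      _ ≤ 1 * (K' * h ^ (-(i : ℝ) / 2)) := by
          gcongr
          rw [inv_mul_eq_div, div_le_one hah]; linarith
      _ ≤ K' ^ i * h ^ (-(i : ℝ) / 2) := by
          rw [one_mul]; gcongr
          exact le_self_pow₀ hK1 (by omega)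
  rw [h1]
  have h4 := norm_iteratedFDerivWithin_comp_le hΛ hf₁ (n := n) (by exact_mod_cast le_top)
    (isOpen_Ioi.uniqueDiffOn) hs.uniqueDiffOn hmap hx (C := C) (D := K' * h ^ (-1 / 2 : ℝ))
    (fun i hi => by
      rw [hf₁x]
      exact Finset.single_le_sum (f := fun i => ‖iteratedFDerivWithin ℝ i Λ t 0‖)
        (fun _ _ => norm_nonneg _) (Finset.mem_range.2 (Nat.lt_succ_of_le hi))) h3
  refine h4.trans (le_of_eq ?_)
  rw [mul_pow, ← Real.rpow_mul_natCast hh.le, ← mul_assoc]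
  congr 2; ring

end LogEstimates

/-! ### Bounds for test functions, products and comparable logarithms -/

section TestBounds

variable {d J : ℕ}

lemma TestOn.hasCompactSupport_slice {O : Set (PhaseSpace d J)} {g : PhaseSpace d J → ℝ}
    (hg : TestOn O g) (j : Fin J) : HasCompactSupport fun x : CotSpace d => g (j, x) :=
  hg.2.1.comp_isClosedEmbedding (isometry_mk j).isClosedEmbedding

lemma TestOn.contDiff_slice {O : Set (PhaseSpace d J)} {g : PhaseSpace d J → ℝ}
    (hg : TestOn O g) (j : Fin J) : ContDiff ℝ ∞ fun x : CotSpace d => g (j, x) := by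
  rw [← contDiffOn_univ]
  exact hg.1 j

lemma TestOn.exists_derivNorm_le {O : Set (PhaseSpace d J)} {g : PhaseSpace d J → ℝ}
    (hg : TestOn O g) (n : ℕ) : ∃ X, 0 ≤ X ∧ ∀ ρ, derivNorm n g ρ ≤ X := by
  have h : ∀ j : Fin J, ∃ X, ∀ x : CotSpace d,
      ‖iteratedFDeriv ℝ n (fun x : CotSpace d => g (j, x)) x‖ ≤ X := fun j =>
    ((hg.contDiff_slice j).continuous_iteratedFDeriv
      (by exact_mod_cast le_top)).bounded_above_of_compact_support
      ((hg.hasCompactSupport_slice j).iteratedFDeriv n)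
  choose X hX using h
  refine ⟨∑ j, |X j|, Finset.sum_nonneg fun _ _ => abs_nonneg _, fun ρ => (hX ρ.1 ρ.2).trans ?_⟩
  exact (le_abs_self _).trans
    (Finset.single_le_sum (f := fun j => |X j|) (fun j _ => abs_nonneg (X j)) (Finset.mem_univ ρ.1))

lemma TestOn.exists_abs_le {O : Set (PhaseSpace d J)} {g : PhaseSpace d J → ℝ}
    (hg : TestOn O g) : ∃ X, 0 ≤ X ∧ ∀ ρ, |g ρ| ≤ X := by
  obtain ⟨X, hX0, hX⟩ := hg.exists_derivNorm_le 0
  exact ⟨X, hX0, fun ρ => by simpa [derivNorm, norm_iteratedFDeriv_zero] using hX ρ⟩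

lemma TestOn.exists_lipschitz {O : Set (PhaseSpace d J)} {g : PhaseSpace d J → ℝ}
    (hg : TestOn O g) :
    ∃ X, 0 ≤ X ∧ ∀ ρ μ : PhaseSpace d J, dist ρ μ < 1 → |g ρ - g μ| ≤ X * dist ρ μ := by
  obtain ⟨X, hX0, hX⟩ := hg.exists_derivNorm_le 1
  refine ⟨X, hX0, ?_⟩
  rintro ⟨j, x⟩ ⟨k, y⟩ h
  obtain rfl : j = k := fst_eq_of_dist_lt_one h
  rw [phase_dist_mk, dist_eq_norm, ← Real.norm_eq_abs]
  refine Convex.norm_image_sub_le_of_norm_fderiv_le (𝕜 := ℝ) (s := univ)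
    (f := fun x : CotSpace d => g (j, x))
    (fun z _ => ((hg.contDiff_slice j).differentiable (by simp)).differentiableAt) (fun z _ => ?_)
    convex_univ (mem_univ y) (mem_univ x)
  rw [← norm_iteratedFDeriv_one]
  exact hX (j, z)

end TestBounds

section Products

variable {E : Type*} [NormedAddCommGroup E] [NormedSpace ℝ E]

lemma norm_iteratedFDeriv_mul_le_of_bounds {n : ℕ} {X A : ℝ} {s : Set E} {f g : E → ℝ} {x : E}
    (hX : 0 ≤ X) (hs : IsOpen s) (hx : x ∈ s) (hf : ContDiffOn ℝ ∞ f s) (hg : ContDiffOn ℝ ∞ g s)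
    (h1 : ∀ i ≤ n, ‖iteratedFDeriv ℝ i f x‖ ≤ X) (h2 : ∀ i ≤ n, ‖iteratedFDeriv ℝ i g x‖ ≤ A) :
    ‖iteratedFDeriv ℝ n (fun y => f y * g y) x‖ ≤ 2 ^ n * X * A := by
  have h3 := norm_iteratedFDerivWithin_mul_le hf hg hs.uniqueDiffOn hx (n := n)
    (by exact_mod_cast le_top)
  simp only [iteratedFDerivWithin_of_isOpen _ hs hx] at h3
  refine h3.trans ?_
  calc ∑ i ∈ Finset.range (n + 1), (n.choose i : ℝ) * ‖iteratedFDeriv ℝ i f x‖ *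
        ‖iteratedFDeriv ℝ (n - i) g x‖
      ≤ ∑ i ∈ Finset.range (n + 1), (n.choose i : ℝ) * X * A := by
        refine Finset.sum_le_sum fun i hi => ?_
        have h4 := h1 i (Nat.lt_succ_iff.1 (Finset.mem_range.1 hi))
        have h5 := h2 (n - i) (Nat.sub_le _ _)
        gcongr
    _ = 2 ^ n * X * A := by
        rw [← Finset.sum_mul, ← Finset.sum_mul]
        congr 2
        exact_mod_cast Nat.sum_range_choose n

lemma abs_log_add_le {M ε P t : ℝ} (hM : 0 ≤ M) (hε : 0 < ε) (hε1 : ε ≤ 1) (ht : ε ≤ t)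
    (htP : t ≤ P) : |Real.log (M * ε + t)| ≤ Real.log (1 / ε) + Real.log (M + P + 1) := by
  have h1 : 0 ≤ M * ε := by positivity
  have h2 : M * ε ≤ M := mul_le_of_le_one_right hM hε1
  have h3 : Real.log (M * ε + t) ≤ Real.log (M + P + 1) :=
    Real.log_le_log (by linarith) (by linarith)
  have h4 : Real.log ε ≤ Real.log (M * ε + t) := Real.log_le_log hε (by linarith)
  have h5 : 0 ≤ Real.log (M + P + 1) := Real.log_nonneg (by linarith)
  have h6 : Real.log (1 / ε) = -Real.log ε := by rw [one_div, Real.log_inv]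
  have h7 : Real.log ε ≤ 0 := Real.log_nonpos hε.le hε1
  rw [abs_le]
  constructor <;> linarith

/-- As `t ≥ ε`, one has `δ² ≤ (a + t) δ²/ε`, so an additive error `δ²` becomes the factor `1 +
δ²/ε`. -/
lemma log_add_le_of_comparable {a ε δ s t Q : ℝ} (ha : 0 ≤ a) (hε : 0 < ε) (hs : 0 < s)
    (ht : ε ≤ t) (hQ : 1 ≤ Q) (h : s ≤ Q * (t + δ ^ 2)) :
    Real.log (a + s) - Real.log (a + t) ≤ Real.log Q + Real.log (1 + δ ^ 2 / ε) := by
  have h0 : 0 ≤ δ ^ 2 / ε := by positivity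
  have h1 : δ ^ 2 ≤ (a + t) * (δ ^ 2 / ε) := by
    have : ε * (δ ^ 2 / ε) ≤ (a + t) * (δ ^ 2 / ε) := by gcongr; linarith
    rwa [mul_div_cancel₀ _ hε.ne'] at this
  have h2 : a + s ≤ Q * ((a + t) * (1 + δ ^ 2 / ε)) := by
    have : a + s ≤ Q * (a + t + δ ^ 2) := by nlinarith
    refine this.trans ?_
    gcongr; linarith
  have h3 := Real.log_le_log (by linarith) h2
  have h4 : 0 < a + t := by linarith
  rw [Real.log_mul (by linarith) (by positivity), Real.log_mul h4.ne' (by positivity)] at h3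
  linarith

end Products

/-! ### The inner escape function -/

namespace OpenMap

variable {d J : ℕ} {F : OpenMap d J} {V : Set (PhaseSpace d J)} {ε₀ : ℝ}
  {φp φm : ℝ → PhaseSpace d J → ℝ}

lemma IsRegularizedPair.isOpen_enlarge (h : F.IsRegularizedPair V ε₀ φp φm) :
    IsOpen (F.enlarge V) :=
  h.1.union (F.Φ.isOpen_image_of_subset_source h.1
    (((subset_closure.trans h.2.2.1.2).trans interior_subset).trans F.D_subset_source))

lemma IsRegularizedPair.enlarge_subset_U (h : F.IsRegularizedPair V ε₀ φp φm) :
    F.enlarge V ⊆ F.U := by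
  have hVD : V ⊆ F.D := (subset_closure.trans h.2.2.1.2).trans interior_subset
  exact union_subset (hVD.trans F.D_subset_U) ((image_mono hVD).trans F.image_subset_U)

/-- Where `d(ρ, 𝒯)²` is large compared with `ε`, the sum `φ₊ + φ₋` is at least `2Mε`, so one of the
two is at least `Mε`. Its logarithm moves in the right direction by `1/(8C)`, and the other one
moves back by at most `1/(16C)`. -/
lemma IsRegularizedPair.exists_gain (h : F.IsRegularizedPair V ε₀ φp φm) :
    ∃ M₀ > 0, ∀ M ≥ M₀, ∃ C₁ > 0, ∃ C₇ > 0, ∀ ε, 0 < ε → ε < ε₀ → ∀ ρ ∈ V,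
      -C₇ ≤ innerEscape φp φm M ε (F.Φ ρ) - innerEscape φp φm M ε ρ ∧
      (C₁ * ε ≤ distTo ρ F.trapped ^ 2 →
        1 / C₁ ≤ innerEscape φp φm M ε (F.Φ ρ) - innerEscape φp φm M ε ρ) := by
  obtain ⟨_, _, _, _, _, C₀, C, K, hC₀, hC, H⟩ := h
  have hCpos : 0 < C := by linarith
  refine ⟨32 * C * C₀, by positivity, fun M hM => ?_⟩
  have hM0 : 0 < M := lt_of_lt_of_le (by positivity) hM
  -- In `C₁`, the term `2CM` makes the sum at least `2Mε` and `16C` ensures `1/C₁ ≤ 1/(16C)`; both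
  -- losses together are `C₇ = 4C₀/M`.
  refine ⟨2 * C * M + 16 * C, by positivity, 4 * C₀ / M, by positivity, fun ε hε hε' ρ hρ => ?_⟩
  obtain ⟨_, _, H1, H2⟩ := H ε hε hε'
  obtain ⟨p1, m1, _, _, _, _, t1, _, _⟩ := H1 ρ (Or.inl hρ)
  obtain ⟨p1', m1', _⟩ := H1 (F.Φ ρ) (Or.inr ⟨ρ, hρ, rfl⟩)
  obtain ⟨g1, _, g2, _⟩ := H2 ρ hρ
  have a := log_growth hC hC₀ hM hε m1 (A' := φm ε (F.Φ ρ)) (by linarith)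
  have b := log_decay hC hC₀ hM hε p1 p1' g1
  have h4 : 4 * C₀ / M = 2 * C₀ / M + 2 * C₀ / M := by ring
  simp only [innerEscape]
  refine ⟨by linarith [a.1, b.1], fun hd => ?_⟩
  have hq : 2 * C₀ / M ≤ 1 / (16 * C) := by
    rw [div_le_div_iff₀ hM0 (by positivity)]; linarith
  have h8 : 1 / (8 * C) = 1 / (16 * C) + 1 / (16 * C) := by field_simp; norm_num
  have h1 : 1 / (2 * C * M + 16 * C) ≤ 1 / (16 * C) := by
    apply one_div_le_one_div_of_le (by positivity)
    have : 0 < 2 * C * M := by positivity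
    linarith
  have hsum : 2 * (M * ε) ≤ φp ε ρ + φm ε ρ := by
    refine le_trans ?_ t1
    rw [le_div_iff₀ hCpos]
    nlinarith [mul_pos hCpos hε]
  rcases le_total (M * ε) (φm ε ρ) with hm | hm
  · linarith [a.2 hm, b.1]
  · linarith [a.1, b.2 (by linarith)]

lemma IsRegularizedPair.exists_abs_innerEscape_le (h : F.IsRegularizedPair V ε₀ φp φm)
    (hne : F.trapped.Nonempty) {M : ℝ} (hM : 0 ≤ M) :
    ∃ B, 0 ≤ B ∧ ∀ ε, 0 < ε → ε < ε₀ → ∀ ρ ∈ F.enlarge V,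
      |innerEscape φp φm M ε ρ| ≤ B * Real.log (1 / ε) := by
  have hU := h.enlarge_subset_U
  obtain ⟨_, _, _, hε₀, hε₁, C₀, C, K, hC₀, hC, H⟩ := h
  obtain ⟨x₀, hx₀⟩ := hne
  obtain ⟨R, hR⟩ := (F.U_compactlyIn.1.isBounded.subset (hU.trans subset_closure)).subset_closedBall
    x₀
  set P : ℝ := C * (R ^ 2 + 1)
  have hlog0 : 0 < Real.log (1 / ε₀) := Real.log_pos (by rw [lt_div_iff₀ hε₀]; linarith)
  have hP0 : 0 ≤ P := by have := sq_nonneg R; simp only [P]; positivity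
  have hL0 : 0 ≤ Real.log (M + P + 1) := Real.log_nonneg (by linarith)
  -- Because `ε < ε₀ < 1`, `log(1/ε)` is bounded below by `log(1/ε₀) > 0` and absorbs constants.
  refine ⟨2 * (1 + Real.log (M + P + 1) / Real.log (1 / ε₀)), by positivity,
    fun ε hε hε' ρ hρ => ?_⟩
  have hεlog : Real.log (1 / ε₀) ≤ Real.log (1 / ε) := by
    apply Real.log_le_log (by positivity)
    exact one_div_le_one_div_of_le hε hε'.le
  have hmul : Real.log (M + P + 1) ≤
      Real.log (M + P + 1) / Real.log (1 / ε₀) * Real.log (1 / ε) := by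
    rw [div_mul_eq_mul_div, le_div_iff₀ hlog0]; gcongr
  obtain ⟨p1, m1, _, p2, _, m2, _⟩ := (H ε hε hε').2.2.1 ρ hρ
  have hdist : ∀ A : Set (PhaseSpace d J), x₀ ∈ A → C * (distTo ρ A ^ 2 + ε) ≤ P := by
    intro A hA
    have h1 : Metric.infDist ρ A ≤ R :=
      (Metric.infDist_le_dist_of_mem hA).trans (Metric.mem_closedBall.1 (hR hρ))
    have h2 : 0 ≤ Metric.infDist ρ A := Metric.infDist_nonneg
    simp only [P, distTo_eq_infDist]
    gcongr; linarith
  have hp := abs_log_add_le hM hε (by linarith) p1 (p2.trans (hdist _ hx₀.1))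
  have hm := abs_log_add_le hM hε (by linarith) m1 (m2.trans (hdist _ hx₀.2))
  have := abs_sub (Real.log (M * ε + φm ε ρ)) (Real.log (M * ε + φp ε ρ))
  simp only [innerEscape]
  linarith

lemma IsRegularizedPair.contDiffOn_innerEscape (h : F.IsRegularizedPair V ε₀ φp φm) {M : ℝ}
    (hM : 0 ≤ M) {ε : ℝ} (hε : 0 < ε) (hε' : ε < ε₀) :
    SmoothOn (innerEscape φp φm M ε) (F.enlarge V) := by
  obtain ⟨_, _, _, hε₀, hε₁, C₀, C, K, hC₀, hC, H⟩ := h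
  obtain ⟨sp, sm, H1, _⟩ := H ε hε hε'
  have hMε : 0 ≤ M * ε := by positivity
  intro j
  refine ContDiffOn.sub ?_ ?_
  · refine (contDiffOn_const.add (sm j)).log fun x hx => ?_
    have := (H1 (j, x) hx).2.1
    exact ne_of_gt (by linarith)
  · refine (contDiffOn_const.add (sp j)).log fun x hx => ?_
    have := (H1 (j, x) hx).1
    exact ne_of_gt (by linarith)

lemma IsRegularizedPair.exists_derivNorm_innerEscape_le (h : F.IsRegularizedPair V ε₀ φp φm)
    {M : ℝ} (hM : 0 ≤ M) (n : ℕ) (hn : 1 ≤ n) :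
    ∃ A, 0 ≤ A ∧ ∀ ε, 0 < ε → ε < ε₀ → ∀ ρ ∈ F.enlarge V,
      derivNorm n (innerEscape φp φm M ε) ρ ≤ A * ε ^ (-(n : ℝ) / 2) := by
  have hV' := h.isOpen_enlarge
  obtain ⟨_, _, _, hε₀, hε₁, C₀, C, K, hC₀, hC, H⟩ := h
  obtain ⟨L, hL0, hL⟩ := exists_norm_iteratedFDeriv_log_le (E := CotSpace d) n hn K
  refine ⟨2 * L, by positivity, fun ε hε hε' ρ hρ => ?_⟩
  obtain ⟨sp, sm, H1, _⟩ := H ε hε hε'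
  have hMε : 0 ≤ M * ε := by positivity
  have hs : IsOpen {x : CotSpace d | (ρ.1, x) ∈ F.enlarge V} := hV'.preimage (by fun_prop)
  have hterm : ∀ φ : PhaseSpace d J → ℝ, SmoothOn φ (F.enlarge V) →
      (∀ μ ∈ F.enlarge V, ε ≤ φ μ) →
      (∀ k : ℕ, derivNorm k φ ρ ≤ K k * φ ρ ^ (1 - (k : ℝ) / 2)) →
      ContDiffAt ℝ n (fun x : CotSpace d => Real.log (M * ε + φ (ρ.1, x))) ρ.2 ∧
      ‖iteratedFDeriv ℝ n (fun x : CotSpace d => Real.log (M * ε + φ (ρ.1, x))) ρ.2‖ ≤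
        L * ε ^ (-(n : ℝ) / 2) := by
    intro φ hφ hφε hφK
    constructor
    · refine ContDiffAt.log ?_ ?_
      · exact contDiffAt_const.add (((hφ ρ.1).contDiffAt (hs.mem_nhds hρ)).of_le
          (by exact_mod_cast le_top))
      · have := hφε ρ hρ
        exact ne_of_gt (show 0 < M * ε + φ ρ by linarith)
    · refine (hL _ (fun x => φ (ρ.1, x)) (M * ε) ρ.2 hs (hφ ρ.1)
        (fun y hy => hε.trans_le (hφε _ hy)) hMε hρ hφK).trans ?_
      refine mul_le_mul_of_nonneg_left ?_ hL0
      refine Real.rpow_le_rpow_of_nonpos hε (hφε ρ hρ) ?_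
      have : (0 : ℝ) ≤ n := n.cast_nonneg
      linarith
  obtain ⟨cp, bp⟩ := hterm (φp ε) sp (fun μ hμ => (H1 μ hμ).1)
    fun k => ((H1 ρ hρ).2.2.2.2.2.2.2.2 k).1
  obtain ⟨cm, bm⟩ := hterm (φm ε) sm (fun μ hμ => (H1 μ hμ).2.1)
    fun k => ((H1 ρ hρ).2.2.2.2.2.2.2.2 k).2
  simp only [derivNorm, innerEscape]
  rw [fun_iteratedFDeriv_sub_apply cm cp]
  refine (norm_sub_le _ _).trans ?_
  linarith

/-- The escape function varies slowly at the scale `√ε`. -/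
lemma IsRegularizedPair.exists_abs_innerEscape_sub_le (h : F.IsRegularizedPair V ε₀ φp φm)
    (hne : F.trapped.Nonempty) {M : ℝ} (hM : 0 ≤ M) :
    ∃ B, 0 ≤ B ∧ ∀ ε, 0 < ε → ε < ε₀ → ∀ ρ ∈ F.enlarge V, ∀ μ ∈ F.enlarge V,
      |innerEscape φp φm M ε ρ - innerEscape φp φm M ε μ| ≤
        B + 2 * Real.log (1 + dist ρ μ ^ 2 / ε) := by
  obtain ⟨_, _, _, hε₀, hε₁, C₀, C, K, hC₀, hC, H⟩ := h
  have hQ : 1 ≤ 2 * C ^ 2 := by nlinarith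
  refine ⟨2 * Real.log (2 * C ^ 2), by have := Real.log_nonneg hQ; positivity,
    fun ε hε hε' => ?_⟩
  obtain ⟨_, _, H1, _⟩ := H ε hε hε'
  have hMε : 0 ≤ M * ε := by positivity
  -- The distance to a set is `1`-Lipschitz, so `φ(ρ) ≤ 2C²(φ(μ) + d(ρ, μ)²)`.
  have hterm : ∀ φ : PhaseSpace d J → ℝ, ∀ A : Set (PhaseSpace d J), A.Nonempty →
      (∀ μ ∈ F.enlarge V, ε ≤ φ μ ∧ (distTo μ A ^ 2 + ε) / C ≤ φ μ ∧
        φ μ ≤ C * (distTo μ A ^ 2 + ε)) →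
      ∀ ρ ∈ F.enlarge V, ∀ μ ∈ F.enlarge V,
        Real.log (M * ε + φ ρ) - Real.log (M * ε + φ μ) ≤
          Real.log (2 * C ^ 2) + Real.log (1 + dist ρ μ ^ 2 / ε) := by
    intro φ A hA hφ ρ hρ μ hμ
    obtain ⟨a1, _, a3⟩ := hφ ρ hρ
    obtain ⟨b1, b2, _⟩ := hφ μ hμ
    refine log_add_le_of_comparable hMε hε (hε.trans_le a1) b1 hQ ?_
    rw [distTo_eq_infDist] at a3 b2
    have h1 : Metric.infDist ρ A ≤ Metric.infDist μ A + dist ρ μ :=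
      Metric.infDist_le_infDist_add_dist
    have h2 : 0 ≤ Metric.infDist ρ A := Metric.infDist_nonneg
    have h3 : 0 ≤ Metric.infDist μ A := Metric.infDist_nonneg
    have h4 : 0 ≤ dist ρ μ := dist_nonneg
    rw [div_le_iff₀ (by linarith)] at b2
    have h5 : Metric.infDist ρ A ^ 2 ≤ 2 * Metric.infDist μ A ^ 2 + 2 * dist ρ μ ^ 2 := by
      nlinarith [sq_nonneg (Metric.infDist μ A - dist ρ μ)]
    have h6 : Metric.infDist ρ A ^ 2 + ε ≤ 2 * (φ μ * C) + 2 * dist ρ μ ^ 2 := by linarith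
    calc φ ρ ≤ C * (2 * (φ μ * C) + 2 * dist ρ μ ^ 2) := a3.trans (by gcongr)
      _ ≤ 2 * C ^ 2 * (φ μ + dist ρ μ ^ 2) := by
        nlinarith [mul_nonneg (mul_nonneg (show (0 : ℝ) ≤ C by linarith)
          (show (0 : ℝ) ≤ C - 1 by linarith)) (sq_nonneg (dist ρ μ))]
  have hp := hterm (φp ε) F.tailPlus (hne.mono fun _ h => h.1) fun μ hμ =>
    ⟨(H1 μ hμ).1, (H1 μ hμ).2.2.1, (H1 μ hμ).2.2.2.1⟩
  have hm := hterm (φm ε) F.tailMinus (hne.mono fun _ h => h.2) fun μ hμ =>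
    ⟨(H1 μ hμ).2.1, (H1 μ hμ).2.2.2.2.1, (H1 μ hμ).2.2.2.2.2.1⟩
  intro ρ hρ μ hμ
  have p1 := hp ρ hρ μ hμ
  have p2 := hp μ hμ ρ hρ
  have m1 := hm ρ hρ μ hμ
  have m2 := hm μ hμ ρ hρ
  rw [dist_comm μ ρ] at p2 m2
  simp only [innerEscape]
  rw [abs_le]
  constructor <;> linarith

end OpenMap

/-! ### The cut-off inner escape function -/

namespace OpenMap

variable {d J : ℕ} {F : OpenMap d J} {V : Set (PhaseSpace d J)} {ε₀ : ℝ}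
  {φp φm : ℝ → PhaseSpace d J → ℝ} {χ : PhaseSpace d J → ℝ} {M : ℝ}

lemma IsRegularizedPair.testOn_cutoff_mul (h : F.IsRegularizedPair V ε₀ φp φm)
    (hχ : TestOn (F.enlarge V) χ) (hM : 0 ≤ M) {ε : ℝ} (hε : 0 < ε) (hε' : ε < ε₀) :
    TestOn (F.enlarge V) fun ρ => χ ρ * innerEscape φp φm M ε ρ := by
  refine ⟨smoothOn_univ_iff.2 fun ρ => ?_, hχ.2.1.mul_right,
    (tsupport_mul_subset_left (f := χ)).trans hχ.2.2⟩
  by_cases hρ : ρ ∈ F.enlarge V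
  · have hs : IsOpen {x : CotSpace d | (ρ.1, x) ∈ F.enlarge V} :=
      h.isOpen_enlarge.preimage (by fun_prop)
    exact (smoothOn_univ_iff.1 hχ.1 ρ).mul
      ((h.contDiffOn_innerEscape hM hε hε' ρ.1).contDiffAt (hs.mem_nhds hρ))
  · refine contDiffAt_slice_of_eventuallyEq (φ := 0)
      (ψ := fun ρ => χ ρ * innerEscape φp φm M ε ρ) contDiffAt_const ?_
    filter_upwards [(isClosed_tsupport χ).isOpen_compl.mem_nhds fun h1 => hρ (hχ.2.2 h1)] with σ hσ
    simp [image_eq_zero_of_notMem_tsupport hσ]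

lemma IsRegularizedPair.exists_abs_cutoff_mul_le (h : F.IsRegularizedPair V ε₀ φp φm)
    (hne : F.trapped.Nonempty) (hχ : TestOn (F.enlarge V) χ) (hM : 0 ≤ M) :
    ∃ B, 0 ≤ B ∧ ∀ ε, 0 < ε → ε < ε₀ → ∀ ρ,
      |χ ρ * innerEscape φp φm M ε ρ| ≤ B * Real.log (1 / ε) := by
  obtain ⟨X, hX0, hX⟩ := hχ.exists_abs_le
  obtain ⟨B, hB0, hB⟩ := h.exists_abs_innerEscape_le hne hM
  have hε₁ := h.2.2.2.2.1
  refine ⟨X * B, by positivity, fun ε hε hε' ρ => ?_⟩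
  have hlog : 0 ≤ Real.log (1 / ε) := Real.log_nonneg (by rw [le_div_iff₀ hε]; linarith)
  by_cases hρ : ρ ∈ F.enlarge V
  · rw [abs_mul, mul_assoc]
    exact mul_le_mul (hX ρ) (hB ε hε hε' ρ hρ) (abs_nonneg _) hX0
  · rw [hχ.eq_zero hρ, zero_mul, abs_zero]
    positivity

lemma IsRegularizedPair.exists_derivNorm_cutoff_mul_le (h : F.IsRegularizedPair V ε₀ φp φm)
    (hne : F.trapped.Nonempty) (hχ : TestOn (F.enlarge V) χ) (hM : 0 ≤ M) (n : ℕ) (hn : 1 ≤ n) :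
    ∃ A, 0 ≤ A ∧ ∀ ε, 0 < ε → ε < ε₀ → ∀ ρ,
      derivNorm n (fun ρ => χ ρ * innerEscape φp φm M ε ρ) ρ ≤ A * ε ^ (-(n : ℝ) / 2) := by
  have hXs := fun i => hχ.exists_derivNorm_le i
  choose X hX0 hX using hXs
  obtain ⟨B, hB0, hB⟩ := h.exists_abs_innerEscape_le hne hM
  have hAs : ∀ k, ∃ A, 0 ≤ A ∧ ∀ ε, 0 < ε → ε < ε₀ → ∀ ρ ∈ F.enlarge V, k ≤ n →
      derivNorm k (innerEscape φp φm M ε) ρ ≤ A * ε ^ (-(n : ℝ) / 2) := by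
    intro k
    rcases Nat.eq_zero_or_pos k with rfl | hk
    -- The term of the Leibniz formula with no derivative on the inner function carries a logarithm,
    -- which is absorbed because `n ≥ 1`.
    · refine ⟨2 * B, by positivity, fun ε hε hε' ρ hρ _ => ?_⟩
      have h1 := hB ε hε hε' ρ hρ
      have h2 := log_inv_le hε n hn (hε'.trans h.2.2.2.2.1)
      rw [derivNorm, norm_iteratedFDeriv_zero, Real.norm_eq_abs]
      nlinarith [mul_le_mul_of_nonneg_left h2 hB0]
    · obtain ⟨A, hA0, hA⟩ := h.exists_derivNorm_innerEscape_le hM k hk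
      refine ⟨A, hA0, fun ε hε hε' ρ hρ hkn => (hA ε hε hε' ρ hρ).trans ?_⟩
      refine mul_le_mul_of_nonneg_left ?_ hA0
      apply Real.rpow_le_rpow_of_exponent_ge hε (hε'.trans h.2.2.2.2.1).le
      have : (k : ℝ) ≤ n := by exact_mod_cast hkn
      linarith
  choose A hA0 hA using hAs
  set SX : ℝ := ∑ i ∈ Finset.range (n + 1), X i
  set SA : ℝ := ∑ i ∈ Finset.range (n + 1), A i
  have hSX0 : 0 ≤ SX := Finset.sum_nonneg fun i _ => hX0 i
  have hSA0 : 0 ≤ SA := Finset.sum_nonneg fun i _ => hA0 i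
  have hleX : ∀ i ≤ n, X i ≤ SX := fun i hi =>
    Finset.single_le_sum (fun i _ => hX0 i) (Finset.mem_range.2 (Nat.lt_succ_of_le hi))
  have hleA : ∀ i ≤ n, A i ≤ SA := fun i hi =>
    Finset.single_le_sum (fun i _ => hA0 i) (Finset.mem_range.2 (Nat.lt_succ_of_le hi))
  refine ⟨2 ^ n * SX * SA, by positivity, fun ε hε hε' ρ => ?_⟩
  have hP : 0 ≤ ε ^ (-(n : ℝ) / 2) := Real.rpow_nonneg hε.le _
  by_cases hρ : ρ ∈ F.enlarge V
  · have hs : IsOpen {x : CotSpace d | (ρ.1, x) ∈ F.enlarge V} :=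
      h.isOpen_enlarge.preimage (by fun_prop)
    have := norm_iteratedFDeriv_mul_le_of_bounds (n := n) (X := SX)
      (A := SA * ε ^ (-(n : ℝ) / 2)) (f := fun x : CotSpace d => χ (ρ.1, x))
      (g := fun x : CotSpace d => innerEscape φp φm M ε (ρ.1, x)) (x := ρ.2) hSX0 hs hρ
      (hχ.contDiff_slice ρ.1).contDiffOn (h.contDiffOn_innerEscape hM hε hε' ρ.1)
      (fun i hi => (hX i ρ).trans (hleX i hi)) fun i hi => (hA i ε hε hε' ρ hρ hi).trans (by
        have := hleA i hi
        gcongr)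
    rw [← mul_assoc] at this
    exact this
  · have h1 : ∀ᶠ σ in nhds ρ, χ σ * innerEscape φp φm M ε σ = 0 := by
      filter_upwards [(isClosed_tsupport χ).isOpen_compl.mem_nhds fun h1 => hρ (hχ.2.2 h1)]
        with σ hσ
      simp [image_eq_zero_of_notMem_tsupport hσ]
    have h2 : ContinuousAt (fun x : CotSpace d => (ρ.1, x)) ρ.2 := by fun_prop
    have h3 : (fun x : CotSpace d => χ (ρ.1, x) * innerEscape φp φm M ε (ρ.1, x)) =ᶠ[nhds ρ.2]
        fun _ => (0 : ℝ) := h2.eventually h1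
    rw [derivNorm, (Filter.EventuallyEq.iteratedFDeriv ℝ h3 n).eq_of_nhds,
      iteratedFDeriv_const_of_ne (by omega)]
    simp only [Pi.zero_apply, norm_zero]
    positivity

/-- The difference is `χ(ρ)(Ĝ(ρ) - Ĝ(μ)) + (χ(ρ) - χ(μ))Ĝ(μ)`. The first term is covered by slow
variation, the second by `log_inv_mul_le`. Only `μ` needs to be in `V'`, as `χ(ρ)` vanishes outside.
-/
lemma IsRegularizedPair.exists_abs_cutoff_mul_sub_le (h : F.IsRegularizedPair V ε₀ φp φm)
    (hne : F.trapped.Nonempty) (hχ : TestOn (F.enlarge V) χ) (hM : 0 ≤ M) :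
    ∃ B, 0 ≤ B ∧ ∀ ε, 0 < ε → ε < ε₀ → ∀ ρ μ : PhaseSpace d J, dist ρ μ < 1 →
      |χ ρ * innerEscape φp φm M ε ρ - χ μ * innerEscape φp φm M ε μ| ≤
        B * (1 + Real.log (1 + dist ρ μ ^ 2 / ε)) := by
  obtain ⟨X, hX0, hX⟩ := hχ.exists_abs_le
  obtain ⟨L, hL0, hL⟩ := hχ.exists_lipschitz
  obtain ⟨B, hB0, hB⟩ := h.exists_abs_innerEscape_le hne hM
  obtain ⟨B', hB'0, hB'⟩ := h.exists_abs_innerEscape_sub_le hne hM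
  refine ⟨X * (B' + 2) + 2 * (L * B), by positivity, fun ε hε hε' => ?_⟩
  have key : ∀ ρ μ : PhaseSpace d J, dist ρ μ < 1 → μ ∈ F.enlarge V →
      |χ ρ * innerEscape φp φm M ε ρ - χ μ * innerEscape φp φm M ε μ| ≤
        (X * (B' + 2) + 2 * (L * B)) * (1 + Real.log (1 + dist ρ μ ^ 2 / ε)) := by
    intro ρ μ hd hμ
    set Λ := Real.log (1 + dist ρ μ ^ 2 / ε)
    have hΛ : 0 ≤ Λ := Real.log_nonneg (by
      have : 0 ≤ dist ρ μ ^ 2 / ε := by positivity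
      linarith)
    have h1 : Real.log (1 / ε) * dist ρ μ ≤ Λ + 2 := log_inv_mul_le hε dist_nonneg hd.le
    have h2 : |(χ ρ - χ μ) * innerEscape φp φm M ε μ| ≤ L * B * (Λ + 2) := by
      rw [abs_mul]
      calc |χ ρ - χ μ| * |innerEscape φp φm M ε μ|
          ≤ (L * dist ρ μ) * (B * Real.log (1 / ε)) := by
            gcongr
            · exact hL ρ μ hd
            · exact hB ε hε hε' μ hμ
        _ = L * B * (Real.log (1 / ε) * dist ρ μ) := by ring
        _ ≤ L * B * (Λ + 2) := by gcongr
    have h3 : |χ ρ * (innerEscape φp φm M ε ρ - innerEscape φp φm M ε μ)| ≤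
        X * (B' + 2 * Λ) := by
      by_cases hρ : ρ ∈ F.enlarge V
      · rw [abs_mul]
        exact mul_le_mul (hX ρ) (hB' ε hε hε' ρ hρ μ hμ) (abs_nonneg _) hX0
      · rw [hχ.eq_zero hρ, zero_mul, abs_zero]
        positivity
    have h4 : χ ρ * innerEscape φp φm M ε ρ - χ μ * innerEscape φp φm M ε μ =
        χ ρ * (innerEscape φp φm M ε ρ - innerEscape φp φm M ε μ) +
          (χ ρ - χ μ) * innerEscape φp φm M ε μ := by ring
    rw [h4]
    refine (abs_add_le _ _).trans ((add_le_add h3 h2).trans ?_)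
    have h5 : 0 ≤ X * B' * Λ := by positivity
    have h6 : 0 ≤ L * B * Λ := by positivity
    nlinarith
  intro ρ μ hd
  by_cases hμ : μ ∈ F.enlarge V
  · exact key ρ μ hd hμ
  by_cases hρ : ρ ∈ F.enlarge V
  · have := key μ ρ (by rwa [dist_comm]) hρ
    rwa [abs_sub_comm, dist_comm μ ρ] at this
  · rw [hχ.eq_zero hρ, hχ.eq_zero hμ, zero_mul, zero_mul, sub_zero, abs_zero]
    have : 0 ≤ Real.log (1 + dist ρ μ ^ 2 / ε) := Real.log_nonneg (by
      have : 0 ≤ dist ρ μ ^ 2 / ε := by positivity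
      linarith)
    positivity

/-- A power `N` of the square root is the exponential of `N/2` times the logarithm; this is where
`2B ≤ N` comes from. -/
lemma exp_div_exp_le_of_log {ε δ a b A B : ℝ} {N : ℕ} (hε : 0 < ε) (hN : 2 * B ≤ N)
    (h : a - b ≤ A + B * Real.log (1 + δ ^ 2 / ε)) :
    Real.exp a / Real.exp b ≤ Real.exp A * Real.sqrt (1 + (δ / Real.sqrt ε) ^ 2) ^ N := by
  have h1 : (δ / Real.sqrt ε) ^ 2 = δ ^ 2 / ε := by rw [div_pow, Real.sq_sqrt hε.le]
  have h2 : 0 < 1 + δ ^ 2 / ε := by positivity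
  have h3 : 0 ≤ Real.log (1 + δ ^ 2 / ε) := Real.log_nonneg (by
    have : 0 ≤ δ ^ 2 / ε := by positivity
    linarith)
  have h4 : Real.sqrt (1 + δ ^ 2 / ε) ^ N = Real.exp (N * (Real.log (1 + δ ^ 2 / ε) / 2)) := by
    rw [Real.exp_nat_mul, ← Real.log_sqrt h2.le, Real.exp_log (Real.sqrt_pos.2 h2)]
  rw [h1, h4, ← Real.exp_sub, ← Real.exp_add, Real.exp_le_exp]
  nlinarith

end OpenMap

/-! ### The global escape function -/

namespace OpenMap

variable {d J : ℕ} {F : OpenMap d J}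

/-- The estimates for the global escape function. -/
theorem IsRegularizedPair.escapeFunction_estimates {V : Set (PhaseSpace d J)} {ε₀ : ℝ}
    {φp φm : ℝ → PhaseSpace d J → ℝ} (h : F.IsRegularizedPair V ε₀ φp φm)
    (hne : F.trapped.Nonempty) {M C₁ C₇ : ℝ} (hM : 0 ≤ M) (hC₇ : 0 < C₇)
    (hgain : ∀ ε, 0 < ε → ε < ε₀ → ∀ ρ ∈ V,
      -C₇ ≤ innerEscape φp φm M ε (F.Φ ρ) - innerEscape φp φm M ε ρ ∧
      (C₁ * ε ≤ distTo ρ F.trapped ^ 2 →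
        1 / C₁ ≤ innerEscape φp φm M ε (F.Φ ρ) - innerEscape φp φm M ε ρ))
    {W₂ W₃ : Set (PhaseSpace d J)} (hW₂ : W₂ ⊆ V) (hW₃ : V ⊆ W₃) {χ g₀ : PhaseSpace d J → ℝ}
    (hχ : TestOn (F.enlarge V) χ) (hχ1 : ∀ ρ ∈ F.enlarge W₂, χ ρ = 1)
    (hg : F.IsOuterEscape W₂ W₃ g₀) :
    ∃ C₅' > 0, ∀ C₅ ≥ C₅',
      ∃ (C₆ C₇ C₈ C₉ : ℝ) (N₁ : ℕ) (K : ℕ → ℝ),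
        0 < C₆ ∧ 0 < C₇ ∧ 0 < C₈ ∧ 0 < C₉ ∧
        ∀ ε : ℝ, 0 < ε → ε < ε₀ →
          let G := escapeFunction φp φm χ g₀ M C₅ ε
          F.IsTest G ∧
          (∀ ρ, |G ρ| ≤ C₆ * Real.log (1 / ε)) ∧
          (∀ n : ℕ, 1 ≤ n → ∀ ρ, derivNorm n G ρ ≤ K n * ε ^ (-(n : ℝ) / 2)) ∧
          (∀ ρ ∈ W₂, -C₇ ≤ G (F.Φ ρ) - G ρ) ∧
          (∀ ρ ∈ W₂, C₁ * ε ≤ distTo ρ F.trapped ^ 2 → 1 / C₁ ≤ G (F.Φ ρ) - G ρ) ∧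
          (∀ ρ ∈ W₃ \ W₂, C₈ * Real.log (1 / ε) ≤ G (F.Φ ρ) - G ρ) ∧
          (∀ ρ μ, Real.exp (G ρ) / Real.exp (G μ) ≤
            C₉ * Real.sqrt (1 + (phaseDist ρ μ / Real.sqrt ε) ^ 2) ^ N₁) := by
  obtain ⟨hgt, _, hg0, hg1⟩ := hg
  have hgt' : TestOn F.cotY g₀ := hgt
  have hVY : F.enlarge V ⊆ F.cotY := h.enlarge_subset_U.trans F.U_subset_cotY
  obtain ⟨B, hB0, hB⟩ := h.exists_abs_cutoff_mul_le hne hχ hM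
  obtain ⟨B', hB'0, hB'⟩ := h.exists_abs_cutoff_mul_sub_le hne hχ hM
  obtain ⟨X, hX0, hX⟩ := hgt'.exists_abs_le
  obtain ⟨L, hL0, hL⟩ := hgt'.exists_lipschitz
  have hDs := fun n => hgt'.exists_derivNorm_le n
  choose D hD0 hD using hDs
  have hAs : ∀ n : ℕ, ∃ A, 0 ≤ A ∧ (1 ≤ n → ∀ ε, 0 < ε → ε < ε₀ → ∀ ρ,
      derivNorm n (fun ρ => χ ρ * innerEscape φp φm M ε ρ) ρ ≤ A * ε ^ (-(n : ℝ) / 2)) := by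
    intro n
    by_cases hn : 1 ≤ n
    · obtain ⟨A, hA0, hA⟩ := h.exists_derivNorm_cutoff_mul_le hne hχ hM n hn
      exact ⟨A, hA0, fun _ => hA⟩
    · exact ⟨0, le_rfl, fun h1 => absurd h1 hn⟩
  choose A hA0 hA using hAs
  -- One step changes the cut-off part by at most `2B log(1/ε)`; one further `log(1/ε)` from `g₀` is
  -- the net gain, so `C₈ = 1`.
  refine ⟨2 * B + 1, by positivity, fun C₅ hC₅ => ?_⟩
  have hC₅0 : 0 < C₅ := by linarith
  -- The first summand serves for points at distance at least `1`, the others for closer points.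
  set b : ℝ := 2 * (B + C₅ * X) + B' + C₅ * L
  refine ⟨B + C₅ * X + 1, C₇, 1, Real.exp (B' + 2 * (C₅ * L)), ⌈2 * b⌉₊,
    fun n => A n + 2 * C₅ * D n, by positivity, hC₇, one_pos, Real.exp_pos _,
    fun ε hε hε' => ?_⟩
  have hε1 : ε < 1 := hε'.trans h.2.2.2.2.1
  have hlog : 0 ≤ Real.log (1 / ε) := Real.log_nonneg (by rw [le_div_iff₀ hε]; linarith)
  have hcut := h.testOn_cutoff_mul hχ hM hε hε'
  have hscaled : TestOn F.cotY fun ρ => C₅ * Real.log (1 / ε) * g₀ ρ :=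
    ⟨fun j => contDiffOn_const.mul (hgt.1 j), hgt.2.1.mul_left,
      (tsupport_mul_subset_right (g := g₀)).trans hgt.2.2⟩
  have hbound : ∀ ρ, |escapeFunction φp φm χ g₀ M C₅ ε ρ| ≤
      (B + C₅ * X) * Real.log (1 / ε) := by
    intro ρ
    have h1 := hB ε hε hε' ρ
    have h2 : |C₅ * Real.log (1 / ε) * g₀ ρ| ≤ C₅ * Real.log (1 / ε) * X := by
      rw [abs_mul, abs_of_nonneg (by positivity)]
      have := hX ρ
      gcongr
    refine (abs_add_le _ _).trans ((add_le_add h1 h2).trans (le_of_eq ?_))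
    ring
  have hinner : ∀ ρ ∈ W₂, innerEscape φp φm M ε (F.Φ ρ) - innerEscape φp φm M ε ρ ≤
      escapeFunction φp φm χ g₀ M C₅ ε (F.Φ ρ) - escapeFunction φp φm χ g₀ M C₅ ε ρ := by
    intro ρ hρ
    have h1 := mul_nonneg (mul_nonneg hC₅0.le hlog) (hg0 ρ (hW₃ (hW₂ hρ)))
    simp only [escapeFunction, hχ1 ρ (Or.inl hρ), hχ1 (F.Φ ρ) (Or.inr ⟨ρ, hρ, rfl⟩), one_mul]
    linarith
  refine ⟨(hcut.mono hVY).add hscaled, fun ρ => ?_, fun n hn ρ => ?_, fun ρ hρ => ?_,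
    fun ρ hρ hd => ?_, fun ρ hρ => ?_, fun ρ μ => ?_⟩
  · refine (hbound ρ).trans ?_
    exact mul_le_mul_of_nonneg_right (by linarith) hlog
  · have h1 : ContDiffAt ℝ n (fun x : CotSpace d => χ (ρ.1, x) * innerEscape φp φm M ε (ρ.1, x))
        ρ.2 := (hcut.contDiff_slice ρ.1).contDiffAt.of_le (by exact_mod_cast le_top)
    have h2 : ContDiffAt ℝ n (fun x : CotSpace d => g₀ (ρ.1, x)) ρ.2 :=
      (hgt'.contDiff_slice ρ.1).contDiffAt.of_le (by exact_mod_cast le_top)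
    have h3 : ‖iteratedFDeriv ℝ n
        (fun x : CotSpace d => (C₅ * Real.log (1 / ε)) • g₀ (ρ.1, x)) ρ.2‖ ≤
        C₅ * (2 * ε ^ (-(n : ℝ) / 2)) * D n := by
      rw [iteratedFDeriv_const_smul_apply' h2, norm_smul, Real.norm_of_nonneg (by positivity)]
      have h4 := log_inv_le hε n hn hε1
      have h5 : ‖iteratedFDeriv ℝ n (fun x : CotSpace d => g₀ (ρ.1, x)) ρ.2‖ ≤ D n := hD n ρ
      have := hD0 n
      gcongr
    have h6 : derivNorm n (escapeFunction φp φm χ g₀ M C₅ ε) ρ ≤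
        ‖iteratedFDeriv ℝ n (fun x : CotSpace d => χ (ρ.1, x) * innerEscape φp φm M ε (ρ.1, x))
          ρ.2‖ + ‖iteratedFDeriv ℝ n
            (fun x : CotSpace d => (C₅ * Real.log (1 / ε)) • g₀ (ρ.1, x)) ρ.2‖ := by
      have h7 : ContDiffAt ℝ n
          (fun x : CotSpace d => (C₅ * Real.log (1 / ε)) • g₀ (ρ.1, x)) ρ.2 :=
        h2.const_smul (C₅ * Real.log (1 / ε))
      have h8 := fun_iteratedFDeriv_add_apply h1 h7
      simp only [derivNorm, escapeFunction]
      simp only [smul_eq_mul] at h8 ⊢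
      rw [h8]
      exact norm_add_le _ _
    refine h6.trans ((add_le_add (hA n hn ε hε hε' ρ) h3).trans (le_of_eq ?_))
    ring
  · exact (hgain ε hε hε' ρ (hW₂ hρ)).1.trans (hinner ρ hρ)
  · exact ((hgain ε hε hε' ρ (hW₂ hρ)).2 hd).trans (hinner ρ hρ)
  · have h1 := abs_le.1 (hB ε hε hε' ρ)
    have h2 := abs_le.1 (hB ε hε hε' (F.Φ ρ))
    have h3 := mul_le_mul_of_nonneg_left (hg1 ρ hρ) (mul_nonneg hC₅0.le hlog)
    have h4 : (2 * B + 1) * Real.log (1 / ε) ≤ C₅ * Real.log (1 / ε) := by gcongr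
    simp only [escapeFunction]
    linarith [h1.2, h2.1]
  · rw [← phase_dist_def]
    set Λ := Real.log (1 + dist ρ μ ^ 2 / ε)
    have hΛ : 0 ≤ Λ := Real.log_nonneg (by
      have : 0 ≤ dist ρ μ ^ 2 / ε := by positivity
      linarith)
    refine exp_div_exp_le_of_log (B := b) hε (Nat.le_ceil _) ?_
    have hCL : 0 ≤ C₅ * L := by positivity
    have hCX : 0 ≤ C₅ * X := by positivity
    rcases lt_or_ge (dist ρ μ) 1 with hd | hd
    · have h1 := (abs_le.1 (hB' ε hε hε' ρ μ hd)).2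
      have h2 := (abs_le.1 (hL ρ μ hd)).2
      have h3 : Real.log (1 / ε) * dist ρ μ ≤ Λ + 2 := log_inv_mul_le hε dist_nonneg hd.le
      have h4 : C₅ * Real.log (1 / ε) * (g₀ ρ - g₀ μ) ≤ C₅ * L * (Λ + 2) := by
        calc C₅ * Real.log (1 / ε) * (g₀ ρ - g₀ μ)
            ≤ C₅ * Real.log (1 / ε) * (L * dist ρ μ) := by gcongr
          _ = C₅ * L * (Real.log (1 / ε) * dist ρ μ) := by ring
          _ ≤ C₅ * L * (Λ + 2) := by gcongr
      have h5 : 0 ≤ (B + C₅ * X) * Λ := by positivity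
      simp only [escapeFunction, b]
      nlinarith
    -- At distance at least `1`, `log(1/ε) ≤ log(1 + d(ρ, μ)²/ε)`, and the sup bound of `G`
    -- suffices.
    · have h1 := (abs_le.1 (hbound ρ)).2
      have h2 := (abs_le.1 (hbound μ)).1
      have h3 : Real.log (1 / ε) ≤ Λ := by
        refine Real.log_le_log (by positivity) ?_
        have : 1 / ε ≤ dist ρ μ ^ 2 / ε := by gcongr; nlinarith
        linarith
      have h4 : (B + C₅ * X) * Real.log (1 / ε) ≤ (B + C₅ * X) * Λ := by gcongr
      have h5 : 0 ≤ (B' + C₅ * L) * Λ := by positivity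
      simp only [b]
      nlinarith

end OpenMap

end

theorem propositionp (d J : ℕ) (F : OpenMap d J) (hne : F.trapped.Nonempty)
    (hint : F.trapped ⊆ interior F.D) (hF : F.IsHyperbolic) :
    -- regularized distance functions exist in arbitrarily small neighbourhoods of the trapped set
    (∀ N : Set (PhaseSpace d J), F.trapped ⊆ interior N →
      ∃ (V : Set (PhaseSpace d J)) (ε₀ : ℝ) (φp φm : ℝ → PhaseSpace d J → ℝ),
        CompactlyIn V N ∧ F.IsRegularizedPair V ε₀ φp φm) ∧
    -- and every choice of them leads to escape functions
    (∀ (V : Set (PhaseSpace d J)) (ε₀ : ℝ) (φp φm : ℝ → PhaseSpace d J → ℝ),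
      F.IsRegularizedPair V ε₀ φp φm →
      ∃ M₀ > 0, ∀ M ≥ M₀, ∃ C₁ > 0, ∀ W₂ W₃ : Set (PhaseSpace d J),
        F.trapped ⊆ interior W₂ → CompactlyIn W₂ V → CompactlyIn V W₃ → CompactlyIn W₃ F.D →
        (∃ g₀, F.IsOuterEscape W₂ W₃ g₀) ∧
        ∀ χ g₀ : PhaseSpace d J → ℝ,
          SmoothOn χ univ → HasCompactSupport χ → tsupport χ ⊆ F.enlarge V →
          (∀ ρ ∈ F.enlarge W₂, χ ρ = 1) →
          F.IsOuterEscape W₂ W₃ g₀ →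
          ∃ C₅' > 0, ∀ C₅ ≥ C₅',
            ∃ (C₆ C₇ C₈ C₉ : ℝ) (N₁ : ℕ) (K : ℕ → ℝ),
              0 < C₆ ∧ 0 < C₇ ∧ 0 < C₈ ∧ 0 < C₉ ∧
              ∀ ε : ℝ, 0 < ε → ε < ε₀ →
                let G := escapeFunction φp φm χ g₀ M C₅ ε
                F.IsTest G ∧
                (∀ ρ, |G ρ| ≤ C₆ * Real.log (1 / ε)) ∧
                (∀ n : ℕ, 1 ≤ n → ∀ ρ, derivNorm n G ρ ≤ K n * ε ^ (-(n : ℝ) / 2)) ∧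
                (∀ ρ ∈ W₂, -C₇ ≤ G (F.Φ ρ) - G ρ) ∧
                (∀ ρ ∈ W₂, C₁ * ε ≤ distTo ρ F.trapped ^ 2 → 1 / C₁ ≤ G (F.Φ ρ) - G ρ) ∧
                (∀ ρ ∈ W₃ \ W₂, C₈ * Real.log (1 / ε) ≤ G (F.Φ ρ) - G ρ) ∧
                (∀ ρ μ, Real.exp (G ρ) / Real.exp (G μ) ≤
                  C₉ * Real.sqrt (1 + (phaseDist ρ μ / Real.sqrt ε) ^ 2) ^ N₁)) := by
  refine ⟨fun N hN => hF.exists_isRegularizedPair hne hint hN, fun V ε₀ φp φm h => ?_⟩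
  obtain ⟨M₀, hM₀, hgain⟩ := h.exists_gain
  refine ⟨M₀, hM₀, fun M hM => ?_⟩
  obtain ⟨C₁, hC₁, C₇, hC₇, hg⟩ := hgain M hM
  refine ⟨C₁, hC₁, fun W₂ W₃ h₂ h₂V hV₃ h₃ =>
    ⟨F.exists_isOuterEscape h₂ h₃, fun χ g₀ hχ hχc hχV hχ1 hg₀ => ?_⟩⟩
  exact h.escapeFunction_estimates hne (hM₀.le.trans hM) hC₇ hg
    ((subset_closure.trans h₂V.2).trans interior_subset)
    ((subset_closure.trans hV₃.2).trans interior_subset) ⟨hχ, hχc, hχV⟩ hχ1 hg₀
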